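/- There is an algorithm which, given a simple directed graph $G=(V,E)$ (no multiple edges, no self-loops) with $n$ vertices and $m$ edges, real edge weights $w\colon E\to\mathbb{R}$, and an elimination forest of $G$ of depth $k$, computes either a potential on $G$ or a negative cycle of $G$ in $O(k(m+n\log n))$ time (constant time if $n\le 1$). Here an elimination forest of $G$ is a rooted forest on $V$ such that for every edge $uv\in E$ one of $u,v$ is an ancestor of the other; its depth is the maximum number of vertices on a path from a root to a leaf. A potential is a function $p\colon V\to\mathbb{R}$ with $w(uv)+p(u)-p(v)\ge 0$ for every $uv\in E$, and a negative cycle is a directed cycle (with no repeated vertex) of negative total weight. Time is counted in unit-cost steps of a random access machine that can add, subtract and compare real numbers. -/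

import Mathlib

/-! ### Machine model

A successor random access machine with real registers.  A program uses finitely many named scalar
variables and finitely many named arrays; each variable or array cell holds a natural number (a word)
or a real number.  In one step the machine can copy, load or store a word or a real number (arrays
are indexed by word variables), set a word to a constant, add one to or subtract one from a word,
add or subtract two real numbers, or compare two words or two real numbers.  There is no other
arithmetic, and no conversion between words and reals.  So after `t` steps every word is at most `t`
plus the largest number occurring in the input or in the program text: words have logarithmically
many bits for polynomial running times, and the bounds proved for this machine hold on every usual
unit-cost RAM whose reals support addition, subtraction and comparison. -/

namespace RealRAM

/-- The contents of the memory: word variables, word arrays, real variables, real arrays. -/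
structure State where
  var : ℕ → ℕ
  arr : ℕ → ℕ → ℕ
  rvar : ℕ → ℝ
  rarr : ℕ → ℕ → ℝ

namespace State

/-- Assign a value to a word variable. -/
def setVar (s : State) (x v : ℕ) : State :=
  { s with var := Function.update s.var x v }

/-- Assign a value to the cell `i` of the word array `a`. -/
def setArr (s : State) (a i v : ℕ) : State :=
  { s with arr := Function.update s.arr a (Function.update (s.arr a) i v) }

/-- Assign a value to a real variable. -/
noncomputable def setRvar (s : State) (x : ℕ) (r : ℝ) : State :=
  { s with rvar := Function.update s.rvar x r }

/-- Assign a value to the cell `i` of the real array `a`. -/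
noncomputable def setRarr (s : State) (a i : ℕ) (r : ℝ) : State :=
  { s with rarr := Function.update s.rarr a (Function.update (s.rarr a) i r) }

end State

/-- Elementary instructions; all arguments are names of variables and arrays, except for the
constant in `const`. -/
inductive Instr where
  /-- `x := c` -/
  | const (x c : ℕ)
  /-- `x := y` -/
  | copy (x y : ℕ)
  /-- `x := y + 1` -/
  | succ (x y : ℕ)
  /-- `x := y - 1` (and `0` if `y = 0`) -/
  | pred (x y : ℕ)
  /-- `x := a[i]` -/
  | load (x a i : ℕ)
  /-- `a[i] := x` -/
  | store (a i x : ℕ)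
  /-- `x := y` on reals -/
  | rcopy (x y : ℕ)
  /-- `x := y + z` on reals -/
  | radd (x y z : ℕ)
  /-- `x := y - z` on reals -/
  | rsub (x y z : ℕ)
  /-- `x := a[i]` on reals -/
  | rload (x a i : ℕ)
  /-- `a[i] := x` on reals -/
  | rstore (a i x : ℕ)

/-- The effect of an elementary instruction. -/
noncomputable def Instr.apply : Instr → State → State
  | .const x c, s => s.setVar x c
  | .copy x y, s => s.setVar x (s.var y)
  | .succ x y, s => s.setVar x (s.var y + 1)
  | .pred x y, s => s.setVar x (s.var y - 1)
  | .load x a i, s => s.setVar x (s.arr a (s.var i))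
  | .store a i x, s => s.setArr a (s.var i) (s.var x)
  | .rcopy x y, s => s.setRvar x (s.rvar y)
  | .radd x y z, s => s.setRvar x (s.rvar y + s.rvar z)
  | .rsub x y z, s => s.setRvar x (s.rvar y - s.rvar z)
  | .rload x a i, s => s.setRvar x (s.rarr a (s.var i))
  | .rstore a i x, s => s.setRarr a (s.var i) (s.rvar x)

/-- Tests: comparisons of two word variables or of two real variables. -/
inductive Test where
  /-- `x = y` -/
  | eq (x y : ℕ)
  /-- `x ≠ y` -/
  | ne (x y : ℕ)
  /-- `x < y` -/
  | lt (x y : ℕ)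
  /-- `x ≤ y` -/
  | le (x y : ℕ)
  /-- `x < y` on reals -/
  | rlt (x y : ℕ)
  /-- `x ≤ y` on reals -/
  | rle (x y : ℕ)

/-- The test succeeds in the given state. -/
def Test.Holds : Test → State → Prop
  | .eq x y, s => s.var x = s.var y
  | .ne x y, s => s.var x ≠ s.var y
  | .lt x y, s => s.var x < s.var y
  | .le x y, s => s.var x ≤ s.var y
  | .rlt x y, s => s.rvar x < s.rvar y
  | .rle x y, s => s.rvar x ≤ s.rvar y

/-- Programs. -/
inductive Program where
  | instr (i : Instr)
  | seq (p q : Program)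
  | ite (b : Test) (p q : Program)
  | loop (b : Test) (p : Program)

/-- `Exec p s t s'`: started in the state `s`, the program `p` halts after exactly `t` steps in the
state `s'`.  Every instruction and every evaluation of a test is one step. -/
inductive Exec : Program → State → ℕ → State → Prop where
  | instr (i : Instr) (s : State) : Exec (.instr i) s 1 (i.apply s)
  | seq {p q : Program} {s₁ s₂ s₃ : State} {t₁ t₂ : ℕ} :
      Exec p s₁ t₁ s₂ → Exec q s₂ t₂ s₃ → Exec (.seq p q) s₁ (t₁ + t₂) s₃
  | ite_true {b : Test} {p q : Program} {s s' : State} {t : ℕ} :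
      b.Holds s → Exec p s t s' → Exec (.ite b p q) s (1 + t) s'
  | ite_false {b : Test} {p q : Program} {s s' : State} {t : ℕ} :
      ¬ b.Holds s → Exec q s t s' → Exec (.ite b p q) s (1 + t) s'
  | loop_false {b : Test} {p : Program} {s : State} :
      ¬ b.Holds s → Exec (.loop b p) s 1 s
  | loop_true {b : Test} {p : Program} {s₁ s₂ s₃ : State} {t₁ t₂ : ℕ} :
      b.Holds s₁ → Exec p s₁ t₁ s₂ → Exec (.loop b p) s₂ t₂ s₃ →
      Exec (.loop b p) s₁ (1 + t₁ + t₂) s₃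

end RealRAM

/-! ### Rooted forests and elimination forests -/

/-- A rooted forest on the (finite) vertex set `V`, given by its parent map; roots have no parent. -/
structure RootedForest (V : Type*) where
  parent : V → Option V
  acyclic : ∀ v, ¬ Relation.TransGen (fun a b => parent a = some b) v v

namespace RootedForest

variable {V : Type*}

/-- `u` is an ancestor of `v`; every vertex is an ancestor of itself. -/
def IsAncestor (T : RootedForest V) (u v : V) : Prop :=
  Relation.ReflTransGen (fun a b => T.parent a = some b) v u

/-- The number of vertices on the path from the root to `v`, both ends included. -/
noncomputable def level (T : RootedForest V) (v : V) : ℕ :=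
  {u | T.IsAncestor u v}.ncard

/-- The maximum number of vertices on a path that descends from a root. -/
noncomputable def depth [Fintype V] (T : RootedForest V) : ℕ :=
  Finset.univ.sup T.level

/-- `T` is an elimination forest of the directed graph `G`: of the two ends of any edge, one is an
ancestor of the other. -/
def IsEliminationForest (T : RootedForest V) (G : Digraph V) : Prop :=
  ∀ u v, G.Adj u v → T.IsAncestor u v ∨ T.IsAncestor v u

end RootedForest

/-! ### Potentials and negative cycles -/

/-- `p` is a potential: the reduced weight `w u v + p u - p v` of every edge is nonnegative. -/
def IsPotential {V : Type*} (G : Digraph V) (w : V → V → ℝ) (p : V → ℝ) : Prop :=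
  ∀ u v, G.Adj u v → 0 ≤ w u v + p u - p v

/-- `c 0, c 1, …, c l` are distinct vertices that form a directed cycle of negative total weight.
Addition in `Fin (l + 1)` is modulo `l + 1`, so the last edge goes from `c l` back to `c 0`. -/
structure IsNegativeCycle {V : Type*} (G : Digraph V) (w : V → V → ℝ) {l : ℕ}
    (c : Fin (l + 1) → V) : Prop where
  injective : Function.Injective c
  adj : ∀ i, G.Adj (c i) (c (i + 1))
  weight_neg : ∑ i, w (c i) (c (i + 1)) < 0

/-! ### Input and output format -/

/-- The initial memory.  Word variables `0` and `1` hold the number `n` of vertices and the number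
`m` of edges; the word arrays `0` and `1` and the real array `0` hold the tails, the heads and the
weights of the edges in the order `e`; the word array `2` holds the parents in the forest, with `n`
for "no parent".  Everything else is zero. -/
noncomputable def inputState {n m : ℕ} (G : Digraph (Fin n)) (w : Fin n → Fin n → ℝ)
    (T : RootedForest (Fin n)) (e : Fin m ≃ {a : Fin n × Fin n // G.Adj a.1 a.2}) :
    RealRAM.State where
  var x := if x = 0 then n else if x = 1 then m else 0
  arr a i :=
    if a = 0 then (if h : i < m then ((e ⟨i, h⟩).1.1 : ℕ) else 0)
    else if a = 1 then (if h : i < m then ((e ⟨i, h⟩).1.2 : ℕ) else 0)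
    else if a = 2 then
      (if h : i < n then (T.parent ⟨i, h⟩).elim n (fun u => (u : ℕ)) else 0)
    else 0
  rvar _ := 0
  rarr a i :=
    if a = 0 then (if h : i < m then w (e ⟨i, h⟩).1.1 (e ⟨i, h⟩).1.2 else 0) else 0

/-- The final memory holds a potential: word variable `0` is `0` and the real array `0` lists the
values of a potential. -/
def OutputsPotential {n : ℕ} (G : Digraph (Fin n)) (w : Fin n → Fin n → ℝ)
    (s : RealRAM.State) : Prop :=
  s.var 0 = 0 ∧ IsPotential G w (fun v => s.rarr 0 v)

/-- The final memory holds a negative cycle: word variable `0` is `1`, word variable `1` is the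
length of the cycle and the word array `0` lists its vertices in cyclic order. -/
def OutputsNegativeCycle {n : ℕ} (G : Digraph (Fin n)) (w : Fin n → Fin n → ℝ)
    (s : RealRAM.State) : Prop :=
  s.var 0 = 1 ∧ ∃ (l : ℕ) (c : Fin (l + 1) → Fin n), s.var 1 = l + 1 ∧
    (∀ i : Fin (l + 1), s.arr 0 i = c i) ∧ IsNegativeCycle G w c

/-! The levels of the forest are added one at a time, from the deepest to the roots. Suppose that
`p` is a potential on the vertices of level greater than `l` and vanishes on the others. For a
vertex `x` of level greater than `l`, let `D x` be the least value of `p x` plus the weight of a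
path from `x` to a vertex of level `l` whose other vertices have level greater than `l`. Since `p`
makes the reduced weights nonnegative there, `D` can be computed by Dijkstra's algorithm, run
backwards from all vertices of level `l` at once. Replace `p` by `p - D` on the levels greater than
`l` and keep it zero on level `l`. Edges that start at a level greater than `l` satisfy the
potential inequality because they are relaxed. An edge `uv` that leaves level `l` satisfies it
unless `w u v - p v + D v < 0`. In that case the edge closes a negative cycle: no edge leaves a
subtree except towards ancestors, so all vertices of the path that realizes `D v` have the same
ancestor at level `l`. This ancestor is `u`, and the path ends there. No two vertices of level `l`
are adjacent.

Vertices that cannot reach level `l` would have infinite distance. Distances are therefore truncated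
at a number `A` that is at least `p v - w u v` for every edge `uv` leaving level `l`. A truncated
distance then never violates the inequality, and a violation always comes from a genuine path. The
combinatorial core is `Dijkstra.relax`, `Dijkstra.potentialAbove` and `Dijkstra.negativeCycle` in
the namespace `Network`.

There are at most `k` rounds, so it suffices that a round takes `O(m + n log n)` steps. This needs a
priority queue with constant amortized time to decrease a key and logarithmic amortized time to
extract a minimum. A quake heap does this: a forest of tournament trees in which decreasing a key
cuts off the subtree of the item, and every extraction links roots of equal height. If afterwards
the number of nodes fails to shrink by a factor `3 / 4` from some height `q` to the next, all nodes
above height `q` are discarded. Heights thus stay logarithmic between operations. A failure at `q`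
requires many nodes with a single child at height `q + 1`, each of them caused by an earlier cut,
and these pay for the new roots (`two_mul_count_le`, `wp_extract`, `wp_decrease`).

Running times are proved with time credits: a specification relates the credits before and after a
program, so amortization is an inequality between credits and a potential function. What a program
leaves unchanged is read off its text. -/

namespace RealRAM

/-! ### A program logic with time credits -/

/-- Started in `s` with `c` time credits, `P` halts within its credits, and the remaining credits
and the final state satisfy `Q`. -/
def WP (P : Program) (Q : ℕ → State → Prop) (c : ℕ) (s : State) : Prop :=
  ∃ t s', Exec P s t s' ∧ t ≤ c ∧ Q (c - t) s'

/-- The instruction assigns to the word variable. -/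
def Instr.writesVar : Instr → ℕ → Bool
  | .const x _, y => x == y
  | .copy x _, y => x == y
  | .succ x _, y => x == y
  | .pred x _, y => x == y
  | .load x _ _, y => x == y
  | _, _ => false

/-- The instruction assigns to a cell of the word array. -/
def Instr.writesArr : Instr → ℕ → Bool
  | .store a _ _, y => a == y
  | _, _ => false

/-- The instruction assigns to the real variable. -/
def Instr.writesRvar : Instr → ℕ → Bool
  | .rcopy x _, y => x == y
  | .radd x _ _, y => x == y
  | .rsub x _ _, y => x == y
  | .rload x _ _, y => x == y
  | _, _ => false

/-- The instruction assigns to a cell of the real array. -/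
def Instr.writesRarr : Instr → ℕ → Bool
  | .rstore a _ _, y => a == y
  | _, _ => false

/-- Some instruction of the program satisfies `f`. -/
def Program.any (f : Instr → Bool) : Program → Bool
  | .instr i => f i
  | .seq p q => p.any f || q.any f
  | .ite _ p q => p.any f || q.any f
  | .loop _ p => p.any f

/-- The two states agree on everything that the program never assigns to. -/
structure Same (P : Program) (s s' : State) : Prop where
  var : ∀ x, P.any (·.writesVar x) = false → s'.var x = s.var x
  arr : ∀ x, P.any (·.writesArr x) = false → s'.arr x = s.arr x
  rvar : ∀ x, P.any (·.writesRvar x) = false → s'.rvar x = s.rvar x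
  rarr : ∀ x, P.any (·.writesRarr x) = false → s'.rarr x = s.rarr x

theorem Same.refl (P : Program) (s : State) : Same P s s :=
  ⟨fun _ _ => rfl, fun _ _ => rfl, fun _ _ => rfl, fun _ _ => rfl⟩

theorem Same.trans {P : Program} {s₁ s₂ s₃ : State} (h : Same P s₁ s₂) (h' : Same P s₂ s₃) :
    Same P s₁ s₃ :=
  ⟨fun x hx => (h'.var x hx).trans (h.var x hx), fun x hx => (h'.arr x hx).trans (h.arr x hx),
    fun x hx => (h'.rvar x hx).trans (h.rvar x hx),
    fun x hx => (h'.rarr x hx).trans (h.rarr x hx)⟩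

theorem Same.mono {P P' : Program} {s s' : State} (h : Same P s s')
    (hP : ∀ f, P'.any f = false → P.any f = false) : Same P' s s' :=
  ⟨fun x hx => h.var x (hP _ hx), fun x hx => h.arr x (hP _ hx), fun x hx => h.rvar x (hP _ hx),
    fun x hx => h.rarr x (hP _ hx)⟩

theorem same_instr (i : Instr) (s : State) : Same (.instr i) s (i.apply s) := by
  refine ⟨fun x hx => ?_, fun x hx => ?_, fun x hx => ?_, fun x hx => ?_⟩ <;>
    cases i <;>
    first
    | rfl
    | exact Function.update_of_ne (by rintro rfl; exact absurd hx (by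
        simp [Program.any, Instr.writesVar, Instr.writesArr, Instr.writesRvar,
          Instr.writesRarr])) _ _

/-- Soundness of the syntactic frame rule. For concrete programs the side conditions are closed
Boolean terms, so most frame facts below are obtained with `rfl`. -/
theorem Exec.same {P : Program} {s s' : State} {t : ℕ} (h : Exec P s t s') : Same P s s' := by
  induction h with
  | instr i s => exact same_instr i s
  | seq _ _ ih₁ ih₂ =>
    refine (ih₁.mono fun f hf => ?_).trans (ih₂.mono fun f hf => ?_) <;>
      simp_all [Program.any]
  | ite_true _ _ ih => exact ih.mono fun f hf => by simp_all [Program.any]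
  | ite_false _ _ ih => exact ih.mono fun f hf => by simp_all [Program.any]
  | loop_false => exact Same.refl _ _
  | loop_true _ _ _ ih₁ ih₂ => exact (ih₁.mono fun f hf => by simp_all [Program.any]).trans ih₂

/-- Consequence and frame rule in one. Specifications need to mention only what a program writes;
the rest is recovered from `Same` where the specification is used. -/
theorem WP.conseq {P : Program} {Q Q' : ℕ → State → Prop} {c : ℕ} {s : State} (h : WP P Q c s)
    (hQ : ∀ c' s', Same P s s' → Q c' s' → Q' c' s') : WP P Q' c s := by
  obtain ⟨t, s', he, ht, hq⟩ := h
  exact ⟨t, s', he, ht, hQ _ _ he.same hq⟩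

theorem WP.seq {P P' : Program} {Q : ℕ → State → Prop} {c : ℕ} {s : State}
    (h : WP P (WP P' Q) c s) : WP (.seq P P') Q c s := by
  obtain ⟨t, s', he, ht, t', s'', he', ht', hq⟩ := h
  exact ⟨t + t', s'', .seq he he', by omega, by rwa [← Nat.sub_sub]⟩

theorem WP.ite {b : Test} {P P' : Program} {Q : ℕ → State → Prop} {c : ℕ} {s : State}
    (hc : 1 ≤ c) (h : b.Holds s → WP P Q (c - 1) s) (h' : ¬ b.Holds s → WP P' Q (c - 1) s) :
    WP (.ite b P P') Q c s := by
  by_cases hb : b.Holds s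
  · obtain ⟨t, s', he, ht, hq⟩ := h hb
    exact ⟨1 + t, s', .ite_true hb he, by omega, by rwa [← Nat.sub_sub]⟩
  · obtain ⟨t, s', he, ht, hq⟩ := h' hb
    exact ⟨1 + t, s', .ite_false hb he, by omega, by rwa [← Nat.sub_sub]⟩

/-- Every iteration of a loop uses up a credit, so an invariant suffices for termination. -/
theorem WP.loop {b : Test} {P : Program} {Q : ℕ → State → Prop} {c : ℕ} {s : State}
    (I : ℕ → State → Prop) (hI : I c s)
    (step : ∀ c' s', Same (.loop b P) s s' → I c' s' → 1 ≤ c' ∧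
      (b.Holds s' → WP P I (c' - 1) s') ∧ (¬ b.Holds s' → Q (c' - 1) s')) :
    WP (.loop b P) Q c s := by
  suffices H : ∀ c' s', Same (.loop b P) s s' → I c' s' → WP (.loop b P) Q c' s' from
    H c s (Same.refl _ _) hI
  intro c'
  induction c' using Nat.strong_induction_on with
  | _ c' ih =>
    intro s' hs hi
    obtain ⟨h1, ht, hf⟩ := step c' s' hs hi
    by_cases hb : b.Holds s'
    · obtain ⟨t, s₂, he, htc, hi₂⟩ := ht hb
      have hs₂ : Same (.loop b P) s' s₂ := he.same.mono fun f hf => by simpa [Program.any] using hf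
      obtain ⟨t', s₃, he', htc', hq⟩ := ih (c' - 1 - t) (by omega) s₂ (hs.trans hs₂) hi₂
      refine ⟨1 + t + t', s₃, .loop_true hb he he', by omega, ?_⟩
      rwa [← Nat.sub_sub, ← Nat.sub_sub]
    · exact ⟨1, s', .loop_false hb, h1, hf hb⟩

/-- A program without effect on the named memory. -/
def skip : Program := .instr (.copy 99 99)

/-- Straight-line programs. -/
def block : List Instr → Program
  | [] => skip
  | [i] => .instr i
  | i :: j :: l => .seq (.instr i) (block (j :: l))

theorem WP.block {l : List Instr} {Q : ℕ → State → Prop} {c : ℕ} {s : State} (hl : l ≠ [])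
    (hc : l.length ≤ c) (h : Q (c - l.length) (l.foldl (fun s i => i.apply s) s)) :
    WP (block l) Q c s := by
  induction l generalizing c s with
  | nil => exact absurd rfl hl
  | cons i l ih =>
    cases l with
    | nil => exact ⟨1, _, .instr i s, hc, h⟩
    | cons j l =>
      simp only [List.length_cons] at hc h
      refine WP.seq ⟨1, _, .instr i s, by omega, ih (by simp) (by simp; omega) ?_⟩
      have : c - 1 - (j :: l).length = c - (l.length + 1 + 1) := by
        simp only [List.length_cons]; omega
      rw [this]
      exact h

theorem WP.skip {Q : ℕ → State → Prop} {c : ℕ} {s : State} (hc : 1 ≤ c) (h : Q (c - 1) s) :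
    WP skip Q c s := by
  refine ⟨1, _, .instr _ s, hc, ?_⟩
  simpa [Instr.apply, State.setVar] using h

/-- Sequential composition of a list of programs. -/
def chain : List Program → Program
  | [] => skip
  | [p] => p
  | p :: q :: l => .seq p (chain (q :: l))

theorem WP.chain_cons {p q : Program} {l : List Program} {Q : ℕ → State → Prop} {c : ℕ} {s : State}
    (h : WP p (WP (chain (q :: l)) Q) c s) : WP (chain (p :: q :: l)) Q c s :=
  WP.seq h

theorem WP.chain_singleton {p : Program} {Q : ℕ → State → Prop} {c : ℕ} {s : State}
    (h : WP p Q c s) : WP (chain [p]) Q c s :=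
  h

/-! ### Evaluation of memory updates -/

namespace State

variable (s : State)

@[simp] theorem setVar_var_same (x v : ℕ) : (s.setVar x v).var x = v := by simp [setVar]

@[simp] theorem setVar_var_ne {x y : ℕ} (v : ℕ) (h : y ≠ x) : (s.setVar x v).var y = s.var y := by
  simp [setVar, h]

@[simp] theorem setVar_arr (x v : ℕ) : (s.setVar x v).arr = s.arr := rfl

@[simp] theorem setVar_rvar (x v : ℕ) : (s.setVar x v).rvar = s.rvar := rfl

@[simp] theorem setVar_rarr (x v : ℕ) : (s.setVar x v).rarr = s.rarr := rfl

@[simp] theorem setArr_var (a i v : ℕ) : (s.setArr a i v).var = s.var := rfl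

@[simp] theorem setArr_arr_same (a i v : ℕ) :
    (s.setArr a i v).arr a = Function.update (s.arr a) i v := by simp [setArr]

@[simp] theorem setArr_arr_ne {a b : ℕ} (i v : ℕ) (h : b ≠ a) :
    (s.setArr a i v).arr b = s.arr b := by simp [setArr, h]

@[simp] theorem setArr_rvar (a i v : ℕ) : (s.setArr a i v).rvar = s.rvar := rfl

@[simp] theorem setArr_rarr (a i v : ℕ) : (s.setArr a i v).rarr = s.rarr := rfl

@[simp] theorem setRvar_var (x : ℕ) (r : ℝ) : (s.setRvar x r).var = s.var := rfl

@[simp] theorem setRvar_arr (x : ℕ) (r : ℝ) : (s.setRvar x r).arr = s.arr := rfl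

@[simp] theorem setRvar_rvar_same (x : ℕ) (r : ℝ) : (s.setRvar x r).rvar x = r := by
  simp [setRvar]

@[simp] theorem setRvar_rvar_ne {x y : ℕ} (r : ℝ) (h : y ≠ x) :
    (s.setRvar x r).rvar y = s.rvar y := by simp [setRvar, h]

@[simp] theorem setRvar_rarr (x : ℕ) (r : ℝ) : (s.setRvar x r).rarr = s.rarr := rfl

@[simp] theorem setRarr_var (a i : ℕ) (r : ℝ) : (s.setRarr a i r).var = s.var := rfl

@[simp] theorem setRarr_arr (a i : ℕ) (r : ℝ) : (s.setRarr a i r).arr = s.arr := rfl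

@[simp] theorem setRarr_rvar (a i : ℕ) (r : ℝ) : (s.setRarr a i r).rvar = s.rvar := rfl

@[simp] theorem setRarr_rarr_same (a i : ℕ) (r : ℝ) :
    (s.setRarr a i r).rarr a = Function.update (s.rarr a) i r := by simp [setRarr]

end State

end RealRAM

namespace RealRAM

/-! ### The program -/

/-! Word variables -/

notation "vN" => 0
notation "vM" => 1
notation "vL" => 2
notation "vI" => 3
notation "vA" => 4
notation "vB" => 5
notation "vC" => 6
notation "vH" => 7
notation "vX" => 8
notation "vE" => 9
notation "vNew" => 10
notation "vR" => 11
notation "vJ" => 12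
notation "vQ" => 13
notation "vU" => 14
notation "vV" => 15
notation "vF" => 16
notation "vS" => 17
-- No instruction of the program assigns to `vZ` or to `rZ`, so both keep their initial value and
-- serve as the constant zero. Zero is also the null pointer of the linked structures.
notation "vZ" => 18

/-! Word arrays -/

notation "aTl" => 0
notation "aHd" => 1
notation "aPa" => 2
notation "aLev" => 3
notation "aFst" => 4
notation "aNxe" => 5
notation "aNxt" => 6
notation "aOwn" => 7
notation "aLc" => 8
notation "aRc" => 9
notation "aPar" => 10
notation "aHt" => 11
notation "aTop" => 12
notation "aRs" => 13
notation "aBk" => 14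
notation "aCnt" => 15
notation "aTq" => 16

/-! Real variables and real arrays -/

notation "rZ" => 0
notation "rA" => 1
notation "rT" => 2
notation "rS" => 3
notation "fW" => 0
notation "fP" => 1
notation "fD" => 2

open Instr Test Program

/-- Compute the levels of all vertices and their maximum. -/
def levelsP : Program := chain [
  block [const vI 0, const vL 0],
  loop (lt vI vN) (chain [
    block [const vC 0, copy vA vI],
    loop (ne vA vN) (block [succ vC vC, load vA aPa vA]),
    block [store aLev vI vC, succ vI vI],
    ite (lt vL vC) (block [copy vL vC]) skip])]

/-- Link the edges with the same head; an edge `e` is represented by `e + 1`. -/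
def adjacencyP : Program := chain [
  block [const vI 0],
  loop (lt vI vM) (block [load vA aHd vI, load vB aFst vA, store aNxe vI vB, succ vI vI,
    store aFst vA vI])]

/-- Tabulate `x ↦ ⌈3 * x / 4⌉`. -/
def tableP : Program := chain [
  block [const vI 0, const vA 0, const vB 3],
  loop (le vI vN) (chain [
    block [store aTq vI vA, succ vI vI],
    ite (eq vB vZ) (block [const vB 3]) (block [pred vB vB, succ vA vA])])]

/-- Compute the value at which distances are truncated. -/
def capP : Program := chain [
  block [const vI 0, rcopy rA rZ],
  loop (lt vI vM) (chain [
    block [load vA aTl vI, load vB aHd vI, load vC aLev vA, load vH aLev vB],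
    ite (eq vC vL)
      (ite (lt vL vH)
        (chain [
          block [rload rT fW vI, rload rS fP vB, rsub rT rS rT],
          ite (rlt rA rT) (block [rcopy rA rT]) skip])
        skip)
      skip,
    block [succ vI vI]])]

/-- Initialize the distances. -/
def initP : Program := chain [
  block [const vI 0],
  loop (lt vI vN) (block [rstore fD vI rA, succ vI vI])]

/-- Enter the edges into the current level. -/
def seedP : Program := chain [
  block [const vI 0],
  loop (lt vI vM) (chain [
    block [load vA aTl vI, load vB aHd vI, load vC aLev vA, load vH aLev vB],
    ite (eq vH vL)
      (ite (lt vL vC)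
        (chain [
          block [rload rT fW vI, rload rS fP vA, radd rT rT rS, rload rS fD vA],
          ite (rlt rT rS) (block [rstore fD vA rT, store aNxt vA vB]) skip])
        skip)
      skip,
    block [succ vI vI]])]

/-- Put all vertices above the current level into the priority queue. -/
def buildP : Program := chain [
  block [const vI 0, const vNew 1, const vR 0],
  loop (lt vI vN) (chain [
    block [load vC aLev vI],
    ite (lt vL vC)
      (block [store aOwn vNew vI, store aHt vNew vZ, store aPar vNew vZ, store aTop vI vNew,
        store aRs vR vNew, succ vNew vNew, succ vR vR, load vA aCnt vZ, succ vA vA,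
        store aCnt vZ vA])
      skip,
    block [succ vI vI]])]

/-- Find the position of a root with minimum key. -/
def minP : Program := chain [
  block [const vJ 0, const vI 1, load vA aRs vJ, load vB aOwn vA, rload rT fD vB],
  loop (lt vI vR) (chain [
    block [load vA aRs vI, load vB aOwn vA, rload rS fD vB],
    ite (rlt rS rT) (block [copy vJ vI, rcopy rT rS]) skip,
    block [succ vI vI]])]

/-- Remove nodes from the top of the `vJ`-th tree until its height is at most `vQ`. -/
def crackP : Program := chain [
  block [load vC aRs vJ, load vH aHt vC],
  loop (lt vQ vH) (chain [
    block [load vA aLc vC, load vB aRc vC, load vX aOwn vC, store aTop vX vA, store aPar vA vZ,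
      store aRs vJ vA, load vX aCnt vH, pred vX vX, store aCnt vH vX],
    ite (ne vB vZ) (block [store aPar vB vZ, store aRs vR vB, succ vR vR]) skip,
    block [load vC aRs vJ, load vH aHt vC]])]

/-- Remove the leaf that forms the `vJ`-th tree. -/
def dropP : Program :=
  block [load vC aRs vJ, load vU aOwn vC, pred vR vR, load vA aRs vR, store aRs vJ vA,
    load vA aCnt vZ, pred vA vA, store aCnt vZ vA]

/-- Link trees of the same height until the heights are distinct, and sort them into the
buckets. -/
def linkP : Program :=
  loop (ne vR vZ) (chain [
    block [pred vJ vR, load vC aRs vJ, load vH aHt vC, load vB aBk vH],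
    ite (eq vB vZ)
      (block [store aBk vH vC, copy vR vJ])
      (chain [
        block [store aBk vH vZ, load vA aOwn vC, load vX aOwn vB, rload rT fD vA, rload rS fD vX],
        ite (rlt rS rT) (block [copy vA vX, copy vX vC, copy vC vB, copy vB vX]) skip,
        block [store aOwn vNew vA, store aLc vNew vC, store aRc vNew vB, store aPar vNew vZ,
          store aPar vC vNew, store aPar vB vNew, store aTop vA vNew, succ vH vH,
          store aHt vNew vH, load vX aCnt vH, succ vX vX, store aCnt vH vX, store aRs vJ vNew,
          succ vNew vNew]])])

/-- Empty the buckets. -/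
def unbucketP : Program := chain [
  block [const vH 0, load vX aCnt vH],
  loop (ne vX vZ) (chain [
    block [load vB aBk vH],
    ite (ne vB vZ) (block [store aBk vH vZ, store aRs vR vB, succ vR vR]) skip,
    block [succ vH vH, load vX aCnt vH]])]

/-- Find the first height at which the number of nodes does not decrease sufficiently. -/
def scanP : Program := chain [
  block [const vQ 0, load vA aCnt vQ, load vB aTq vA, succ vC vQ, load vC aCnt vC],
  loop (lt vC vB) (block [succ vQ vQ, load vA aCnt vQ, load vB aTq vA, succ vC vQ,
    load vC aCnt vC])]

/-- Remove all nodes above the height `vQ`. -/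
def quakeP : Program := chain [
  block [const vJ 0],
  loop (lt vJ vR) (chain [crackP, block [succ vJ vJ]])]

/-- Remove a vertex of minimum key from the forest. -/
def popP : Program := chain [minP, block [const vQ 0], crackP, dropP]

/-- Extract a vertex of minimum key. -/
def extractP : Program := chain [popP, linkP, unbucketP, scanP, quakeP]

/-- Restore the priority queue after the key of `vV` was decreased. -/
def decreaseP : Program := chain [
  block [load vC aTop vV, load vB aPar vC],
  ite (ne vB vZ)
    (block [store aRc vB vZ, store aPar vC vZ, store aRs vR vC, succ vR vR]) skip]

/-- Relax the edges into `vU`. -/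
def relaxP : Program := chain [
  block [load vE aFst vU],
  loop (ne vE vZ) (chain [
    block [pred vE vE, load vV aTl vE, load vC aLev vV],
    ite (lt vL vC)
      (chain [
        block [rload rT fD vU, rload rS fW vE, radd rT rT rS, rload rS fP vV, radd rT rT rS,
          rload rS fP vU, rsub rT rT rS, rload rS fD vV],
        ite (rlt rT rS)
          (chain [block [rstore fD vV rT, store aNxt vV vU], decreaseP]) skip])
      skip,
    block [load vE aNxe vE]])]

/-- Dijkstra's algorithm. -/
def dijkstraP : Program :=
  loop (ne vR vZ) (chain [extractP, relaxP])

/-- Look for an edge from the current level that closes a negative cycle. -/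
def checkP : Program := chain [
  block [const vI 0],
  loop (lt vI vM) (chain [
    block [load vA aTl vI, load vB aHd vI, load vC aLev vA, load vH aLev vB],
    ite (eq vC vL)
      (ite (lt vL vH)
        (chain [
          block [rload rT fW vI, rload rS fP vB, rsub rT rT rS, rload rS fD vB, radd rT rT rS],
          ite (rlt rT rZ) (block [const vF 1, copy vS vB]) skip])
        skip)
      skip,
    block [succ vI vI]])]

/-- Update the potential. -/
def updateP : Program := chain [
  block [const vI 0],
  loop (lt vI vN) (chain [
    block [load vC aLev vI],
    ite (lt vL vC) (block [rload rT fP vI, rload rS fD vI, rsub rT rT rS, rstore fP vI rT]) skip,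
    block [succ vI vI]])]

/-- Write the negative cycle through `vS` to the output array. -/
def cycleP : Program := chain [
  block [copy vC vS, const vI 0, load vA aLev vC],
  loop (ne vA vL) (block [store aTl vI vC, succ vI vI, load vC aNxt vC, load vA aLev vC]),
  block [store aTl vI vC, succ vI vI, copy vS vI]]

/-- Extend the potential to the current level, or find a negative cycle. -/
def roundP : Program := chain [capP, initP, seedP, buildP, dijkstraP, checkP,
  ite (eq vF vZ) (chain [updateP, block [pred vL vL]]) (chain [cycleP, block [const vL 0]])]

/-- Copy the potential to the output array. -/
def outputP : Program := chain [
  block [const vI 0],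
  loop (lt vI vN) (block [rload rT fP vI, rstore fW vI rT, succ vI vI]),
  block [const vN 0]]

/-- The whole algorithm. -/
def mainP : Program := chain [levelsP, adjacencyP, tableP, loop (ne vL vZ) roundP,
  ite (eq vF vZ) outputP (block [const vN 1, copy vM vS])]

end RealRAM

/-! ### Tournament forests -/

/-- A forest of tournaments.  A node `c` of height `ht c > 0` has the left child `lc c`, which has
the same owner, and possibly (if `rc c ≠ 0`) a right child, whose owner has a larger key.  The
highest node that belongs to `x` is `top x`. -/
structure Tournament (own lc rc par ht top : ℕ → ℕ) (key : ℕ → ℝ) (alive live : Finset ℕ) :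
    Prop where
  pos : ∀ c ∈ alive, c ≠ 0
  left : ∀ c ∈ alive, 0 < ht c →
    lc c ∈ alive ∧ ht (lc c) + 1 = ht c ∧ own (lc c) = own c ∧ par (lc c) = c
  right : ∀ c ∈ alive, 0 < ht c → rc c ≠ 0 →
    rc c ∈ alive ∧ ht (rc c) + 1 = ht c ∧ own (rc c) ≠ own c ∧ par (rc c) = c ∧
      top (own (rc c)) = rc c ∧ key (own c) ≤ key (own (rc c))
  parent : ∀ c ∈ alive, par c ≠ 0 → par c ∈ alive ∧ 0 < ht (par c)
  eq_right : ∀ c ∈ alive, c = top (own c) → par c ≠ 0 → rc (par c) = c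
  eq_left : ∀ c ∈ alive, c ≠ top (own c) → par c ≠ 0 ∧ lc (par c) = c
  owner : ∀ c ∈ alive, own c ∈ live
  topmost : ∀ x ∈ live, top x ∈ alive ∧ own (top x) = x

namespace Tournament

open Function

variable {own lc rc par ht top : ℕ → ℕ} {key : ℕ → ℝ} {alive live : Finset ℕ}

theorem empty (own lc rc par ht top : ℕ → ℕ) (key : ℕ → ℝ) :
    Tournament own lc rc par ht top key ∅ ∅ := by
  constructor <;> simp

/-- The local conditions at a node. -/
theorem node (h : Tournament own lc rc par ht top key alive live) (c : ℕ) (hc : c ∈ alive) :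
    c ≠ 0 ∧ own c ∈ live ∧ top (own c) ∈ alive ∧ own (top (own c)) = own c ∧
    (0 < ht c →
      lc c ∈ alive ∧ ht (lc c) + 1 = ht c ∧ own (lc c) = own c ∧ par (lc c) = c) ∧
    (0 < ht c → rc c ≠ 0 →
      rc c ∈ alive ∧ ht (rc c) + 1 = ht c ∧ own (rc c) ≠ own c ∧ par (rc c) = c ∧
        top (own (rc c)) = rc c ∧ key (own c) ≤ key (own (rc c))) ∧
    (par c ≠ 0 → par c ∈ alive ∧ 0 < ht (par c)) ∧
    (c = top (own c) → par c ≠ 0 → rc (par c) = c) ∧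
    (c ≠ top (own c) → par c ≠ 0 ∧ lc (par c) = c) :=
  ⟨h.pos c hc, h.owner c hc, (h.topmost _ (h.owner c hc)).1, (h.topmost _ (h.owner c hc)).2,
    h.left c hc, h.right c hc, h.parent c hc, h.eq_right c hc, h.eq_left c hc⟩

/-- All updates of the forest change pointers around a single node or a pair of nodes. Every
condition therefore follows by case distinction from the local conditions `node` at the nodes
involved and their children. -/
theorem insert_leaf (h : Tournament own lc rc par ht top key alive live) {c x : ℕ} (hx : x ∉ live)
    (hc : c ∉ alive) (h0 : c ≠ 0) :
    Tournament (update own c x) lc rc (update par c 0) (update ht c 0) (update top x c) key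
      (insert c alive) (insert x live) := by
  have H := h.node
  have X := h.topmost
  clear h
  constructor <;> intro d hd <;> simp only [update_apply, Finset.mem_insert] at hd ⊢ <;>
    have h1 := H d <;> have h2 := X d <;> have h3 := H (rc d) <;> clear H X <;>
    rcases hd with rfl | hd <;> grind

theorem remove_root (h : Tournament own lc rc par ht top key alive live) {c : ℕ} (hc : c ∈ alive)
    (hp : par c = 0) (hh : 0 < ht c) (hr : rc c = 0) :
    Tournament own lc rc (update par (lc c) 0) ht (update top (own c) (lc c)) key
      (alive.erase c) live := by
  have H := h.node
  have X := h.topmost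
  clear h
  constructor <;> intro d hd <;> simp only [update_apply, Finset.mem_erase] at hd ⊢ <;>
    have h1 := H d <;> have h2 := X d <;> have h3 := H c hc <;> have h4 := H (lc d) <;>
    have h5 := H (rc d) <;> clear H X <;> grind

/-- The right child is already the topmost node of its owner, so only the left child needs a new
entry in `top` when both become roots. -/
theorem remove_root_right (h : Tournament own lc rc par ht top key alive live) {c : ℕ}
    (hc : c ∈ alive) (hp : par c = 0) (hh : 0 < ht c) (hr : rc c ≠ 0) :
    Tournament own lc rc (update (update par (lc c) 0) (rc c) 0) ht (update top (own c) (lc c)) key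
      (alive.erase c) live := by
  have H := h.node
  have X := h.topmost
  clear h
  constructor <;> intro d hd <;> simp only [update_apply, Finset.mem_erase] at hd ⊢ <;>
    have h1 := H d <;> have h2 := X d <;> have h3 := H c hc <;> have h4 := H (lc d) <;>
    have h5 := H (rc d) <;> clear H X <;> grind

theorem link (h : Tournament own lc rc par ht top key alive live) {a b d : ℕ}
    (ha : a ∈ alive) (hb : b ∈ alive) (hpa : par a = 0) (hpb : par b = 0) (hab : a ≠ b)
    (hh : ht a = ht b) (hd : d ∉ alive) (h0 : d ≠ 0) (hk : key (own a) ≤ key (own b)) :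
    Tournament (update own d (own a)) (update lc d a) (update rc d b)
      (update (update (update par d 0) a d) b d) (update ht d (ht a + 1)) (update top (own a) d) key
      (insert d alive) live := by
  have H := h.node
  have X := h.topmost
  clear h
  constructor <;> intro e he <;> simp only [update_apply, Finset.mem_insert] at he ⊢ <;>
    have h1 := H e <;> have h2 := X e <;> have h3 := H a ha <;> have h4 := H b hb <;>
    clear H X <;> grind

/-- The key of `x` could only become too small at a right child owned by `x`. Such a child would be
`top x`, which is a root. -/
theorem decrease_root (h : Tournament own lc rc par ht top key alive live) {x : ℕ} {r : ℝ}
    (hr : r ≤ key x) (hp : par (top x) = 0) :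
    Tournament own lc rc par ht top (update key x r) alive live := by
  refine ⟨h.pos, h.left, fun c hc hh hr0 => ?_, h.parent, h.eq_right, h.eq_left, h.owner,
    h.topmost⟩
  have h1 := h.right c hc hh hr0
  have h2 := h.pos c hc
  simp only [update_apply]
  clear h
  grind

/-- A topmost node that is not a root is a right child by `eq_right`. Clearing the right pointer of
its parent keeps the left spine of the parent intact and removes the only key comparison that the
smaller key could violate. -/
theorem cut (h : Tournament own lc rc par ht top key alive live) {x : ℕ} (hx : x ∈ live)
    {r : ℝ} (hr : r ≤ key x) (hp : par (top x) ≠ 0) :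
    Tournament own lc (update rc (par (top x)) 0) (update par (top x) 0) ht top
      (update key x r) alive live := by
  have H := h.node
  have h3 := H _ (h.topmost x hx).1
  have h4 := (h.topmost x hx).2
  have X := h.topmost
  clear h
  constructor <;> intro e he <;> (try simp only [update_apply]) <;>
    have h1 := H e <;> have h2 := X e <;> clear H X <;> grind

/-- A root is the topmost node of its owner by `eq_left`. The highest other node with this owner
would be a left child, and its parent has the same owner and is higher still; it is not `c`, which
has height zero. -/
theorem eq_of_own_eq (h : Tournament own lc rc par ht top key alive live) {c : ℕ} (hc : c ∈ alive)
    (hp : par c = 0) (hh : ht c = 0) {c' : ℕ} (hc' : c' ∈ alive) (ho : own c' = own c) :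
    c' = c := by
  by_contra hne
  have hf : (alive.filter fun d => own d = own c ∧ d ≠ c).Nonempty :=
    ⟨c', by simp [hc', ho, hne]⟩
  obtain ⟨d, hd, hmax⟩ := Finset.exists_max_image _ ht hf
  simp only [Finset.mem_filter] at hd hmax
  have h1 := h.eq_left d hd.1
  have h2 := h.parent d hd.1
  have h3 := h.left (par d)
  have h4 := h.eq_left c hc
  have h5 := hmax (par d)
  clear hmax h
  grind

theorem remove_leaf (h : Tournament own lc rc par ht top key alive live) {c : ℕ} (hc : c ∈ alive)
    (hp : par c = 0) (hh : ht c = 0) :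
    Tournament own lc rc par ht top key (alive.erase c) (live.erase (own c)) := by
  have hu : ∀ c' ∈ alive, own c' = own c → c' = c := fun c' hc' ho => h.eq_of_own_eq hc hp hh hc' ho
  have H := h.node
  have X := h.topmost
  clear h
  constructor <;> intro e he <;> simp only [Finset.mem_erase] at he ⊢ <;>
    have h1 := H e <;> have h2 := X e <;> have h3 := H c hc <;> have h4 := hu e <;>
    have h5 := hu (top e) <;> clear H X hu <;> grind

/-- Every node lies below some root. -/
theorem exists_root (h : Tournament own lc rc par ht top key alive live) {c : ℕ} (hc : c ∈ alive) :
    ∃ r ∈ alive, par r = 0 ∧ ht c ≤ ht r ∧ key (own r) ≤ key (own c) := by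
  -- A highest node among those at least as high as `c` and with no larger key is a root, since its
  -- parent would qualify as well.
  obtain ⟨r, hr, hmax⟩ := Finset.exists_max_image
    (alive.filter fun d => ht c ≤ ht d ∧ key (own d) ≤ key (own c)) ht ⟨c, by simp [hc]⟩
  simp only [Finset.mem_filter] at hr hmax
  refine ⟨r, hr.1, ?_, hr.2.1, hr.2.2⟩
  by_contra hp
  have := h.parent r hr.1 hp
  have h1 := h.node r hr.1
  have h2 := h.node (par r) this.1
  have hk : key (own (par r)) ≤ key (own r) := by clear h hmax; grind
  have hl : ht r + 1 = ht (par r) := by clear h hmax; grind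
  have := hmax (par r) ⟨this.1, by omega, hk.trans hr.2.2⟩
  omega

/-- The number of nodes of height `i`. -/
def count (ht : ℕ → ℕ) (alive : Finset ℕ) (i : ℕ) : ℕ :=
  (alive.filter fun c => ht c = i).card

/-- The number of inner nodes without right child. -/
def defects (rc ht : ℕ → ℕ) (alive : Finset ℕ) : ℕ :=
  (alive.filter fun c => 0 < ht c ∧ rc c = 0).card

/-- The set of roots. -/
def rootSet (par : ℕ → ℕ) (alive : Finset ℕ) : Finset ℕ :=
  alive.filter fun c => par c = 0

/-- All children of the nodes of height `i + 1` are distinct nodes of height `i`. Every such parent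
has a left child, and all but the defective ones also have a right child. -/
theorem two_mul_count_le (h : Tournament own lc rc par ht top key alive live) (i : ℕ) :
    2 * count ht alive (i + 1) ≤
      count ht alive i + (alive.filter fun c => ht c = i + 1 ∧ rc c = 0).card := by
  set A := alive.filter fun c => ht c = i + 1 with hA
  have hsplit : A.card = (A.filter fun c => rc c = 0).card + (A.filter fun c => rc c ≠ 0).card :=
    (Finset.card_filter_add_card_filter_not _).symm
  have hmem : ∀ c ∈ A, c ∈ alive ∧ ht c = i + 1 := by simp [hA]
  have hl : (A.image lc).card = A.card := Finset.card_image_of_injOn fun c hc d hd hcd => by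
    have hc := hmem c hc
    have hd := hmem d hd
    have h1 := h.left c hc.1 (by omega)
    have h2 := h.left d hd.1 (by omega)
    clear h; grind
  have hr : ((A.filter fun c => rc c ≠ 0).image rc).card = (A.filter fun c => rc c ≠ 0).card :=
    Finset.card_image_of_injOn fun c hc d hd hcd => by
      simp only [Finset.coe_filter, Set.mem_ofPred_eq] at hc hd
      have hc' := hmem c hc.1
      have hd' := hmem d hd.1
      have h1 := h.right c hc'.1 (by omega) hc.2
      have h2 := h.right d hd'.1 (by omega) hd.2
      clear h; grind
  have hdisj : Disjoint (A.image lc) ((A.filter fun c => rc c ≠ 0).image rc) := by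
    rw [Finset.disjoint_left]
    intro x hx hx'
    simp only [Finset.mem_image, Finset.mem_filter] at hx hx'
    obtain ⟨c, hc, rfl⟩ := hx
    obtain ⟨d, ⟨hd, hd0⟩, he⟩ := hx'
    have hc := hmem c hc
    have hd := hmem d hd
    have h1 := h.left c hc.1 (by omega)
    have h2 := h.right d hd.1 (by omega) hd0
    clear h; grind
  have hsub : A.image lc ∪ (A.filter fun c => rc c ≠ 0).image rc ⊆
      alive.filter fun c => ht c = i := by
    intro x hx
    simp only [Finset.mem_union, Finset.mem_image, Finset.mem_filter] at hx ⊢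
    rcases hx with ⟨c, hc, rfl⟩ | ⟨c, ⟨hc, hc0⟩, rfl⟩
    · have hc := hmem c hc
      have h1 := h.left c hc.1 (by omega)
      exact ⟨h1.1, by omega⟩
    · have hc := hmem c hc
      have h1 := h.right c hc.1 (by omega) hc0
      exact ⟨h1.1, by omega⟩
  have hle := Finset.card_le_card hsub
  rw [Finset.card_union_of_disjoint hdisj, hl, hr] at hle
  have hB : (A.filter fun c => rc c = 0) = alive.filter fun c => ht c = i + 1 ∧ rc c = 0 := by
    rw [hA, Finset.filter_filter]
  rw [hB] at hsplit
  have hc : count ht alive (i + 1) = A.card := rfl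
  have hc' : count ht alive i = (alive.filter fun c => ht c = i).card := rfl
  omega

theorem count_succ_le (h : Tournament own lc rc par ht top key alive live) (i : ℕ) :
    count ht alive (i + 1) ≤ count ht alive i := by
  refine Finset.card_le_card_of_injOn lc (fun c hc => ?_) fun c hc d hd hcd => ?_
  · simp only [Finset.coe_filter, Set.mem_ofPred_eq] at hc ⊢
    have h1 := h.left c hc.1 (by omega)
    exact ⟨h1.1, by omega⟩
  · simp only [Finset.coe_filter, Set.mem_ofPred_eq] at hc hd
    have h1 := h.left c hc.1 (by omega)
    have h2 := h.left d hd.1 (by omega)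
    clear h; grind

theorem count_ne_zero (h : Tournament own lc rc par ht top key alive live) {c i : ℕ}
    (hc : c ∈ alive) (hi : i ≤ ht c) : count ht alive i ≠ 0 := by
  have h1 : 0 < count ht alive (ht c) := Finset.card_pos.2 ⟨c, by simp [hc]⟩
  have h2 : count ht alive (ht c) ≤ count ht alive i :=
    antitone_nat_of_succ_le h.count_succ_le hi
  omega

/-- Every height up to `ht c` occurs. This crude bound serves while nodes above the cut-off height
are being discarded, when the geometric decay may fail. -/
theorem ht_lt_card (h : Tournament own lc rc par ht top key alive live) {c : ℕ} (hc : c ∈ alive) :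
    ht c < alive.card := by
  have hs : Finset.range (ht c + 1) ⊆ alive.image ht := by
    intro i hi
    have := h.count_ne_zero hc (Nat.lt_succ_iff.1 (Finset.mem_range.1 hi))
    obtain ⟨d, hd⟩ := Finset.card_pos.1 (Nat.pos_of_ne_zero this)
    simp only [Finset.mem_filter] at hd
    exact Finset.mem_image.2 ⟨d, hd⟩
  have := (Finset.card_le_card hs).trans Finset.card_image_le
  simpa using this

end Tournament

/-- A sequence that decreases geometrically is zero after logarithmically many steps. -/
theorem lt_log_of_decay {f : ℕ → ℕ} {n q : ℕ} (hn : f 0 ≤ n) (hq : ∀ i < q, 4 * f (i + 1) ≤ 3 * f i)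
    (h0 : f q ≠ 0) : q < 3 * (Nat.log 2 n + 1) := by
  -- Three steps reduce the value at least by half, because `(3 / 4) ^ 3 < 1 / 2`.
  have hp : ∀ j, 3 * j ≤ q → f (3 * j) * 2 ^ j ≤ n := by
    intro j hj
    induction j with
    | zero => simpa using hn
    | succ j ih =>
      have h1 := hq (3 * j) (by omega)
      have h2 := hq (3 * j + 1) (by omega)
      have h3 := hq (3 * j + 1 + 1) (by omega)
      have h4 : 2 * f (3 * (j + 1)) ≤ f (3 * j) := by
        rw [show 3 * (j + 1) = 3 * j + 1 + 1 + 1 by ring]; omega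
      calc f (3 * (j + 1)) * 2 ^ (j + 1) = (2 * f (3 * (j + 1))) * 2 ^ j := by ring
        _ ≤ f (3 * j) * 2 ^ j := Nat.mul_le_mul_right _ h4
        _ ≤ n := ih (by omega)
  -- Otherwise the sequence would be below `1` at the index `3 * (Nat.log 2 n + 1) ≤ q`, although it
  -- decreases to `f q ≥ 1`.
  by_contra hlt
  have hmono : ∀ d, d ≤ q → f q ≤ f (q - d) := by
    intro d hd
    induction d with
    | zero => rfl
    | succ d ih =>
      have h1 := hq (q - (d + 1)) (by omega)
      rw [show q - (d + 1) + 1 = q - d by omega] at h1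
      have := ih (by omega)
      omega
  have h2 := hmono (q - 3 * (Nat.log 2 n + 1)) (by omega)
  rw [show q - (q - 3 * (Nat.log 2 n + 1)) = 3 * (Nat.log 2 n + 1) by omega] at h2
  have h3 := hp (Nat.log 2 n + 1) (by omega)
  have h4 : n < 2 ^ (Nat.log 2 n + 1) := Nat.lt_pow_succ_log_self (by norm_num) n
  have h5 : 1 ≤ f (3 * (Nat.log 2 n + 1)) := by omega
  nlinarith [Nat.one_le_two_pow (n := Nat.log 2 n + 1)]

/-! ### Stacks stored in arrays -/

/-- The first `r` cells of `rs` list the elements of `S` without repetition. -/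
structure IsStack (rs : ℕ → ℕ) (r : ℕ) (S : Finset ℕ) : Prop where
  mem : ∀ i < r, rs i ∈ S
  surj : ∀ x ∈ S, ∃ i < r, rs i = x
  inj : ∀ i < r, ∀ j < r, rs i = rs j → i = j

namespace IsStack

open Function

variable {rs : ℕ → ℕ} {r : ℕ} {S : Finset ℕ}

theorem empty (rs : ℕ → ℕ) : IsStack rs 0 ∅ := by
  constructor <;> simp

theorem card_eq (h : IsStack rs r S) : S.card = r := by
  have : S = (Finset.range r).image rs := by
    ext x
    simp only [Finset.mem_image, Finset.mem_range]
    exact ⟨h.surj x, fun ⟨i, hi, he⟩ => he ▸ h.mem i hi⟩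
  rw [this, Finset.card_image_of_injOn, Finset.card_range]
  intro i hi j hj he
  simp only [Finset.coe_range, Set.mem_Iio] at hi hj
  exact h.inj i hi j hj he

theorem push (h : IsStack rs r S) {x : ℕ} (hx : x ∉ S) :
    IsStack (update rs r x) (r + 1) (insert x S) := by
  have h1 := h.mem
  refine ⟨fun i hi => ?_, fun y hy => ?_, fun i hi j hj hij => ?_⟩
  · have := h1 i
    simp only [update_apply, Finset.mem_insert]
    grind
  · rcases Finset.mem_insert.1 hy with rfl | hy
    · exact ⟨r, by omega, by simp⟩
    · obtain ⟨i, hi, he⟩ := h.surj y hy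
      exact ⟨i, by omega, by rw [update_of_ne (by omega), he]⟩
  · have h2 := h.inj i
    have h3 := h1 i
    have h4 := h1 j
    simp only [update_apply] at hij
    grind

theorem replace (h : IsStack rs r S) {j x : ℕ} (hj : j < r) (hx : x ∉ S) :
    IsStack (update rs j x) r (insert x (S.erase (rs j))) := by
  refine ⟨fun i hi => ?_, fun y hy => ?_, fun i hi i' hi' he => ?_⟩
  · have h1 := h.mem i hi
    have h2 := h.inj i hi j hj
    simp only [update_apply, Finset.mem_insert, Finset.mem_erase]
    grind
  · rcases Finset.mem_insert.1 hy with rfl | hy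
    · exact ⟨j, hj, by simp⟩
    · obtain ⟨hne, hy⟩ := Finset.mem_erase.1 hy
      obtain ⟨i, hi, he⟩ := h.surj y hy
      exact ⟨i, hi, by rw [update_of_ne (by rintro rfl; exact hne he.symm), he]⟩
  · have h1 := h.inj i hi i' hi'
    have h2 := h.mem i hi
    have h3 := h.mem i' hi'
    simp only [update_apply] at he
    grind

theorem pop (h : IsStack rs (r + 1) S) : IsStack rs r (S.erase (rs r)) := by
  refine ⟨fun i hi => ?_, fun y hy => ?_, fun i hi i' hi' he => ?_⟩
  · have h1 := h.mem i (by omega)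
    have h2 := h.inj i (by omega) r (by omega)
    simp only [Finset.mem_erase]
    grind
  · obtain ⟨hne, hy⟩ := Finset.mem_erase.1 hy
    obtain ⟨i, hi, he⟩ := h.surj y hy
    exact ⟨i, by grind, he⟩
  · exact h.inj i (by omega) i' (by omega) he

/-- Remove the `j`-th element and put the last one in its place. -/
theorem remove (h : IsStack rs (r + 1) S) {j : ℕ} (hj : j < r + 1) :
    IsStack (update rs j (rs r)) r (S.erase (rs j)) := by
  refine ⟨fun i hi => ?_, fun y hy => ?_, fun i hi i' hi' he => ?_⟩
  · have h1 := h.mem i (by omega)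
    have h2 := h.inj i (by omega) j hj
    have h3 := h.mem r (by omega)
    have h4 := h.inj r (by omega) j hj
    simp only [update_apply, Finset.mem_erase]
    grind
  · obtain ⟨hne, hy⟩ := Finset.mem_erase.1 hy
    obtain ⟨i, hi, he⟩ := h.surj y hy
    by_cases hir : i = r
    · exact ⟨j, by grind, by simp [← he, hir]⟩
    · exact ⟨i, by omega, by rw [update_of_ne (by rintro rfl; exact hne he.symm), he]⟩
  · have h1 := h.inj i (by omega) i' (by omega)
    have h2 := h.inj r (by omega) i (by omega)
    have h3 := h.inj r (by omega) i' (by omega)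
    simp only [update_apply] at he
    grind

end IsStack

/-! ### Heaps in memory and the removal of the top of a tree -/

namespace RealRAM
open Tournament Function Instr Test Program

/-- The memory holds a tournament forest with the nodes `alive` for the keys of the items
`live`. -/
structure Heap (s : State) (alive live : Finset ℕ) : Prop where
  forest : Tournament (s.arr aOwn) (s.arr aLc) (s.arr aRc) (s.arr aPar) (s.arr aHt) (s.arr aTop)
    (s.rarr fD) alive live
  fresh : ∀ c ∈ alive, c < s.var vNew
  new_ne : s.var vNew ≠ 0
  count : ∀ i, s.arr aCnt i = count (s.arr aHt) alive i

/-- The roots of the forest. -/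
abbrev roots (s : State) (alive : Finset ℕ) : Finset ℕ := rootSet (s.arr aPar) alive

/-- The root stack holds the roots of the forest. -/
abbrev Stacked (s : State) (alive : Finset ℕ) : Prop :=
  IsStack (s.arr aRs) (s.var vR) (roots s alive)

theorem count_erase {ht : ℕ → ℕ} {alive : Finset ℕ} {c : ℕ} (hc : c ∈ alive) (i : ℕ) :
    count ht (alive.erase c) i = update (count ht alive) (ht c) (count ht alive (ht c) - 1) i := by
  simp only [count, Finset.filter_erase, update_apply]
  split_ifs with h
  · subst h
    rw [Finset.card_erase_of_mem (by simp [hc])]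
  · rw [Finset.erase_eq_of_notMem]
    simp [hc, Ne.symm h]

theorem rootSet_remove {par : ℕ → ℕ} {alive : Finset ℕ} {c l : ℕ}
    (hl : l ∈ alive) (hlc : l ≠ c) :
    rootSet (update par l 0) (alive.erase c) = insert l ((rootSet par alive).erase c) := by
  ext d
  simp only [rootSet, Finset.mem_filter, Finset.mem_erase, Finset.mem_insert, update_apply]
  grind

theorem rootSet_remove_right {par : ℕ → ℕ} {alive : Finset ℕ} {c l r : ℕ}
    (hl : l ∈ alive) (hlc : l ≠ c) (hr : r ∈ alive) (hrc : r ≠ c) :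
    rootSet (update (update par l 0) r 0) (alive.erase c) =
      insert r (insert l ((rootSet par alive).erase c)) := by
  ext d
  simp only [rootSet, Finset.mem_filter, Finset.mem_erase, Finset.mem_insert, update_apply]
  grind

/-- The relation between the states before and after removing nodes from the top of the
`vJ`-th tree. -/
structure Cracked (c : ℕ) (s : State) (alive live : Finset ℕ) (c' : ℕ) (s' : State)
    (alive' : Finset ℕ) : Prop where
  subset : alive' ⊆ alive
  heap : Heap s' alive' live
  stacked : Stacked s' alive'
  le_size : s.var vR ≤ s'.var vR
  ht_le : s.arr aHt (s'.arr aRs (s.var vJ)) ≤ s.arr aHt (s.arr aRs (s.var vJ))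
  size_le : s'.var vR + s.arr aHt (s'.arr aRs (s.var vJ)) ≤
    s.var vR + s.arr aHt (s.arr aRs (s.var vJ))
  card : alive'.card + s.arr aHt (s.arr aRs (s.var vJ)) =
    alive.card + s.arr aHt (s'.arr aRs (s.var vJ))
  credits : c + 20 * s.arr aHt (s'.arr aRs (s.var vJ)) ≤
    c' + 20 * s.arr aHt (s.arr aRs (s.var vJ)) + 2
  own : s.arr aOwn (s'.arr aRs (s.var vJ)) = s.arr aOwn (s.arr aRs (s.var vJ))
  other : ∀ i < s.var vR, i ≠ s.var vJ → s'.arr aRs i = s.arr aRs i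
  low : ∀ d ∈ alive, s.arr aHt d ≤ s.var vQ → d ∈ alive'
  low_roots : ∀ d ∈ roots s' alive', s.arr aHt d < s.var vQ → d ∈ roots s alive

theorem Heap.ne_zero {s : State} {alive live : Finset ℕ} (h : Heap s alive live) {c : ℕ}
    (hc : c ∈ alive) : c ≠ 0 := h.forest.pos c hc

/-- The removed nodes form a path of left children, one for each height, all with the owner of the
root. Each releases at most one right child as a new root at the end of the stack, and costs at most
20 steps. The specification is stated for `c' + 1` credits because it is inherited from the loop
invariant, which holds before the last, failing test. -/
theorem wp_crack {s : State} {c : ℕ} {alive live : Finset ℕ}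
    (hz : s.var vZ = 0) (h : Heap s alive live) (hs : Stacked s alive) (hj : s.var vJ < s.var vR)
    (hc : 20 * (s.arr aHt (s.arr aRs (s.var vJ)) - s.var vQ) + 10 ≤ c) :
    WP crackP (fun c' s' => ∃ alive', Cracked c s alive live (c' + 1) s' alive' ∧
      s.arr aHt (s'.arr aRs (s.var vJ)) ≤ s.var vQ) c s := by
  refine WP.chain_cons (WP.block (by simp) (by simp; omega) (WP.chain_singleton ?_))
  refine WP.loop (fun c' s' => ∃ alive', Cracked c s alive live c' s' alive' ∧
      s'.var vC = s'.arr aRs (s.var vJ) ∧ s'.var vH = s.arr aHt (s'.arr aRs (s.var vJ)) ∧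
      20 * (s.arr aHt (s'.arr aRs (s.var vJ)) - s.var vQ) + 1 ≤ c') ?_ ?_
  · exact ⟨alive, ⟨subset_rfl, ⟨h.forest, h.fresh, h.new_ne, h.count⟩, hs, le_rfl, le_rfl, le_rfl, rfl,
      by simp [Instr.apply]; omega, rfl, fun _ _ _ => rfl, fun _ hd _ => hd, fun _ hd _ => hd⟩, rfl, rfl, by
      simp [Instr.apply]; omega⟩
  · rintro c' s' hsame ⟨alive', hk, hvC, hvH, hcr⟩
    have eZ : s'.var vZ = s.var vZ := hsame.var _ rfl
    have eJ : s'.var vJ = s.var vJ := hsame.var _ rfl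
    have eQ : s'.var vQ = s.var vQ := hsame.var _ rfl
    have eH : s'.arr aHt = s.arr aHt := hsame.arr _ rfl
    have eO : s'.arr aOwn = s.arr aOwn := hsame.arr _ rfl
    refine ⟨by omega, fun ht => ?_, fun hf => ?_⟩
    · simp only [Test.Holds] at ht
      have hjR := hj.trans_le hk.le_size
      have hrt := hk.stacked.mem (s.var vJ) hjR
      rw [← hvC] at hrt
      have hrt' := Finset.mem_filter.1 hrt
      have hpos : 0 < s'.arr aHt (s'.var vC) := by rw [eH, hvC]; omega
      have hl := hk.heap.forest.left _ hrt'.1 hpos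
      have hl' : s'.arr aLc (s'.var vC) ∉ roots s' alive' := by
        simp only [rootSet, Finset.mem_filter, hl.2.2.2]
        exact fun hh => hk.heap.ne_zero hrt'.1 hh.2
      have hcnt : s'.arr aCnt = count (s'.arr aHt) alive' := funext hk.heap.count
      set l := s'.arr aLc (s'.var vC) with hldef
      set r := s'.arr aRc (s'.var vC) with hrdef
      -- The invariant is restored once for both branches, in terms of what they have in common
      -- whether or not there is a right child.
      have next : ∀ c₂ s₂, c' ≤ c₂ + 20 → s₂.arr aHt = s.arr aHt → s₂.arr aOwn = s.arr aOwn →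
          Tournament (s₂.arr aOwn) (s₂.arr aLc) (s₂.arr aRc) (s₂.arr aPar) (s₂.arr aHt)
            (s₂.arr aTop) (s₂.rarr fD) (alive'.erase (s'.var vC)) live →
          Stacked s₂ (alive'.erase (s'.var vC)) →
          s₂.arr aCnt = update (s'.arr aCnt) (s'.var vH) (s'.arr aCnt (s'.var vH) - 1) →
          s₂.var vNew = s'.var vNew → s'.var vR ≤ s₂.var vR → s₂.var vR ≤ s'.var vR + 1 →
          s₂.arr aRs (s.var vJ) = l → (∀ i < s'.var vR, i ≠ s.var vJ → s₂.arr aRs i = s'.arr aRs i) →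
          (∀ d ∈ roots s₂ (alive'.erase (s'.var vC)), d = l ∨ d = r ∧ r ≠ 0 ∨ d ∈ roots s' alive') →
          s₂.var vC = l → s₂.var vH = s.arr aHt l →
          ∃ alive'', Cracked c s alive live c₂ s₂ alive'' ∧
            s₂.var vC = s₂.arr aRs (s.var vJ) ∧ s₂.var vH = s.arr aHt (s₂.arr aRs (s.var vJ)) ∧
            20 * (s.arr aHt (s₂.arr aRs (s.var vJ)) - s.var vQ) + 1 ≤ c₂ := by
        intro c₂ s₂ g1 g2 g3 g4 g5 g6 g7 g8 g9 g10 g11 g12 g13 g14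
        have hht : s.arr aHt l + 1 = s.arr aHt (s'.arr aRs (s.var vJ)) := by
          rw [← hvC, ← eH]; exact hl.2.1
        have k1 := hk.ht_le
        have k2 := hk.size_le
        have k3 := hk.card
        have k4 := hk.credits
        have k5 := Finset.card_erase_add_one hrt'.1
        have k6 := hk.le_size
        refine ⟨alive'.erase (s'.var vC), ⟨(Finset.erase_subset _ _).trans hk.subset,
          ⟨g4, fun d hd => ?_, ?_, fun i => ?_⟩, g5, by omega, ?_, ?_, ?_, ?_, ?_, fun i hi hij => ?_,
          fun d hd hdq => ?_, fun d hd hdq => ?_⟩, ?_, ?_, ?_⟩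
        · rw [g7]; exact hk.heap.fresh d (Finset.mem_of_mem_erase hd)
        · rw [g7]; exact hk.heap.new_ne
        · rw [g6, g2, hvH, ← hvC, ← eH, count_erase hrt'.1, hcnt]
        · rw [g10]; omega
        · rw [g10]; omega
        · rw [g10]; omega
        · rw [g10]; omega
        · rw [g10, ← hk.own, ← hvC, ← eO]; exact hl.2.2.1
        · rw [g11 i (by omega) hij, hk.other i hi hij]
        · refine Finset.mem_erase.2 ⟨?_, hk.low d hd hdq⟩
          rintro rfl
          rw [eH] at hpos
          rw [eQ, hvH, ← hvC] at ht
          omega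
        · rcases g12 d hd with rfl | ⟨rfl, h0⟩ | hd
          · rw [eQ, hvH] at ht; omega
          · have := (hk.heap.forest.right _ hrt'.1 hpos h0).2.1
            have h6 : s.arr aHt (s'.var vC) = s.arr aHt (s'.arr aRs (s.var vJ)) := by rw [hvC]
            rw [eH, ← hrdef] at this
            rw [eQ, hvH] at ht; omega
          · exact hk.low_roots d hd hdq
        · rw [g13, g10]
        · rw [g14, g10]
        · rw [g10]; omega
      refine WP.chain_cons (WP.block (by simp) (by simp; omega) ?_)
      refine WP.chain_cons (WP.ite (by simp; omega) (fun hb => WP.block (by simp) (by simp; omega) ?_)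
        (fun hb => WP.skip (by simp; omega) ?_)) <;>
      simp [Instr.apply, Test.Holds, eZ, hz] at hb <;>
      refine WP.chain_singleton (WP.block (by simp) (by simp; omega) ?_) <;>
      generalize hS : List.foldl _ _ _ = s₂
      · have hr := hk.heap.forest.right _ hrt'.1 hpos hb
        have hT := hk.heap.forest.remove_root_right hrt'.1 hrt'.2 hpos hb
        have hr' : r ∉ roots s' alive' := by
          simp only [rootSet, Finset.mem_filter, hrdef, hr.2.2.2.1]
          exact fun hh => hk.heap.ne_zero hrt'.1 hh.2
        have hne : r ≠ l := by grind
        have e1 : s₂.arr aPar = update (update (s'.arr aPar) l 0) r 0 := by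
          rw [← hz, ← eZ, ← hS]; rfl
        have e2 : s₂.arr aRs = update (update (s'.arr aRs) (s.var vJ) l) (s'.var vR) r := by
          rw [← eJ, ← hS]; rfl
        have e3 : s₂.var vR = s'.var vR + 1 := by rw [← hS]; rfl
        have e4 : roots s₂ (alive'.erase (s'.var vC)) =
            insert r (insert l ((roots s' alive').erase (s'.var vC))) := by
          rw [roots, e1, rootSet_remove_right hl.1 (by grind) hr.1 (by grind)]
        have e5 : s₂.arr aRs (s.var vJ) = l := by rw [e2, update_of_ne (by omega), update_self]
        have e6 : s₂.var vC = s₂.arr aRs (s'.var vJ) := by rw [← hS]; rfl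
        have e7 : s₂.var vH = s'.arr aHt (s₂.arr aRs (s'.var vJ)) := by rw [← hS]; rfl
        refine next _ s₂ (by simp; omega) (by rw [← eH, ← hS]; rfl) (by rw [← eO, ← hS]; rfl)
          (by rw [e1, ← hS]; exact hT) ?_ (by rw [← hS]; rfl) (by rw [← hS]; rfl) (by omega)
          (by omega) e5 (fun i hi hij => ?_) (fun d hd => ?_) (by rw [e6, eJ, e5])
          (by rw [e7, eJ, e5, eH])
        · rw [Stacked, e2, e3, e4]
          have := (hk.stacked.replace hjR hl').push (x := r) (by simp [hr', hne])
          rwa [← hvC] at this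
        · rw [e2, update_of_ne (by omega), update_of_ne hij]
        · rw [e4] at hd
          simp only [Finset.mem_insert, Finset.mem_erase] at hd
          grind
      · have hT := hk.heap.forest.remove_root hrt'.1 hrt'.2 hpos hb
        have e1 : s₂.arr aPar = update (s'.arr aPar) l 0 := by
          rw [← hz, ← eZ, ← hS]; rfl
        have e2 : s₂.arr aRs = update (s'.arr aRs) (s.var vJ) l := by
          rw [← eJ, ← hS]; rfl
        have e3 : s₂.var vR = s'.var vR := by rw [← hS]; rfl
        have e4 : roots s₂ (alive'.erase (s'.var vC)) =
            insert l ((roots s' alive').erase (s'.var vC)) := by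
          rw [roots, e1, rootSet_remove hl.1 (by grind)]
        have e5 : s₂.arr aRs (s.var vJ) = l := by rw [e2, update_self]
        have e6 : s₂.var vC = s₂.arr aRs (s'.var vJ) := by rw [← hS]; rfl
        have e7 : s₂.var vH = s'.arr aHt (s₂.arr aRs (s'.var vJ)) := by rw [← hS]; rfl
        refine next _ s₂ (by simp; omega) (by rw [← eH, ← hS]; rfl) (by rw [← eO, ← hS]; rfl)
          (by rw [e1, ← hS]; exact hT) ?_ (by rw [← hS]; rfl) (by rw [← hS]; rfl) (by omega)
          (by omega) e5 (fun i hi hij => ?_) (fun d hd => ?_) (by rw [e6, eJ, e5])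
          (by rw [e7, eJ, e5, eH])
        · rw [Stacked, e2, e3, e4]
          have := hk.stacked.replace hjR hl'
          rwa [← hvC] at this
        · rw [e2, update_of_ne hij]
        · rw [e4] at hd
          simp only [Finset.mem_insert, Finset.mem_erase] at hd
          grind
    · simp only [Test.Holds] at hf
      refine ⟨alive', ?_, by omega⟩
      rwa [Nat.sub_add_cancel (by omega)]

end RealRAM

/-! ### Frame rules for heaps, and the removal of a minimum -/

namespace RealRAM
open Tournament Function Instr Test Program

theorem Program.any_eq_false {f g : Instr → Bool} (hfg : ∀ i, f i = true → g i = true)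
    {P : Program} (h : P.any g = false) : P.any f = false := by
  induction P with
  | instr i =>
    have := hfg i
    simp only [Program.any] at h ⊢
    cases hf : f i <;> simp_all
  | seq p q ihp ihq => simp_all [Program.any]
  | ite b p q ihp ihq => simp_all [Program.any]
  | loop b p ih => simp_all [Program.any]

theorem Same.seq {p q : Program} {s₁ s₂ s₃ : State} (h : Same p s₁ s₂) (h' : Same q s₂ s₃) :
    Same (.seq p q) s₁ s₃ := by
  refine Same.trans (h.mono fun f hf => ?_) (h'.mono fun f hf => ?_) <;>
    simp_all [Program.any]

theorem Heap.congr {s s' : State} {alive live : Finset ℕ} (h : Heap s alive live)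
    (e7 : s'.arr aOwn = s.arr aOwn) (e8 : s'.arr aLc = s.arr aLc) (e9 : s'.arr aRc = s.arr aRc)
    (e10 : s'.arr aPar = s.arr aPar) (e11 : s'.arr aHt = s.arr aHt)
    (e12 : s'.arr aTop = s.arr aTop) (e15 : s'.arr aCnt = s.arr aCnt)
    (e2 : s'.rarr fD = s.rarr fD) (eN : s'.var vNew = s.var vNew) : Heap s' alive live := by
  obtain ⟨h1, h2, h3, h4⟩ := h
  constructor
  · rwa [e7, e8, e9, e10, e11, e12, e2]
  · rwa [eN]
  · rwa [eN]
  · rwa [e15, e11]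

/-- The program leaves the tournament forest alone. -/
def Program.keepsHeap (P : Program) : Bool :=
  !P.any fun i => i.writesVar vNew || i.writesArr aOwn || i.writesArr aLc || i.writesArr aRc ||
    i.writesArr aPar || i.writesArr aHt || i.writesArr aTop || i.writesArr aCnt || i.writesRarr fD

theorem Heap.frame {P : Program} {s s' : State} {alive live : Finset ℕ} (h : Heap s alive live)
    (hS : Same P s s') (hP : P.keepsHeap = true) : Heap s' alive live := by
  have hP' := (Bool.not_eq_true' _).mp hP
  apply h.congr <;>
  first
  | exact hS.arr _ (Program.any_eq_false (by grind) hP')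
  | exact hS.rarr _ (Program.any_eq_false (by grind) hP')
  | exact hS.var _ (Program.any_eq_false (by grind) hP')

theorem Stacked.congr {s s' : State} {alive : Finset ℕ} (h : Stacked s alive)
    (e10 : s'.arr aPar = s.arr aPar) (e13 : s'.arr aRs = s.arr aRs)
    (eR : s'.var vR = s.var vR) : Stacked s' alive := by
  rw [Stacked, roots, e10, e13, eR]
  exact h

theorem wp_min {s : State} {c : ℕ} (hc : 10 * s.var vR + 10 ≤ c) (hR : 0 < s.var vR) :
    WP minP (fun c' s' => c ≤ c' + 10 * s.var vR + 10 ∧ s'.var vJ < s.var vR ∧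
      ∀ i < s.var vR, s.rarr fD (s.arr aOwn (s.arr aRs (s'.var vJ))) ≤
        s.rarr fD (s.arr aOwn (s.arr aRs i))) c s := by
  refine WP.chain_cons (WP.block (by simp) (by simp; omega) (WP.chain_singleton ?_))
  refine WP.loop (fun c' s' => s'.var vI ≤ s.var vR ∧ 1 ≤ s'.var vI ∧
    c + 10 ≤ c' + 10 * s'.var vI + 6 ∧ 10 * s.var vR + 10 ≤ c' + 10 * s'.var vI ∧
    s'.var vJ < s.var vR ∧
    s'.rvar rT = s.rarr fD (s.arr aOwn (s.arr aRs (s'.var vJ))) ∧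
      ∀ i < s'.var vI, s'.rvar rT ≤ s.rarr fD (s.arr aOwn (s.arr aRs i))) ?_ ?_
  · refine ⟨hR, le_rfl, ?_, ?_, hR, rfl, fun i hi => ?_⟩
    · simp [Instr.apply]; omega
    · simp [Instr.apply]; omega
    · obtain rfl : i = 0 := Nat.lt_one_iff.1 hi
      exact le_rfl
  · rintro c' s' hS ⟨h1, h2, h3, h3', h4, h5, h6⟩
    have eR : s'.var vR = s.var vR := hS.var _ rfl
    have eO : s'.arr aOwn = s.arr aOwn := hS.arr _ rfl
    have eS : s'.arr aRs = s.arr aRs := hS.arr _ rfl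
    have eD : s'.rarr fD = s.rarr fD := hS.rarr _ rfl
    refine ⟨by omega, fun ht => ?_, fun hf => ?_⟩
    · simp only [Test.Holds] at ht
      refine WP.chain_cons (WP.block (by simp) (by simp; omega) ?_)
      refine WP.chain_cons (WP.ite (by simp; omega) (fun hb => WP.block (by simp) (by simp; omega) ?_)
        (fun hb => WP.skip (by simp; omega) ?_)) <;>
      simp [Instr.apply, Test.Holds, eO, eS, eD] at hb <;>
      refine WP.chain_singleton (WP.block (by simp) (by simp; omega) ?_) <;>
      simp [Instr.apply, eO, eS, eD]
      · refine ⟨by omega, by omega, by omega, by omega, fun i hi => ?_⟩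
        rcases Nat.lt_or_eq_of_le hi with hi | rfl
        · exact hb.le.trans (h6 i hi)
        · exact le_rfl
      · refine ⟨by omega, by omega, by omega, h4, h5, fun i hi => ?_⟩
        rcases Nat.lt_or_eq_of_le hi with hi | rfl
        · exact h6 i hi
        · exact hb
    · simp only [Test.Holds, eR] at hf
      exact ⟨by omega, h4, fun i hi => h5 ▸ h6 i (by omega)⟩

theorem rootSet_erase (par : ℕ → ℕ) (alive : Finset ℕ) (c : ℕ) :
    rootSet par (alive.erase c) = (rootSet par alive).erase c :=
  Finset.filter_erase _ _ _

theorem wp_drop {s : State} {c : ℕ} {alive live : Finset ℕ} (hz : s.var vZ = 0)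
    (h : Heap s alive live) (hs : Stacked s alive) (hj : s.var vJ < s.var vR)
    (hh : s.arr aHt (s.arr aRs (s.var vJ)) = 0) (hc : 10 ≤ c) :
    WP dropP (fun c' s' => c ≤ c' + 10 ∧ s'.var vU = s.arr aOwn (s.arr aRs (s.var vJ)) ∧
      s'.var vR + 1 = s.var vR ∧ Stacked s' (alive.erase (s.arr aRs (s.var vJ))) ∧
      Heap s' (alive.erase (s.arr aRs (s.var vJ)))
        (live.erase (s.arr aOwn (s.arr aRs (s.var vJ))))) c s := by
  have hm := Finset.mem_filter.1 (hs.mem _ hj)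
  obtain ⟨r, hr⟩ : ∃ r, s.var vR = r + 1 := ⟨s.var vR - 1, by omega⟩
  refine WP.block (by simp) (by simp; omega) ?_
  generalize hS : List.foldl _ _ _ = s₂
  have e1 : s₂.var vR = s.var vR - 1 := by rw [← hS]; rfl
  refine ⟨by simp; omega, by rw [← hS]; rfl, by omega, ?_, ?_, ?_, ?_, fun i => ?_⟩
  · have e2 : s₂.arr aRs = update (s.arr aRs) (s.var vJ) (s.arr aRs (s.var vR - 1)) := by
      rw [← hS]; rfl
    have e3 : s₂.arr aPar = s.arr aPar := by rw [← hS]; rfl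
    rw [Stacked, e1, e2, roots, e3, rootSet_erase, hr]
    rw [Stacked, hr] at hs
    exact hs.remove (hr ▸ hj)
  · have := h.forest.remove_leaf hm.1 hm.2 hh
    rw [← hS]
    exact this
  · rw [← hS]
    exact fun d hd => h.fresh d (Finset.mem_of_mem_erase hd)
  · rw [← hS]
    exact h.new_ne
  · have e2 : s₂.arr aCnt = update (s.arr aCnt) (s.var vZ) (s.arr aCnt (s.var vZ) - 1) := by
      rw [← hS]; rfl
    have e3 : s₂.arr aHt = s.arr aHt := by rw [← hS]; rfl
    have hcnt : s.arr aCnt = count (s.arr aHt) alive := funext h.count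
    rw [e2, e3, count_erase hm.1, hh, hz, hcnt]

/-- With `vQ = 0` the tree of the minimum root is taken apart down to a single leaf with the same
owner, which can be dropped. As heights are at most `L`, this adds at most `L` roots. -/
theorem wp_pop {s : State} {c L : ℕ} {alive live : Finset ℕ} (hz : s.var vZ = 0)
    (h : Heap s alive live) (hs : Stacked s alive) (hR : s.var vR ≠ 0)
    (hL : ∀ d ∈ alive, s.arr aHt d ≤ L) (hc : 10 * s.var vR + 20 * L + 50 ≤ c) :
    WP popP (fun c' s' => ∃ alive' ⊆ alive,
      c ≤ c' + 10 * s.var vR + 20 * L + 50 ∧ Heap s' alive' (live.erase (s'.var vU)) ∧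
      Stacked s' alive' ∧ s.var vR ≤ s'.var vR + 1 ∧ s'.var vR ≤ s.var vR + L ∧
      s'.var vU ∈ live ∧ (∀ x ∈ live, s.rarr fD (s'.var vU) ≤ s.rarr fD x)) c s := by
  refine WP.chain_cons ((wp_min (by omega) (by omega)).conseq ?_)
  rintro c₁ s₁ hS₁ ⟨hc₁, hj₁, hmin⟩
  refine WP.chain_cons (WP.block (by simp) (by simp; omega) ?_)
  generalize hs₂ : List.foldl _ _ _ = s₂
  have hS₂ : Same (chain [minP, block [const vQ 0]]) s s₂ := by
    have : Same (block [const vQ 0]) s₁ s₂ := by rw [← hs₂]; exact same_instr _ _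
    exact hS₁.seq this
  have hh₂ : Heap s₂ alive live := h.frame hS₂ rfl
  have hst₂ : Stacked s₂ alive := Stacked.congr hs (hS₂.arr _ rfl) (hS₂.arr _ rfl) (hS₂.var _ rfl)
  have eJ : s₂.var vJ = s₁.var vJ := by rw [← hs₂]; rfl
  have eQ : s₂.var vQ = 0 := by rw [← hs₂]; rfl
  have eR : s₂.var vR = s.var vR := hS₂.var _ rfl
  have eH : s₂.arr aHt = s.arr aHt := hS₂.arr _ rfl
  have eO : s₂.arr aOwn = s.arr aOwn := hS₂.arr _ rfl
  have eS : s₂.arr aRs = s.arr aRs := hS₂.arr _ rfl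
  have hroot := hst₂.mem (s₂.var vJ) (by omega)
  have hroot' := Finset.mem_filter.1 hroot
  have hLj := hL _ hroot'.1
  rw [← eH] at hLj
  have eZ : s₂.var vZ = 0 := (hS₂.var _ rfl).trans hz
  simp only [List.length_singleton]
  refine WP.chain_cons ((wp_crack eZ hh₂ hst₂ (by omega) (by omega)).conseq ?_)
  rintro c₃ s₃ hS₃ ⟨alive₃, hk, hle⟩
  have eJ₃ : s₃.var vJ = s₂.var vJ := hS₃.var _ rfl
  have eH₃ : s₃.arr aHt = s₂.arr aHt := hS₃.arr _ rfl
  have eO₃ : s₃.arr aOwn = s₂.arr aOwn := hS₃.arr _ rfl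
  have eZ₃ : s₃.var vZ = 0 := (hS₃.var _ rfl).trans eZ
  have k1 := hk.credits
  have k2 := hk.le_size
  have k3 := hk.size_le
  refine WP.chain_singleton ((wp_drop eZ₃ hk.heap hk.stacked (by omega) ?_ (by omega)).conseq ?_)
  · rw [eH₃, eJ₃]; omega
  · rintro c₄ s₄ hS₄ ⟨g1, g2, g3, g4, g5⟩
    have hu : s₄.var vU = s.arr aOwn (s.arr aRs (s₁.var vJ)) := by
      rw [g2, eO₃, eJ₃, hk.own, eO, eS, eJ]
    rw [← g2] at g5
    refine ⟨_, (Finset.erase_subset _ _).trans hk.subset, by omega, g5, g4, by omega, by omega,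
      ?_, fun x hx => ?_⟩
    · rw [hu, ← eO, ← eS, ← eJ]
      exact hh₂.forest.owner _ hroot'.1
    -- A minimum over the roots is a minimum over all items, since above every node there is a root
    -- with no larger key.
    · obtain ⟨r, hr, hp, -, hk'⟩ := h.forest.exists_root (h.forest.topmost x hx).1
      rw [(h.forest.topmost x hx).2] at hk'
      obtain ⟨i, hi, rfl⟩ := hs.surj r (Finset.mem_filter.2 ⟨hr, hp⟩)
      rw [hu]
      exact (hmin i hi).trans hk'

end RealRAM

/-! ### Linking roots of equal height -/

namespace RealRAM
open Tournament Function Instr Test Program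

/-- While the roots are linked, those in `S` are on the stack and the others in the bucket that
belongs to their height. -/
structure Linking (s : State) (alive S : Finset ℕ) : Prop where
  stack : IsStack (s.arr aRs) (s.var vR) S
  subset : S ⊆ roots s alive
  bucket : ∀ h, s.arr aBk h ≠ 0 →
    s.arr aBk h ∈ roots s alive ∧ s.arr aHt (s.arr aBk h) = h ∧ s.arr aBk h ∉ S
  cover : ∀ d ∈ roots s alive, d ∈ S ∨ s.arr aBk (s.arr aHt d) = d

theorem count_insert {ht : ℕ → ℕ} {alive : Finset ℕ} {d h : ℕ} (hd : d ∉ alive) (i : ℕ) :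
    count (update ht d h) (insert d alive) i =
      update (count ht alive) h (count ht alive h + 1) i := by
  have hf : ∀ j, (alive.filter fun c => update ht d h c = j) = alive.filter fun c => ht c = j := by
    intro j
    refine Finset.filter_congr fun c hc => ?_
    rw [update_of_ne (by rintro rfl; exact hd hc)]
  simp only [count, Finset.filter_insert, update_self, hf]
  by_cases h' : h = i
  · subst h'
    simp [hd]
  · simp [h', update_of_ne (Ne.symm h'), count]

theorem defects_insert {rc ht : ℕ → ℕ} {alive : Finset ℕ} {d b h : ℕ} (hd : d ∉ alive)
    (hb : b ≠ 0) :
    defects (update rc d b) (update ht d h) (insert d alive) = defects rc ht alive := by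
  have hf : (alive.filter fun c => 0 < update ht d h c ∧ update rc d b c = 0) =
      alive.filter fun c => 0 < ht c ∧ rc c = 0 := by
    refine Finset.filter_congr fun c hc => ?_
    rw [update_of_ne (by rintro rfl; exact hd hc), update_of_ne (by rintro rfl; exact hd hc)]
  simp only [defects, Finset.filter_insert, update_self, hb, and_false, if_false, hf]

theorem rootSet_link {par : ℕ → ℕ} {alive : Finset ℕ} {a b d : ℕ}
    (hda : d ≠ a) (hdb : d ≠ b) (h0 : d ≠ 0) :
    rootSet (update (update (update par d 0) a d) b d) (insert d alive) =
      insert d (((rootSet par alive).erase a).erase b) := by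
  ext e
  simp only [rootSet, Finset.mem_filter, Finset.mem_erase, Finset.mem_insert, update_apply]
  grind

/-- The relation between the states before and after linking `l` pairs of roots. -/
structure Linked (s : State) (alive : Finset ℕ) (s' : State) (alive' : Finset ℕ) (l : ℕ) :
    Prop where
  card : alive'.card = alive.card + l
  card_roots : (roots s' alive').card + l = (roots s alive).card
  defects : defects (s'.arr aRc) (s'.arr aHt) alive' = defects (s.arr aRc) (s.arr aHt) alive
  count : count (s'.arr aHt) alive' 0 = count (s.arr aHt) alive 0
  height : ∀ M, (∀ d ∈ alive, s.arr aHt d ≤ M) → ∀ d ∈ alive', s'.arr aHt d ≤ M + l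

/-- An iteration either moves a root from the stack into an empty bucket or replaces two roots by
one. It thus lowers by one either the stack size or the number of roots, which both start at `s.var
vR`; hence 30 steps per iteration give 60 per initial root. -/
theorem wp_link {s : State} {c : ℕ} {alive live : Finset ℕ} (hz : s.var vZ = 0)
    (h : Heap s alive live) (hs : Stacked s alive) (hb : ∀ i, s.arr aBk i = 0)
    (hc : 60 * s.var vR + 1 ≤ c) :
    WP linkP (fun c' s' => ∃ alive' l, c ≤ c' + 60 * s.var vR + 1 ∧ s'.var vR = 0 ∧
      Heap s' alive' live ∧ Linking s' alive' ∅ ∧ Linked s alive s' alive' l) c s := by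
  have hcard := hs.card_eq
  refine WP.loop (fun c' s' => ∃ alive' l S, Heap s' alive' live ∧ Linking s' alive' S ∧
    Linked s alive s' alive' l ∧
    c + 30 * (s'.var vR + (roots s' alive').card) ≤ c' + 60 * s.var vR ∧
    30 * s'.var vR + 30 * (roots s' alive').card + 1 ≤ c') ?_ ?_
  · refine ⟨alive, 0, roots s alive, h, ⟨hs, subset_rfl, fun i hi => absurd (hb i) hi,
      fun d hd => .inl hd⟩, ⟨rfl, rfl, rfl, rfl, fun M hM => hM⟩, ?_, ?_⟩ <;> omega
  · rintro c' s' hS ⟨alive', l, S, hH, hLk, hLd, hc1, hc2⟩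
    have eZ : s'.var vZ = 0 := (hS.var _ rfl).trans hz
    have hScard := hLk.stack.card_eq
    have hSle := Finset.card_le_card hLk.subset
    refine ⟨by omega, fun ht => ?_, fun hf => ?_⟩
    · simp only [Test.Holds, eZ] at ht
      obtain ⟨r, hr⟩ : ∃ r, s'.var vR = r + 1 := ⟨s'.var vR - 1, by omega⟩
      have hst := hLk.stack
      rw [hr] at hst
      set x := s'.arr aRs r with hx
      have hxS : x ∈ S := hst.mem r (by omega)
      have hxr := hLk.subset hxS
      have hxr' := Finset.mem_filter.1 hxr
      refine WP.chain_cons (WP.block (by simp) (by simp; omega) (WP.chain_singleton ?_))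
      generalize hs₁ : List.foldl _ _ _ = s₁
      have eR₁ : s₁.var vR = r + 1 := by rw [← hr, ← hs₁]; rfl
      have eJ₁ : s₁.var vJ = r := by
        have : s₁.var vJ = s'.var vR - 1 := by rw [← hs₁]; rfl
        omega
      have eJ₁' : s₁.var vJ = s'.var vR - 1 := by rw [← hs₁]; rfl
      have eC₁ : s₁.var vC = x := by rw [hx, ← eJ₁, eJ₁', ← hs₁]; rfl
      have eH₁ : s₁.var vH = s'.arr aHt x := by rw [← eC₁, ← hs₁]; rfl
      have eB₁ : s₁.var vB = s'.arr aBk (s'.arr aHt x) := by rw [← eH₁, ← hs₁]; rfl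
      have eZ₁ : s₁.var vZ = 0 := by rw [← eZ, ← hs₁]; rfl
      have eA₁ : s₁.arr = s'.arr := by rw [← hs₁]; rfl
      have eF₁ : s₁.rarr = s'.rarr := by rw [← hs₁]; rfl
      have eN₁ : s₁.var vNew = s'.var vNew := by rw [← hs₁]; rfl
      clear_value x
      clear hs₁ eJ₁'
      have hH₁ : Heap s₁ alive' live := by apply hH.congr <;> simp only [eA₁, eF₁, eN₁]
      simp only [List.length_cons, List.length_nil]
      refine WP.ite (by omega) (fun hb => WP.block (by simp) (by simp; omega) ?_) (fun hb => ?_)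
      · simp only [Test.Holds, eB₁, eZ₁] at hb
        generalize hs₂ : List.foldl _ _ _ = s₂
        have f1 : s₂.arr aBk = update (s'.arr aBk) (s'.arr aHt x) x := by
          rw [← eH₁, ← eA₁, ← eC₁, ← hs₂]; rfl
        have f2 : s₂.var vR = r := by rw [← eJ₁, ← hs₂]; rfl
        have f3 : s₂.arr aHt = s'.arr aHt := by rw [← eA₁, ← hs₂]; rfl
        have f4 : s₂.arr aPar = s'.arr aPar := by rw [← eA₁, ← hs₂]; rfl
        have f5 : s₂.arr aRs = s'.arr aRs := by rw [← eA₁, ← hs₂]; rfl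
        have f6 : s₂.arr aRc = s'.arr aRc := by rw [← eA₁, ← hs₂]; rfl
        have f7 : roots s₂ alive' = roots s' alive' := by rw [roots, f4]
        have hH₂ : Heap s₂ alive' live := by apply hH₁.congr <;> (rw [← hs₂]; rfl)
        refine ⟨alive', l, S.erase x, hH₂, ⟨?_, ?_, fun i hi => ?_, fun d hd => ?_⟩,
          ⟨hLd.card, ?_, ?_, ?_, ?_⟩, ?_, ?_⟩
        · rw [f5, f2, hx]; exact hst.pop
        · rw [f7]; exact (Finset.erase_subset _ _).trans hLk.subset
        · rw [f1] at hi ⊢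
          rw [f7, f3]
          by_cases hix : i = s'.arr aHt x
          · subst hix
            simp [hxr]
          · rw [update_of_ne hix] at hi ⊢
            have := hLk.bucket i hi
            exact ⟨this.1, this.2.1, fun hm => this.2.2 (Finset.mem_of_mem_erase hm)⟩
        · rw [f7] at hd
          rw [f1, f3, Finset.mem_erase]
          by_cases hdx : d = x
          · subst hdx
            simp
          · rcases hLk.cover d hd with h1 | h1
            · exact .inl ⟨hdx, h1⟩
            · right
              rw [update_of_ne, h1]
              intro he
              rw [he, hb] at h1
              exact hH.ne_zero (Finset.mem_filter.1 hd).1 h1.symm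
        · rw [f7]; exact hLd.card_roots
        · rw [f6, f3]; exact hLd.defects
        · rw [f3]; exact hLd.count
        · rw [f3]; exact hLd.height
        · rw [f7, f2]; simp; omega
        · rw [f7, f2]; simp; omega
      · simp only [Test.Holds, eB₁, eZ₁] at hb
        set b := s'.arr aBk (s'.arr aHt x) with hbdef
        obtain ⟨hbr, hbh, hbS⟩ := hLk.bucket _ hb
        rw [← hbdef] at hbr hbh hbS
        have hbr' := Finset.mem_filter.1 hbr
        have hxb : x ≠ b := by rintro he; exact hbS (he ▸ hxS)
        set d := s'.var vNew with hd
        have hdal : d ∉ alive' := fun hm => lt_irrefl _ (hH.fresh d hm)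
        have next : ∀ c₂ s₂ a b', c' ≤ c₂ + 30 → (a = x ∧ b' = b ∨ a = b ∧ b' = x) →
            s'.rarr fD (s'.arr aOwn a) ≤ s'.rarr fD (s'.arr aOwn b') →
            s₂.arr aOwn = update (s'.arr aOwn) d (s'.arr aOwn a) →
            s₂.arr aLc = update (s'.arr aLc) d a → s₂.arr aRc = update (s'.arr aRc) d b' →
            s₂.arr aPar = update (update (update (s'.arr aPar) d 0) a d) b' d →
            s₂.arr aHt = update (s'.arr aHt) d (s'.arr aHt x + 1) →
            s₂.arr aTop = update (s'.arr aTop) (s'.arr aOwn a) d →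
            s₂.rarr fD = s'.rarr fD →
            s₂.arr aCnt = update (s'.arr aCnt) (s'.arr aHt x + 1) (s'.arr aCnt (s'.arr aHt x + 1) + 1) →
            s₂.var vNew = d + 1 → s₂.var vR = r + 1 → s₂.arr aRs = update (s'.arr aRs) r d →
            s₂.arr aBk = update (s'.arr aBk) (s'.arr aHt x) 0 →
            ∃ alive'' l S, Heap s₂ alive'' live ∧ Linking s₂ alive'' S ∧
              Linked s alive s₂ alive'' l ∧
              c + 30 * (s₂.var vR + (roots s₂ alive'').card) ≤ c₂ + 60 * s.var vR ∧
              30 * s₂.var vR + 30 * (roots s₂ alive'').card + 1 ≤ c₂ := by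
          intro c₂ s₂ a b' g0 hab hkey g1 g2 g3 g4 g5 g6 g7 g8 g9 g10 g11 g12
          have ha : a ∈ alive' ∧ s'.arr aPar a = 0 ∧ s'.arr aHt a = s'.arr aHt x := by
            rcases hab with ⟨rfl, -⟩ | ⟨rfl, -⟩
            exacts [⟨hxr'.1, hxr'.2, rfl⟩, ⟨hbr'.1, hbr'.2, hbh⟩]
          have hb' : b' ∈ alive' ∧ s'.arr aPar b' = 0 ∧ s'.arr aHt b' = s'.arr aHt x := by
            rcases hab with ⟨-, rfl⟩ | ⟨-, rfl⟩
            exacts [⟨hbr'.1, hbr'.2, hbh⟩, ⟨hxr'.1, hxr'.2, rfl⟩]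
          have hT := hH.forest.link ha.1 hb'.1 ha.2.1 hb'.2.1 (by grind) (by omega) hdal hH.new_ne
            hkey
          have hcnt : s'.arr aCnt = count (s'.arr aHt) alive' := funext hH.count
          have hda : d ≠ a := by rintro rfl; exact hdal ha.1
          have hdb : d ≠ b' := by rintro rfl; exact hdal hb'.1
          have hroots : roots s₂ (insert d alive') = insert d (((roots s' alive').erase x).erase b) := by
            rw [roots, g4, rootSet_link hda hdb hH.new_ne]
            rcases hab with ⟨rfl, rfl⟩ | ⟨rfl, rfl⟩
            · rfl
            · rw [Finset.erase_right_comm]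
          have hdr : d ∉ roots s' alive' := fun hm => hdal (Finset.mem_filter.1 hm).1
          have hrc : (roots s₂ (insert d alive')).card + 1 = (roots s' alive').card := by
            rw [hroots, Finset.card_insert_of_notMem (by simp [hdr])]
            have h1 := Finset.card_erase_add_one hxr
            have h2 := Finset.card_erase_add_one (Finset.mem_erase.2 ⟨hxb.symm, hbr⟩)
            omega
          have hb0 : b' ≠ 0 := hH.ne_zero hb'.1
          refine ⟨insert d alive', l + 1, insert d (S.erase x), ⟨?_, ?_, ?_, fun i => ?_⟩,
            ⟨?_, ?_, fun i hi => ?_, fun e he => ?_⟩, ⟨?_, ?_, ?_, ?_, fun M hM e he => ?_⟩, ?_, ?_⟩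
          · rw [g1, g2, g3, g4, g5, g6, g7, ← ha.2.2]; exact hT
          · rw [g9]
            intro e he
            rcases Finset.mem_insert.1 he with rfl | he
            · omega
            · have := hH.fresh e he; omega
          · omega
          · rw [g8, g5, count_insert hdal, hcnt]
          · rw [g11, g10, hx]
            exact hst.replace (by omega) fun hm => hdr (hLk.subset hm)
          · rw [hroots]
            intro e he
            simp only [Finset.mem_insert, Finset.mem_erase] at he ⊢
            rcases he with rfl | ⟨h1, h2⟩
            · exact .inl rfl
            · exact .inr ⟨by rintro rfl; exact hbS h2, h1, hLk.subset h2⟩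
          · rw [g12] at hi ⊢
            by_cases hix : i = s'.arr aHt x
            · simp [hix] at hi
            · rw [update_of_ne hix] at hi ⊢
              obtain ⟨h1, h2, h3⟩ := hLk.bucket i hi
              have hne : s'.arr aBk i ≠ d := by intro he; exact hdr (he ▸ h1)
              rw [g5, hroots, update_of_ne hne, Finset.mem_insert, Finset.mem_erase,
                Finset.mem_erase]
              refine ⟨.inr ⟨?_, ?_, h1⟩, h2, ?_⟩
              · intro he; exact hix (by rw [← h2, he, hbh])
              · intro he; exact hix (by rw [← h2, he])
              · simp only [Finset.mem_insert, Finset.mem_erase]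
                rintro (he | he)
                exacts [hne he, h3 he.2]
          · rw [hroots] at he
            simp only [Finset.mem_insert, Finset.mem_erase] at he ⊢
            by_cases hed : e = d
            · exact .inl (.inl hed)
            · have he' := he.resolve_left hed
              rcases hLk.cover e he'.2.2 with h1 | h1
              · exact .inl (.inr ⟨he'.2.1, h1⟩)
              · right
                rw [g5, update_of_ne hed, g12, update_of_ne, h1]
                intro hh
                rw [hh] at h1
                exact he'.1 h1.symm
          · rw [Finset.card_insert_of_notMem hdal, hLd.card, add_assoc]
          · have := hLd.card_roots; omega
          · rw [g3, g5, defects_insert hdal hb0, hLd.defects]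
          · rw [g5, count_insert hdal, update_of_ne (by omega), hLd.count]
          · have h1 := hLd.height M hM
            rw [g5]
            rcases Finset.mem_insert.1 he with rfl | he
            · rw [update_self]
              have := h1 x hxr'.1
              omega
            · rw [update_of_ne (by rintro rfl; exact hdal he)]
              have := h1 e he
              omega
          · omega
          · omega
        refine WP.chain_cons (WP.block (by simp) (by simp; omega) ?_)
        refine WP.chain_cons (WP.ite (by simp; omega) (fun hb => WP.block (by simp) (by simp; omega) ?_)
          (fun hb => WP.skip (by simp; omega) ?_)) <;>
        simp [Instr.apply, Test.Holds, eA₁, eF₁, eC₁, eB₁] at hb <;>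
        refine WP.chain_singleton (WP.block (by simp) (by simp; omega) ?_) <;>
        generalize hS : List.foldl _ _ _ = s₂
        · refine next _ s₂ b x (by simp; omega) (.inr ⟨rfl, rfl⟩) hb.le ?_ ?_ ?_ ?_ ?_ ?_ ?_ ?_ ?_ ?_ ?_ ?_ <;>
          rw [← hS] <;> simp [Instr.apply, eA₁, eF₁, eC₁, eB₁, eH₁, eN₁, eJ₁, eZ₁, eR₁]
        · refine next _ s₂ x b (by simp; omega) (.inl ⟨rfl, rfl⟩) hb ?_ ?_ ?_ ?_ ?_ ?_ ?_ ?_ ?_ ?_ ?_ ?_ <;>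
          rw [← hS] <;> simp [Instr.apply, eA₁, eF₁, eC₁, eB₁, eH₁, eN₁, eJ₁, eZ₁, eR₁]
    · simp only [Test.Holds, eZ, not_not] at hf
      have : S = ∅ := by rw [← Finset.card_eq_zero, hScard, hf]
      subst this
      exact ⟨alive', l, by omega, hf, hH, hLk, hLd⟩
end RealRAM

/-! ### Restoring the geometric decay, and the amortized cost of an extraction -/

namespace RealRAM
open Tournament Function Instr Test Program

/-- The occupied heights form an initial segment, so all buckets have been visited when a height
without nodes is reached. Each bucket holds at most one root, which bounds the number of roots by `M
+ 1`. -/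
theorem wp_unbucket {s : State} {c M : ℕ} {alive live : Finset ℕ} (hz : s.var vZ = 0)
    (h : Heap s alive live) (hl : Linking s alive ∅) (hR : s.var vR = 0)
    (hM : ∀ d ∈ alive, s.arr aHt d ≤ M) (hc : 10 * M + 20 ≤ c) :
    WP unbucketP (fun c' s' => c ≤ c' + 10 * M + 20 ∧ Heap s' alive live ∧ Stacked s' alive ∧
      (∀ i, s'.arr aBk i = 0) ∧ s'.var vR ≤ M + 1) c s := by
  refine WP.conseq (Q := fun c' s' => c ≤ c' + 10 * M + 20 ∧ Stacked s' alive ∧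
      (∀ i, s'.arr aBk i = 0) ∧ s'.var vR ≤ M + 1) ?_ fun c' s' hS hq =>
    ⟨hq.1, h.frame hS rfl, hq.2⟩
  refine WP.chain_cons (WP.block (by simp) (by simp; omega) (WP.chain_singleton ?_))
  have hcM : ∀ i, s.arr aCnt i ≠ 0 → i ≤ M := by
    intro i hi
    rw [h.count] at hi
    obtain ⟨d, hd⟩ := Finset.card_pos.1 (Nat.pos_of_ne_zero hi)
    have hd := Finset.mem_filter.1 hd
    exact hd.2 ▸ hM d hd.1
  refine WP.loop (fun c' s' => ∃ S, Linking s' alive S ∧ s'.var vR ≤ s'.var vH ∧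
    s'.var vH ≤ M + 1 ∧ s'.var vX = s.arr aCnt (s'.var vH) ∧
    (∀ i < s'.var vH, s'.arr aBk i = 0) ∧ c ≤ c' + 10 * s'.var vH + 2) ?_ ?_
  · refine ⟨∅, ⟨?_, ?_, ?_, ?_⟩, ?_, Nat.zero_le _, rfl, fun i hi => ?_, by simp; omega⟩
    · exact hl.stack
    · exact hl.subset
    · exact hl.bucket
    · exact hl.cover
    · exact hR.le
    · exact absurd hi (Nat.not_lt_zero i)
  · rintro c' s' hS ⟨S, hL, h1, h2, h3, h4, h5⟩
    have eZ : s'.var vZ = 0 := (hS.var _ rfl).trans hz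
    have eC : s'.arr aCnt = s.arr aCnt := hS.arr _ rfl
    have eP : s'.arr aPar = s.arr aPar := hS.arr _ rfl
    have eH : s'.arr aHt = s.arr aHt := hS.arr _ rfl
    refine ⟨by omega, fun ht => ?_, fun hf => ?_⟩
    · simp only [Test.Holds, eZ, h3] at ht
      have hHM := hcM _ ht
      refine WP.chain_cons (WP.block (by simp) (by simp; omega) ?_)
      refine WP.chain_cons (WP.ite (by simp; omega) (fun hb => WP.block (by simp) (by simp; omega) ?_)
        (fun hb => WP.skip (by simp; omega) ?_)) <;>
      simp [Instr.apply, Test.Holds, eZ] at hb <;>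
      refine WP.chain_singleton (WP.block (by simp) (by simp; omega) ?_) <;>
      generalize hs₂ : List.foldl _ _ _ = s₂
      · obtain ⟨hb1, hb2, hb3⟩ := hL.bucket _ hb
        set b := s'.arr aBk (s'.var vH) with hbdef
        have g1 : s₂.arr aBk = update (s'.arr aBk) (s'.var vH) 0 := by
          rw [← eZ, ← hs₂]; rfl
        have g2 : s₂.arr aRs = update (s'.arr aRs) (s'.var vR) b := by
          rw [← hs₂]; rfl
        have g3 : s₂.var vR = s'.var vR + 1 := by rw [← hs₂]; rfl
        have g4 : s₂.var vH = s'.var vH + 1 := by rw [← hs₂]; rfl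
        have g5 : s₂.arr aPar = s'.arr aPar := by rw [← hs₂]; rfl
        have g6 : s₂.arr aHt = s'.arr aHt := by rw [← hs₂]; rfl
        have g7 : s₂.var vX = s'.arr aCnt (s'.var vH + 1) := by rw [← hs₂]; rfl
        have g8 : roots s₂ alive = roots s' alive := by rw [roots, g5]
        refine ⟨insert b S, ⟨?_, ?_, fun i hi => ?_, fun d hd => ?_⟩, by omega, by omega, by
          rw [g7, g4, eC], fun i hi => ?_, by simp; omega⟩
        · rw [g2, g3]; exact hL.stack.push hb3
        · rw [g8]; exact Finset.insert_subset hb1 hL.subset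
        · rw [g1] at hi ⊢
          by_cases hix : i = s'.var vH
          · simp [hix] at hi
          · rw [update_of_ne hix] at hi ⊢
            obtain ⟨k1, k2, k3⟩ := hL.bucket i hi
            rw [g8, g6]
            refine ⟨k1, k2, ?_⟩
            simp only [Finset.mem_insert, not_or]
            exact ⟨fun he => hix (by rw [← k2, he, hb2]), k3⟩
        · rw [g8] at hd
          rw [g1, g6, Finset.mem_insert]
          by_cases hdb : d = b
          · exact .inl (.inl hdb)
          · rcases hL.cover d hd with k | k
            · exact .inl (.inr k)
            · right
              rw [update_of_ne, k]
              intro he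
              rw [he] at k
              exact hdb k.symm
        · rw [g1]
          rw [g4] at hi
          by_cases hix : i = s'.var vH
          · simp [hix]
          · rw [update_of_ne hix]; exact h4 i (by omega)
      · have g1 : s₂.arr aBk = s'.arr aBk := by rw [← hs₂]; rfl
        have g2 : s₂.arr aRs = s'.arr aRs := by rw [← hs₂]; rfl
        have g3 : s₂.var vR = s'.var vR := by rw [← hs₂]; rfl
        have g4 : s₂.var vH = s'.var vH + 1 := by rw [← hs₂]; rfl
        have g5 : s₂.arr aPar = s'.arr aPar := by rw [← hs₂]; rfl
        have g6 : s₂.arr aHt = s'.arr aHt := by rw [← hs₂]; rfl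
        have g7 : s₂.var vX = s'.arr aCnt (s'.var vH + 1) := by rw [← hs₂]; rfl
        have g8 : roots s₂ alive = roots s' alive := by rw [roots, g5]
        refine ⟨S, ⟨?_, ?_, ?_, ?_⟩, by omega, by omega, by
          rw [g7, g4, eC], fun i hi => ?_, by simp; omega⟩
        · rw [g2, g3]; exact hL.stack
        · rw [g8]; exact hL.subset
        · rw [g1, g8, g6]; exact hL.bucket
        · rw [g1, g8, g6]; exact hL.cover
        · rw [g1]
          rw [g4] at hi
          by_cases hix : i = s'.var vH
          · rw [hix, hb]
          · exact h4 i (by omega)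
    · simp only [Test.Holds, eZ, h3, not_not] at hf
      have hlow : ∀ d ∈ alive, s.arr aHt d < s'.var vH := by
        intro d hd
        by_contra hle
        have := h.forest.count_ne_zero hd (not_lt.1 hle)
        rw [← h.count] at this
        exact this hf
      have hbk : ∀ i, s'.arr aBk i = 0 := by
        intro i
        by_contra hi
        obtain ⟨k1, k2, -⟩ := hL.bucket i hi
        have := hlow _ (Finset.mem_filter.1 k1).1
        rw [← eH, k2] at this
        exact hi (h4 i this)
      have hSr : S = roots s' alive := by
        refine hL.subset.antisymm fun d hd => ?_
        refine (hL.cover d hd).resolve_right fun hk => ?_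
        rw [hbk] at hk
        exact h.ne_zero (Finset.mem_filter.1 hd).1 hk.symm
      exact ⟨by omega, by rw [Stacked, ← hSr]; exact hL.stack, hbk, by omega⟩

/-- The machine cannot multiply, so `⌈3 * x / 4⌉` comes from a table. For natural numbers `y < ⌈3 *
x / 4⌉` means `4 * y < 3 * x`; therefore the loop goes on exactly while the counts decay, which is
logarithmically long by `lt_log_of_decay`. -/
theorem wp_scan {s : State} {c n : ℕ} {alive live : Finset ℕ} (h : Heap s alive live)
    (htab : ∀ x ≤ n, s.arr aTq x = (3 * x + 3) / 4) (hn : count (s.arr aHt) alive 0 ≤ n)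
    (hc : 20 * (Nat.log 2 n + 1) + 20 ≤ c) :
    WP scanP (fun c' s' => c ≤ c' + 20 * (Nat.log 2 n + 1) + 20 ∧
      (∀ i < s'.var vQ, 4 * count (s.arr aHt) alive (i + 1) ≤ 3 * count (s.arr aHt) alive i) ∧
      (count (s.arr aHt) alive (s'.var vQ) = 0 ∨ 3 * count (s.arr aHt) alive (s'.var vQ) ≤
        4 * count (s.arr aHt) alive (s'.var vQ + 1))) c s := by
  have hanti : Antitone (s.arr aCnt) := by
    rw [show s.arr aCnt = count (s.arr aHt) alive from funext h.count]
    exact antitone_nat_of_succ_le h.forest.count_succ_le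
  simp only [← h.count] at hn ⊢
  have hle : ∀ i, s.arr aTq (s.arr aCnt i) = (3 * s.arr aCnt i + 3) / 4 := fun i =>
    htab _ ((hanti (Nat.zero_le i)).trans hn)
  refine WP.chain_cons (WP.block (by simp) (by simp; omega) (WP.chain_singleton ?_))
  refine WP.loop (fun c' s' => s'.var vB = (3 * s.arr aCnt (s'.var vQ) + 3) / 4 ∧
    s'.var vC = s.arr aCnt (s'.var vQ + 1) ∧ c ≤ c' + 6 * s'.var vQ + 5 ∧
    s'.var vQ ≤ 3 * (Nat.log 2 n + 1) ∧
    ∀ i < s'.var vQ, 4 * s.arr aCnt (i + 1) ≤ 3 * s.arr aCnt i) ?_ ?_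
  · refine ⟨hle 0, rfl, ?_, Nat.zero_le _, fun i hi => absurd hi (Nat.not_lt_zero i)⟩
    simp [Instr.apply]; omega
  · rintro c' s' hS ⟨h1, h2, h3, h4, h5⟩
    have eC : s'.arr aCnt = s.arr aCnt := hS.arr _ rfl
    have eT : s'.arr aTq = s.arr aTq := hS.arr _ rfl
    refine ⟨by omega, fun ht => ?_, fun hf => ?_⟩
    · simp only [Test.Holds, h1, h2] at ht
      have hlt : s'.var vQ < 3 * (Nat.log 2 n + 1) :=
        lt_log_of_decay (f := s.arr aCnt) hn h5 (by omega)
      refine WP.block (by simp) (by simp; omega) ?_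
      generalize hs₂ : List.foldl _ _ _ = s₂
      have g1 : s₂.var vQ = s'.var vQ + 1 := by rw [← hs₂]; rfl
      have g2 : s₂.var vB = s'.arr aTq (s'.arr aCnt (s'.var vQ + 1)) := by rw [← hs₂]; rfl
      have g3 : s₂.var vC = s'.arr aCnt (s'.var vQ + 1 + 1) := by rw [← hs₂]; rfl
      rw [g1, g2, g3, eT, eC]
      refine ⟨hle _, rfl, by simp; omega, by omega, fun i hi => ?_⟩
      rcases Nat.lt_succ_iff_lt_or_eq.1 hi with hi | rfl
      · exact h5 i hi
      · omega
    · simp only [Test.Holds, h1, h2] at hf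
      exact ⟨by omega, h5, by omega⟩

/-- A removed node pays 20 credits for its removal and 15 for the later visit to the root that it
may release. This explains 35 credits per node and 15 per initial root. -/
theorem wp_quake {s : State} {c : ℕ} {alive live : Finset ℕ} (hz : s.var vZ = 0)
    (h : Heap s alive live) (hs : Stacked s alive) (hc : 15 * s.var vR + 35 * alive.card + 5 ≤ c) :
    WP quakeP (fun c' s' => ∃ alive', alive' = alive.filter (fun d => s.arr aHt d ≤ s.var vQ) ∧
      Heap s' alive' live ∧ Stacked s' alive' ∧
      s'.var vR ≤ s.var vR + count (s.arr aHt) alive (s.var vQ) ∧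
      c + 35 * alive'.card ≤ c' + 15 * s.var vR + 35 * alive.card + 5) c s := by
  refine WP.chain_cons (WP.block (by simp) (by simp; omega) (WP.chain_singleton ?_))
  refine WP.loop (fun c' s' => ∃ alive' ⊆ alive, Heap s' alive' live ∧ Stacked s' alive' ∧
    s'.var vJ ≤ s'.var vR ∧ s'.var vR + alive'.card ≤ s.var vR + alive.card ∧
    (∀ d ∈ alive, s.arr aHt d ≤ s.var vQ → d ∈ alive') ∧
    (∀ d ∈ roots s' alive', s.arr aHt d < s.var vQ → d ∈ roots s alive) ∧
    (∀ i < s'.var vJ, s.arr aHt (s'.arr aRs i) ≤ s.var vQ) ∧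
    c + 20 * alive'.card ≤ c' + 15 * s'.var vJ + 20 * alive.card + 1) ?_ ?_
  · refine ⟨alive, subset_rfl, ?_, ?_, Nat.zero_le _, le_rfl, fun d hd _ => hd, fun d hd _ => hd,
      fun i hi => absurd hi (Nat.not_lt_zero i), by simp; omega⟩
    · apply h.congr <;> rfl
    · exact hs
  · rintro c' s' hS ⟨alive', h1, h2, h3, h4, h5, h6, h7, h8, h9⟩
    have eZ : s'.var vZ = 0 := (hS.var _ rfl).trans hz
    have eQ : s'.var vQ = s.var vQ := hS.var _ rfl
    have eH : s'.arr aHt = s.arr aHt := hS.arr _ rfl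
    refine ⟨by omega, fun ht => ?_, fun hf => ?_⟩
    · simp only [Test.Holds] at ht
      have hlt := h2.forest.ht_lt_card (Finset.mem_filter.1 (h3.mem _ ht)).1
      refine WP.chain_cons ((wp_crack eZ h2 h3 ht (by omega)).conseq ?_)
      rintro c₁ s₁ hS₁ ⟨alive₁, hk, hle⟩
      have eJ₁ : s₁.var vJ = s'.var vJ := hS₁.var _ rfl
      have k1 := hk.credits
      have k2 := hk.card
      have k3 := hk.size_le
      have k4 := hk.le_size
      have k5 := hk.ht_le
      refine WP.chain_singleton (WP.block (by simp) (by simp; omega) ?_)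
      generalize hs₂ : List.foldl _ _ _ = s₂
      have g1 : s₂.var vJ = s'.var vJ + 1 := by rw [← eJ₁, ← hs₂]; rfl
      have g2 : s₂.var vR = s₁.var vR := by rw [← hs₂]; rfl
      have g3 : s₂.arr aPar = s₁.arr aPar := by rw [← hs₂]; rfl
      have g4 : s₂.arr aRs = s₁.arr aRs := by rw [← hs₂]; rfl
      have g5 : roots s₂ alive₁ = roots s₁ alive₁ := by rw [roots, g3]
      refine ⟨alive₁, hk.subset.trans h1, ?_, ?_, by omega, by omega, fun d hd hdq => ?_,
        fun d hd hdq => ?_, fun i hi => ?_, by simp; omega⟩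
      · apply hk.heap.congr <;> (rw [← hs₂]; rfl)
      · exact Stacked.congr hk.stacked g3 g4 g2
      · exact hk.low d (h6 d hd hdq) (by rw [eH, eQ]; exact hdq)
      · rw [g5] at hd
        exact h7 d (hk.low_roots d hd (by rw [eH, eQ]; exact hdq)) hdq
      · rw [g4]
        rcases Nat.lt_succ_iff_lt_or_eq.1 (g1 ▸ hi) with hi | rfl
        · rw [hk.other i (by omega) (by omega)]
          exact h8 i hi
        · rw [← eH, ← eQ]; exact hle
    · simp only [Test.Holds] at hf
      have hrt : ∀ d ∈ roots s' alive', s.arr aHt d ≤ s.var vQ := by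
        intro d hd
        obtain ⟨i, hi, rfl⟩ := h3.surj d hd
        exact h8 i (by omega)
      have hal : ∀ d ∈ alive', s.arr aHt d ≤ s.var vQ := by
        intro d hd
        obtain ⟨r, hr, hp, hle, -⟩ := h2.forest.exists_root hd
        rw [eH] at hle
        exact hle.trans (hrt r (Finset.mem_filter.2 ⟨hr, hp⟩))
      refine ⟨alive', ?_, h2, h3, ?_, by omega⟩
      · ext d
        rw [Finset.mem_filter]
        exact ⟨fun hd => ⟨h1 hd, hal d hd⟩, fun hd => h6 d hd.1 hd.2⟩
      · rw [← h3.card_eq, ← hs.card_eq, count]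
        refine (Finset.card_le_card (t := roots s alive ∪ _) fun d hd => ?_).trans
          (Finset.card_union_le _ _)
        rw [Finset.mem_union, Finset.mem_filter]
        -- A root below the cut-off height was a root before; every new root lies exactly at the
        -- cut-off height.
        rcases (hrt d hd).lt_or_eq with hlt | heq
        · exact .inl (h7 d hd hlt)
        · exact .inr ⟨h1 (Finset.mem_filter.1 hd).1, heq⟩

/-- The invariant of the priority queue. -/
structure Queue (n : ℕ) (s : State) (alive live : Finset ℕ) : Prop where
  heap : Heap s alive live
  stacked : Stacked s alive
  bucket : ∀ i, s.arr aBk i = 0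
  decay : ∀ i, 4 * count (s.arr aHt) alive (i + 1) ≤ 3 * count (s.arr aHt) alive i
  size : count (s.arr aHt) alive 0 ≤ n

/-- The potential of the priority queue. -/
def potential (s : State) (alive : Finset ℕ) : ℕ :=
  35 * alive.card + 200 * s.var vR + 400 * defects (s.arr aRc) (s.arr aHt) alive

theorem defects_mono {rc ht : ℕ → ℕ} {alive alive' : Finset ℕ} (h : alive' ⊆ alive) :
    defects rc ht alive' ≤ defects rc ht alive :=
  Finset.card_le_card (Finset.filter_subset_filter _ h)

theorem defects_filter_le (rc ht : ℕ → ℕ) (alive : Finset ℕ) (q : ℕ) :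
    defects rc ht (alive.filter fun d => ht d ≤ q) +
      (alive.filter fun d => ht d = q + 1 ∧ rc d = 0).card ≤ defects rc ht alive := by
  rw [defects, defects, ← Finset.card_union_of_disjoint]
  · refine Finset.card_le_card fun d hd => ?_
    simp only [Finset.mem_union, Finset.mem_filter] at hd ⊢
    grind
  · rw [Finset.disjoint_left]
    intro d hd hd'
    simp only [Finset.mem_filter] at hd hd'
    omega

theorem count_filter_le (ht : ℕ → ℕ) (alive : Finset ℕ) (q i : ℕ) :
    count ht (alive.filter fun d => ht d ≤ q) i = if i ≤ q then count ht alive i else 0 := by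
  rw [count, Finset.filter_filter]
  split_ifs with h
  · rw [count]
    congr 1
    refine Finset.filter_congr fun d _ => ?_
    omega
  · rw [Finset.card_eq_zero, Finset.filter_eq_empty_iff]
    intro d _
    omega

/-- Let `r₁` and `r₂` be the numbers of roots before and after `l` links. Then `r₂ = r₁ - l`, and
`r₂ ≤ L + l + 1` because the roots then have distinct heights, none above `L + l`. Adding the two
gives `2 * r₂ ≤ r₁ + L + 1`. So about half of the roots disappear, and the 200 units of potential of
each of these cover all work that is linear in `r₁` and the 35 units of each new node. What remains
is a multiple of `L`. -/
theorem wp_extract {s : State} {c n : ℕ} {alive live : Finset ℕ} (hz : s.var vZ = 0)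
    (htab : ∀ x ≤ n, s.arr aTq x = (3 * x + 3) / 4) (h : Queue n s alive live)
    (hR : s.var vR ≠ 0) (hc : potential s alive + 2000 * (Nat.log 2 n + 1) ≤ c) :
    WP extractP (fun c' s' => ∃ alive', Queue n s' alive' (live.erase (s'.var vU)) ∧
      s'.var vU ∈ live ∧ (∀ x ∈ live, s.rarr fD (s'.var vU) ≤ s.rarr fD x) ∧
      c + potential s' alive' ≤ c' + potential s alive + 2000 * (Nat.log 2 n + 1)) c s := by
  have hlt : ∀ d ∈ alive, s.arr aHt d ≤ 3 * (Nat.log 2 n + 1) := fun d hd =>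
    (lt_log_of_decay h.size (fun i _ => h.decay i) (h.heap.forest.count_ne_zero hd le_rfl)).le
  simp only [potential] at hc ⊢
  set L := 3 * (Nat.log 2 n + 1) with hL
  refine WP.chain_cons ((wp_pop hz h.heap h.stacked hR hlt (by omega)).conseq ?_)
  rintro c₁ s₁ hS₁ ⟨alive₁, hsub₁, hc₁, hH₁, hst₁, hR₁, hR₁', hu, hmin⟩
  have eZ₁ : s₁.var vZ = 0 := (hS₁.var _ rfl).trans hz
  have eH₁ : s₁.arr aHt = s.arr aHt := hS₁.arr _ rfl
  have eRc₁ : s₁.arr aRc = s.arr aRc := hS₁.arr _ rfl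
  have eBk₁ : s₁.arr aBk = s.arr aBk := hS₁.arr _ rfl
  have hB₁ := defects_mono (rc := s.arr aRc) (ht := s.arr aHt) hsub₁
  have hN₁ := Finset.card_le_card hsub₁
  have hC₁ : count (s₁.arr aHt) alive₁ 0 ≤ n := by
    rw [eH₁]
    exact (Finset.card_le_card (Finset.filter_subset_filter _ hsub₁)).trans h.size
  refine WP.chain_cons ((wp_link eZ₁ hH₁ hst₁ (by rw [eBk₁]; exact h.bucket) (by omega)).conseq ?_)
  rintro c₂ s₂ hS₂ ⟨alive₂, l, hc₂, hR₂, hH₂, hL₂, hLd⟩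
  have eZ₂ : s₂.var vZ = 0 := (hS₂.var _ rfl).trans eZ₁
  have hM₂ := hLd.height L (fun d hd => by rw [eH₁]; exact hlt d (hsub₁ hd))
  have hr₁ := hst₁.card_eq
  have hr₂ := hLd.card_roots
  have hN₂ := hLd.card
  have hB₂ := hLd.defects
  rw [eRc₁, eH₁] at hB₂
  refine WP.chain_cons ((wp_unbucket eZ₂ hH₂ hL₂ hR₂ hM₂ (by omega)).conseq ?_)
  rintro c₃ s₃ hS₃ ⟨hc₃, hH₃, hst₃, hb₃, hR₃⟩
  have eZ₃ : s₃.var vZ = 0 := (hS₃.var _ rfl).trans eZ₂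
  have eH₃ : s₃.arr aHt = s₂.arr aHt := hS₃.arr _ rfl
  have eRc₃ : s₃.arr aRc = s₂.arr aRc := hS₃.arr _ rfl
  have eP₃ : s₃.arr aPar = s₂.arr aPar := hS₃.arr _ rfl
  have eT₃ : s₃.arr aTq = s.arr aTq :=
    (hS₃.arr _ rfl).trans ((hS₂.arr _ rfl).trans (hS₁.arr _ rfl))
  have hr₃ : s₃.var vR = (roots s₂ alive₂).card := by rw [← hst₃.card_eq, roots, eP₃]
  have hC₃ : count (s₃.arr aHt) alive₂ 0 ≤ n := by rw [eH₃, hLd.count]; exact hC₁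
  refine WP.chain_cons ((wp_scan hH₃ (by rw [eT₃]; exact htab) hC₃ (by omega)).conseq ?_)
  rintro c₄ s₄ hS₄ ⟨hc₄, hlow, hq⟩
  have eZ₄ : s₄.var vZ = 0 := (hS₄.var _ rfl).trans eZ₃
  have hH₄ := hH₃.frame hS₄ rfl
  have hst₄ : Stacked s₄ alive₂ :=
    Stacked.congr hst₃ (hS₄.arr _ rfl) (hS₄.arr _ rfl) (hS₄.var _ rfl)
  have eR₄ : s₄.var vR = s₃.var vR := hS₄.var _ rfl
  have eH₄ : s₄.arr aHt = s₃.arr aHt := hS₄.arr _ rfl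
  have eRc₄ : s₄.arr aRc = s₃.arr aRc := hS₄.arr _ rfl
  refine WP.chain_singleton ((wp_quake eZ₄ hH₄ hst₄ (by omega)).conseq ?_)
  rintro c₅ s₅ hS₅ ⟨alive₅, hal, hH₅, hst₅, hR₅, hc₅⟩
  have eH₅ : s₅.arr aHt = s₄.arr aHt := hS₅.arr _ rfl
  have eRc₅ : s₅.arr aRc = s₄.arr aRc := hS₅.arr _ rfl
  have eU : s₅.var vU = s₁.var vU := (hS₅.var _ rfl).trans
    ((hS₄.var _ rfl).trans ((hS₃.var _ rfl).trans (hS₂.var _ rfl)))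
  have eBk₅ : s₅.arr aBk = s₃.arr aBk := (hS₅.arr _ rfl).trans (hS₄.arr _ rfl)
  rw [eU]
  have hcnt : ∀ i, count (s₅.arr aHt) alive₅ i =
      if i ≤ s₄.var vQ then count (s₃.arr aHt) alive₂ i else 0 := by
    intro i
    rw [hal, eH₅, count_filter_le, eH₄]
  -- If `3 * count q ≤ 4 * count (q + 1)`, then by `htwo` at least `count q / 2` nodes of height `q
  -- + 1` have a single child. All of them are discarded, and their 400 units each pay the 200 units
  -- for each of the at most `count q` new roots.
  have hdef := defects_filter_le (s₄.arr aRc) (s₄.arr aHt) alive₂ (s₄.var vQ)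
  have htwo := hH₄.forest.two_mul_count_le (s₄.var vQ)
  rw [← hal] at hdef
  rw [eH₄] at htwo hR₅
  refine ⟨alive₅, ⟨hH₅, hst₅, by rw [eBk₅]; exact hb₃, fun i => ?_, ?_⟩, hu, hmin, ?_⟩
  · rw [hcnt, hcnt]
    split_ifs
    · exact hlow i (by omega)
    · omega
    · omega
    · omega
  · rw [hcnt, if_pos (Nat.zero_le _)]
    exact hC₃
  · rw [eRc₅, eH₅]
    have e : defects (s₄.arr aRc) (s₄.arr aHt) alive₂ = defects (s₂.arr aRc) (s₂.arr aHt) alive₂ := by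
      rw [eRc₄, eH₄, eRc₃, eH₃]
    rw [e, hB₂, eH₄] at hdef
    rw [eH₄]
    omega

end RealRAM

/-! ### Decreasing a key and building the queue -/

namespace RealRAM
open Tournament Function Instr Test Program

/-- A cut creates one root (200 units of potential) and at most one defect (400 units), and takes at
most 20 steps: 620 in total. Heights and nodes stay the same, so the decay is not affected. -/
theorem wp_decrease {s : State} {c n : ℕ} {alive live : Finset ℕ} (hz : s.var vZ = 0)
    (h : Queue n s alive live) (hv : s.var vV ∈ live) (hr : s.rvar rT ≤ s.rarr fD (s.var vV))
    (hc : 20 ≤ c) :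
    WP (chain [block [rstore fD vV rT, store aNxt vV vU], decreaseP]) (fun c' s' =>
      Queue n s' alive live ∧ s'.rarr fD = update (s.rarr fD) (s.var vV) (s.rvar rT) ∧
      s'.arr aNxt = update (s.arr aNxt) (s.var vV) (s.var vU) ∧
      c + potential s' alive ≤ c' + potential s alive + 620 ∧ c ≤ c' + 20) c s := by
  have htop := h.heap.forest.topmost _ hv
  refine WP.chain_cons (WP.block (by simp) (by simp; omega) (WP.chain_singleton ?_))
  refine WP.chain_cons (WP.block (by simp) (by simp; omega) (WP.chain_singleton ?_))
  refine WP.ite (by simp; omega) (fun hb => WP.block (by simp) (by simp; omega) ?_)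
    (fun hb => WP.skip (by simp; omega) ?_) <;>
  simp [Instr.apply, Test.Holds, hz] at hb <;>
  generalize hs₂ : List.foldl _ _ _ = s₂
  · set t := s.arr aTop (s.var vV) with ht
    set b := s.arr aPar t with hbdef
    have f1 : s₂.arr aOwn = s.arr aOwn := by rw [← hs₂]; rfl
    have f2 : s₂.arr aLc = s.arr aLc := by rw [← hs₂]; rfl
    have f3 : s₂.arr aRc = update (s.arr aRc) b 0 := by rw [← hz, ← hs₂]; rfl
    have f4 : s₂.arr aPar = update (s.arr aPar) t 0 := by rw [← hz, ← hs₂]; rfl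
    have f5 : s₂.arr aHt = s.arr aHt := by rw [← hs₂]; rfl
    have f6 : s₂.arr aTop = s.arr aTop := by rw [← hs₂]; rfl
    have f7 : s₂.rarr fD = update (s.rarr fD) (s.var vV) (s.rvar rT) := by rw [← hs₂]; rfl
    have f8 : s₂.arr aRs = update (s.arr aRs) (s.var vR) t := by rw [← hs₂]; rfl
    have f9 : s₂.var vR = s.var vR + 1 := by rw [← hs₂]; rfl
    have f10 : s₂.var vNew = s.var vNew := by rw [← hs₂]; rfl
    have f11 : s₂.arr aCnt = s.arr aCnt := by rw [← hs₂]; rfl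
    have f12 : s₂.arr aBk = s.arr aBk := by rw [← hs₂]; rfl
    have hroots : roots s₂ alive = insert t (roots s alive) := by
      ext d
      have := htop.1
      simp only [roots, f4, rootSet, Finset.mem_filter, Finset.mem_insert, update_apply]
      grind
    have hdef : defects (s₂.arr aRc) (s₂.arr aHt) alive ≤ defects (s.arr aRc) (s.arr aHt) alive + 1 := by
      rw [f3, f5, defects, defects]
      refine (Finset.card_le_card (t := insert b _) fun d hd => ?_).trans (Finset.card_insert_le b _)
      simp only [Finset.mem_filter, Finset.mem_insert, update_apply] at hd ⊢
      grind
    refine ⟨⟨⟨?_, ?_, ?_, fun i => ?_⟩, ?_, ?_, ?_, ?_⟩, f7, by rw [← hs₂]; rfl, ?_⟩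
    · rw [f1, f2, f3, f4, f5, f6, f7]
      exact h.heap.forest.cut hv hr hb
    · rw [f10]; exact h.heap.fresh
    · rw [f10]; exact h.heap.new_ne
    · rw [f11, f5]; exact h.heap.count i
    · rw [Stacked, hroots, f8, f9]
      exact h.stacked.push fun hm => hb (Finset.mem_filter.1 hm).2
    · rw [f12]; exact h.bucket
    · rw [f5]; exact h.decay
    · rw [f5]; exact h.size
    · simp only [potential, f9, List.length_cons, List.length_nil]; omega
  · have f1 : s₂.arr aOwn = s.arr aOwn := by rw [← hs₂]; rfl
    have f2 : s₂.arr aLc = s.arr aLc := by rw [← hs₂]; rfl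
    have f3 : s₂.arr aRc = s.arr aRc := by rw [← hs₂]; rfl
    have f4 : s₂.arr aPar = s.arr aPar := by rw [← hs₂]; rfl
    have f5 : s₂.arr aHt = s.arr aHt := by rw [← hs₂]; rfl
    have f6 : s₂.arr aTop = s.arr aTop := by rw [← hs₂]; rfl
    have f7 : s₂.rarr fD = update (s.rarr fD) (s.var vV) (s.rvar rT) := by rw [← hs₂]; rfl
    have f8 : s₂.arr aRs = s.arr aRs := by rw [← hs₂]; rfl
    have f9 : s₂.var vR = s.var vR := by rw [← hs₂]; rfl
    have f10 : s₂.var vNew = s.var vNew := by rw [← hs₂]; rfl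
    have f11 : s₂.arr aCnt = s.arr aCnt := by rw [← hs₂]; rfl
    have f12 : s₂.arr aBk = s.arr aBk := by rw [← hs₂]; rfl
    refine ⟨⟨⟨?_, ?_, ?_, fun i => ?_⟩, ?_, ?_, ?_, ?_⟩, f7, by rw [← hs₂]; rfl, ?_⟩
    · rw [f1, f2, f3, f4, f5, f6, f7]
      exact h.heap.forest.decrease_root hr hb
    · rw [f10]; exact h.heap.fresh
    · rw [f10]; exact h.heap.new_ne
    · rw [f11, f5]; exact h.heap.count i
    · exact Stacked.congr h.stacked f4 f8 f9
    · rw [f12]; exact h.bucket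
    · rw [f5]; exact h.decay
    · rw [f5]; exact h.size
    · simp only [potential, f9, f3, f5, List.length_cons, List.length_nil]; omega

/-- Every tree is a single leaf, which contributes 35 as a node and 200 as a root to the potential,
and there are no defects. -/
theorem wp_build {s : State} {c : ℕ} (hz : s.var vZ = 0) (hcnt : ∀ i, s.arr aCnt i = 0)
    (hbk : ∀ i, s.arr aBk i = 0) (hc : 20 * s.var vN + 10 ≤ c) :
    WP buildP (fun c' s' => ∃ alive,
      Queue (s.var vN) s' alive ((Finset.range (s.var vN)).filter fun v => s.var vL < s.arr aLev v) ∧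
      potential s' alive ≤ 235 * s.var vN ∧ c ≤ c' + 20 * s.var vN + 10) c s := by
  refine WP.chain_cons (WP.block (by simp) (by simp; omega) (WP.chain_singleton ?_))
  refine WP.loop (fun c' s' => ∃ alive,
    Heap s' alive ((Finset.range (s'.var vI)).filter fun v => s.var vL < s.arr aLev v) ∧
    Stacked s' alive ∧ s'.var vI ≤ s.var vN ∧ alive.card ≤ s'.var vI ∧
    (∀ d ∈ alive, s'.arr aPar d = 0 ∧ s'.arr aHt d = 0) ∧
    c ≤ c' + 20 * s'.var vI + 5) ?_ ?_
  · exact ⟨∅, ⟨Tournament.empty _ _ _ _ _ _ _, by simp, one_ne_zero, fun i => hcnt i⟩, IsStack.empty _,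
      Nat.zero_le _, le_rfl, by simp, by simp; omega⟩
  · rintro c' s' hS ⟨alive, h1, h2, h3, h4, h5, h6⟩
    have eZ : s'.var vZ = 0 := (hS.var _ rfl).trans hz
    have eN : s'.var vN = s.var vN := hS.var _ rfl
    have eL : s'.var vL = s.var vL := hS.var _ rfl
    have eV : s'.arr aLev = s.arr aLev := hS.arr _ rfl
    have hroots : roots s' alive = alive := Finset.filter_true_of_mem fun d hd => (h5 d hd).1
    refine ⟨by omega, fun ht => ?_, fun hf => ?_⟩
    · simp only [Test.Holds] at ht
      refine WP.chain_cons (WP.block (by simp) (by simp; omega) ?_)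
      refine WP.chain_cons (WP.ite (by simp; omega) (fun hb => WP.block (by simp) (by simp; omega) ?_)
        (fun hb => WP.skip (by simp; omega) ?_)) <;>
      simp [Instr.apply, Test.Holds, eL, eV] at hb <;>
      refine WP.chain_singleton (WP.block (by simp) (by simp; omega) ?_) <;>
      generalize hs₂ : List.foldl _ _ _ = s₂
      · set d := s'.var vNew with hd
        set v := s'.var vI with hv
        have f1 : s₂.arr aOwn = update (s'.arr aOwn) d v := by rw [← hs₂]; rfl
        have f2 : s₂.arr aLc = s'.arr aLc := by rw [← hs₂]; rfl
        have f3 : s₂.arr aRc = s'.arr aRc := by rw [← hs₂]; rfl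
        have f4 : s₂.arr aPar = update (s'.arr aPar) d 0 := by rw [← eZ, ← hs₂]; rfl
        have f5 : s₂.arr aHt = update (s'.arr aHt) d 0 := by rw [← eZ, ← hs₂]; rfl
        have f6 : s₂.arr aTop = update (s'.arr aTop) v d := by rw [← hs₂]; rfl
        have f7 : s₂.rarr fD = s'.rarr fD := by rw [← hs₂]; rfl
        have f8 : s₂.arr aRs = update (s'.arr aRs) (s'.var vR) d := by rw [← hs₂]; rfl
        have f9 : s₂.var vR = s'.var vR + 1 := by rw [← hs₂]; rfl
        have f10 : s₂.var vNew = d + 1 := by rw [← hs₂]; rfl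
        have f11 : s₂.arr aCnt = update (s'.arr aCnt) 0 (s'.arr aCnt 0 + 1) := by
          rw [← eZ, ← hs₂]; rfl
        have f12 : s₂.var vI = v + 1 := by rw [← hs₂]; rfl
        have hdal : d ∉ alive := fun hm => lt_irrefl _ (h1.fresh d hm)
        have hlive : ((Finset.range (v + 1)).filter fun v => s.var vL < s.arr aLev v) =
            insert v ((Finset.range v).filter fun v => s.var vL < s.arr aLev v) := by
          rw [Finset.range_add_one, Finset.filter_insert, if_pos hb]
        have hpar : ∀ e ∈ insert d alive, s₂.arr aPar e = 0 ∧ s₂.arr aHt e = 0 := by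
          intro e he
          rw [f4, f5]
          rcases Finset.mem_insert.1 he with rfl | he
          · simp
          · have := h5 e he
            have hne : e ≠ d := by rintro rfl; exact hdal he
            simp [hne, this]
        have hroots₂ : roots s₂ (insert d alive) = insert d alive :=
          Finset.filter_true_of_mem fun e he => (hpar e he).1
        refine ⟨insert d alive, ⟨?_, fun e he => ?_, by omega, fun i => ?_⟩, ?_, by omega, ?_, hpar,
          by simp; omega⟩
        · rw [f1, f2, f3, f4, f5, f6, f7, f12, hlive]
          exact h1.forest.insert_leaf (by simp) hdal h1.new_ne
        · rw [f10]
          rcases Finset.mem_insert.1 he with rfl | he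
          · omega
          · have := h1.fresh e he; omega
        · rw [f11, f5, count_insert hdal, show s'.arr aCnt = _ from funext h1.count]
        · rw [Stacked, f8, f9, hroots₂]
          rw [Stacked, hroots] at h2
          exact h2.push hdal
        · rw [Finset.card_insert_of_notMem hdal]; omega
      · have f12 : s₂.var vI = s'.var vI + 1 := by rw [← hs₂]; rfl
        have hlive : ((Finset.range (s'.var vI + 1)).filter fun v => s.var vL < s.arr aLev v) =
            (Finset.range (s'.var vI)).filter fun v => s.var vL < s.arr aLev v := by
          rw [Finset.range_add_one, Finset.filter_insert, if_neg (by omega)]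
        refine ⟨alive, ?_, ?_, by omega, by omega, ?_, by simp; omega⟩
        · rw [f12, hlive]
          apply h1.congr <;> (rw [← hs₂]; rfl)
        · refine Stacked.congr h2 ?_ ?_ ?_ <;> (rw [← hs₂]; rfl)
        · rw [← hs₂]; exact h5
    · simp only [Test.Holds, eN] at hf
      have hI : s'.var vI = s.var vN := by omega
      rw [hI] at h1
      have hr := h2.card_eq
      rw [hroots] at hr
      have hdef : defects (s'.arr aRc) (s'.arr aHt) alive = 0 := by
        rw [defects, Finset.card_eq_zero, Finset.filter_eq_empty_iff]
        intro d hd hh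
        have := (h5 d hd).2
        omega
      have hcount : ∀ i, count (s'.arr aHt) alive (i + 1) = 0 := by
        intro i
        rw [count, Finset.card_eq_zero, Finset.filter_eq_empty_iff]
        intro d hd hh
        have := (h5 d hd).2
        omega
      refine ⟨alive, ⟨h1, h2, ?_, fun i => ?_, ?_⟩, ?_, by omega⟩
      · rw [hS.arr aBk rfl]; exact hbk
      · rw [hcount]; omega
      · exact (Finset.card_le_card (Finset.filter_subset _ _)).trans (by omega)
      · rw [potential, hdef]; omega

end RealRAM

/-! ### Shortest paths -/

/-- A directed graph with vertices `0, …, n - 1` and edges `0, …, m - 1` together with the levels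
and the ancestors (`anc l v` is the ancestor of `v` at level `l`) of an elimination forest. -/
structure Network where
  n : ℕ
  m : ℕ
  tl : ℕ → ℕ
  hd : ℕ → ℕ
  W : ℕ → ℕ → ℝ
  lev : ℕ → ℕ
  anc : ℕ → ℕ → ℕ
  tl_lt : ∀ e < m, tl e < n
  hd_lt : ∀ e < m, hd e < n
  lev_ne : ∀ e < m, lev (tl e) ≠ lev (hd e)
  anc_edge : ∀ e < m, ∀ l ≤ lev (tl e), l ≤ lev (hd e) → anc l (tl e) = anc l (hd e)
  anc_self : ∀ v < n, anc (lev v) v = v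

namespace Network

open Function

variable (N : Network)

/-- There is an edge from `u` to `v`. -/
def Edge (u v : ℕ) : Prop := ∃ e < N.m, N.tl e = u ∧ N.hd e = v

/-- `p` is a potential of the subgraph of the vertices whose level is larger than `l`. -/
def PotentialAbove (l : ℕ) (p : ℕ → ℝ) : Prop :=
  ∀ e < N.m, l < N.lev (N.tl e) → l < N.lev (N.hd e) →
    0 ≤ N.W (N.tl e) (N.hd e) + p (N.tl e) - p (N.hd e)

/-- Following the pointers `nxt` from `x` leads through `S` to a vertex of level `l`, on a path of
weight `w`. -/
inductive Leads (l : ℕ) (nxt : ℕ → ℕ) (S : Set ℕ) : ℕ → ℝ → Prop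
  | base {x : ℕ} (he : N.Edge x (nxt x)) (hl : N.lev (nxt x) = l) :
      Leads l nxt S x (N.W x (nxt x))
  | step {x : ℕ} {w : ℝ} (he : N.Edge x (nxt x)) (hS : nxt x ∈ S) (h : Leads l nxt S (nxt x) w) :
      Leads l nxt S x (N.W x (nxt x) + w)

variable {N}

/-- The interior of the path lies in `S`, the set of finished vertices in the applications. Their
pointers are final, so recorded paths survive later changes of pointers at unfinished vertices. -/
theorem Leads.congr {l : ℕ} {nxt nxt' : ℕ → ℕ} {S S' : Set ℕ} (hSS : S ⊆ S')
    (hn : ∀ y ∈ S, nxt' y = nxt y) {x : ℕ} {w : ℝ} (h : N.Leads l nxt S x w)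
    (hx : nxt' x = nxt x) : N.Leads l nxt' S' x w := by
  induction h with
  | base he hl =>
    rw [← hx] at he hl ⊢
    exact .base he hl
  | step he hS h ih =>
    have ih := ih (hn _ hS)
    have hS' := hSS hS
    rw [← hx] at he hS' ih ⊢
    exact .step he hS' ih

/-- The invariant of Dijkstra's algorithm that computes the distances `D` to the vertices of level
`l`, truncated at `A`, with respect to the potential `p`.  The vertices in `Q` are unfinished, and
the edges in `R` have not yet been relaxed although their heads are finished. -/
structure Dijkstra (N : Network) (l : ℕ) (p : ℕ → ℝ) (A : ℝ) (D : ℕ → ℝ) (nxt : ℕ → ℕ)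
    (Q : Finset ℕ) (R : List ℕ) : Prop where
  above : ∀ x ∈ Q, x < N.n ∧ l < N.lev x
  cap : ∀ x < N.n, l < N.lev x → D x ≤ A
  seed : ∀ e < N.m, l < N.lev (N.tl e) → N.lev (N.hd e) = l →
    D (N.tl e) ≤ N.W (N.tl e) (N.hd e) + p (N.tl e)
  relaxed : ∀ e < N.m, l < N.lev (N.tl e) → l < N.lev (N.hd e) → N.hd e ∉ Q → e ∉ R →
    D (N.tl e) ≤ D (N.hd e) + N.W (N.tl e) (N.hd e) + p (N.tl e) - p (N.hd e)
  mono : ∀ y < N.n, l < N.lev y → y ∉ Q → ∀ x ∈ Q, D y ≤ D x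
  path : ∀ x < N.n, l < N.lev x → D x = A ∨
    ∃ w, N.Leads l nxt {y | l < N.lev y ∧ y ∉ Q} x w ∧ D x = w + p x

namespace Dijkstra

variable {l : ℕ} {p : ℕ → ℝ} {A : ℝ} {D : ℕ → ℝ} {nxt : ℕ → ℕ} {Q : Finset ℕ} {R : List ℕ}

/-- Monotonicity persists because `u` has minimum distance among the unfinished vertices. The edges
into `u` are the ones that become due for relaxation. -/
theorem extract (h : Dijkstra N l p A D nxt Q []) {u : ℕ}
    (hmin : ∀ x ∈ Q, D u ≤ D x) (hR : ∀ e < N.m, N.hd e = u → e ∈ R) :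
    Dijkstra N l p A D nxt (Q.erase u) R := by
  refine ⟨fun x hx => h.above x (Finset.mem_of_mem_erase hx), h.cap, h.seed,
    fun e he h1 h2 h3 h4 => ?_, fun y hy hl hyQ x hx => ?_, fun x hx hl => ?_⟩
  · refine h.relaxed e he h1 h2 (fun hQ => ?_) (by simp)
    rw [Finset.mem_erase] at h3
    by_cases hne : N.hd e = u
    · exact h4 (hR e he hne)
    · exact h3 ⟨hne, hQ⟩
  · have hx' := Finset.mem_of_mem_erase hx
    by_cases hyu : y = u
    · rw [hyu]; exact hmin x hx'
    · exact h.mono y hy hl (fun hm => hyQ (Finset.mem_erase.2 ⟨hyu, hm⟩)) x hx'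
  · refine (h.path x hx hl).imp_right fun ⟨w, hw, he⟩ => ⟨w, hw.congr ?_ (fun _ _ => rfl) rfl, he⟩
    exact fun y hy => ⟨hy.1, fun hm => hy.2 (Finset.mem_of_mem_erase hm)⟩

theorem relax_skip {e : ℕ} (h : Dijkstra N l p A D nxt Q (e :: R))
    (he : l < N.lev (N.tl e) →
      D (N.tl e) ≤ D (N.hd e) + N.W (N.tl e) (N.hd e) + p (N.tl e) - p (N.hd e)) :
    Dijkstra N l p A D nxt Q R := by
  refine ⟨h.above, h.cap, h.seed, fun e' he' h1 h2 h3 h4 => ?_, h.mono, h.path⟩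
  by_cases hee : e' = e
  · subst hee; exact he h1
  · exact h.relaxed e' he' h1 h2 h3 (by simp [hee, h4])

/-- Only the distances of unfinished vertices are decreased. -/
theorem mem_of_lt (hp : N.PotentialAbove l p) {e : ℕ}
    (he : e < N.m) (hu : l < N.lev (N.hd e)) (hv : l < N.lev (N.tl e))
    (hmax : ∀ y < N.n, l < N.lev y → y ∉ Q → D y ≤ D (N.hd e))
    (hlt : D (N.hd e) + N.W (N.tl e) (N.hd e) + p (N.tl e) - p (N.hd e) < D (N.tl e)) :
    N.tl e ∈ Q := by
  by_contra hQ
  have h1 := hmax _ (N.tl_lt e he) hv hQ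
  have h2 := hp e he hv hu
  linarith

/-- The reduced weight of the edge is nonnegative, so the new distance is at least that of its head,
which is largest among the finished vertices. Hence finished vertices stay ahead of unfinished ones.
The changed vertex is unfinished, so no recorded path runs through it. -/
theorem relax (h : Dijkstra N l p A D nxt Q (e :: R)) (hp : N.PotentialAbove l p) {t : ℝ}
    (he : e < N.m) (hu : l < N.lev (N.hd e)) (huQ : N.hd e ∉ Q) (hv : l < N.lev (N.tl e))
    (hmax : ∀ y < N.n, l < N.lev y → y ∉ Q → D y ≤ D (N.hd e))
    (ht : t = D (N.hd e) + N.W (N.tl e) (N.hd e) + p (N.tl e) - p (N.hd e))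
    (hlt : t < D (N.tl e)) :
    Dijkstra N l p A (update D (N.tl e) t) (update nxt (N.tl e) (N.hd e)) Q R := by
  have hvQ := mem_of_lt hp he hu hv hmax (ht ▸ hlt)
  have h0 := hp e he hv hu
  have hvn := N.tl_lt e he
  have hun := N.hd_lt e he
  set v := N.tl e with hvdef
  set u := N.hd e with hudef
  have huv : u ≠ v := by intro hh; exact huQ (hh ▸ hvQ)
  have hcapv := h.cap v hvn hv
  refine ⟨h.above, fun x hx hl => ?_, fun e' he' h1 h2 => ?_, fun e' he' h1 h2 h3 h4 => ?_,
    fun y hy hl hyQ x hx => ?_, fun x hx hl => ?_⟩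
  · have := h.cap x hx hl
    simp only [update_apply]
    split_ifs <;> linarith
  · have := h.seed e' he' h1 h2
    simp only [update_apply]
    split_ifs with hev
    · rw [hev] at this ⊢; linarith
    · exact this
  · have hne : N.hd e' ≠ v := by intro hh; exact h3 (hh ▸ hvQ)
    by_cases hee : e' = e
    · rw [hee, ← hvdef, ← hudef, update_self, update_of_ne huv, ht]
    · have := h.relaxed e' he' h1 h2 h3 (by simp [hee, h4])
      simp only [update_apply, if_neg hne]
      split_ifs with hev
      · rw [hev] at this ⊢; linarith
      · exact this
  · have hyv : y ≠ v := by rintro rfl; exact hyQ hvQ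
    have h1 := h.mono y hy hl hyQ x hx
    have h2 := hmax y hy hl hyQ
    simp only [update_apply, if_neg hyv]
    split_ifs <;> linarith
  · have hS : ∀ y ∈ {y | l < N.lev y ∧ y ∉ Q}, update nxt v u y = nxt y := by
      intro y hy
      rw [update_of_ne]
      rintro rfl
      exact hy.2 hvQ
    by_cases hxv : x = v
    · subst hxv
      right
      -- `D u ≤ t < D v ≤ A`, so the distance of `u` is not truncated and comes from a path, which
      -- the edge extends.
      have hA : D u ≠ A := by intro hA; linarith
      obtain ⟨w, hw, hDw⟩ := (h.path u hun hu).resolve_left hA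
      refine ⟨N.W v u + w, ?_, ?_⟩
      · have hw' := hw.congr subset_rfl hS (by rw [update_of_ne huv])
        have := Leads.step (N := N) (nxt := update nxt v u) (x := v) (w := w) (l := l)
          (S := {y | l < N.lev y ∧ y ∉ Q}) (by rw [update_self]; exact ⟨e, he, rfl, rfl⟩)
          (by rw [update_self]; exact ⟨hu, huQ⟩) (by rw [update_self]; exact hw')
        rwa [update_self] at this
      · rw [update_self, ht, hDw]; ring
    · rw [update_of_ne hxv]
      exact (h.path x hx hl).imp_right fun ⟨w, hw, hDw⟩ =>
        ⟨w, hw.congr subset_rfl hS (by rw [update_of_ne hxv]), hDw⟩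

/-- The potential that results from the distances. -/
theorem potentialAbove (h : Dijkstra N (l + 1) p A D nxt ∅ [])
    (hp : ∀ v < N.n, N.lev v ≤ l + 1 → p v = 0)
    (hc : ∀ e < N.m, N.lev (N.tl e) = l + 1 → l + 1 < N.lev (N.hd e) →
      0 ≤ N.W (N.tl e) (N.hd e) - p (N.hd e) + D (N.hd e)) :
    N.PotentialAbove l fun v => if l + 1 < N.lev v then p v - D v else p v := by
  intro e he h1 h2
  have hne := N.lev_ne e he
  -- Two ends at the new level are excluded by `lev_ne`. An edge out of the new level is covered by
  -- `hc`, an edge into it by `seed`, and any other edge by `relaxed`; `p` is zero on the new level.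
  rcases (show l + 1 ≤ N.lev (N.tl e) from h1).eq_or_lt with h3 | h3 <;>
  rcases (show l + 1 ≤ N.lev (N.hd e) from h2).eq_or_lt with h4 | h4
  · omega
  · have := hc e he h3.symm h4
    have h0 := hp _ (N.tl_lt e he) h3.symm.le
    simp only [if_neg (h3.symm.le.not_gt), if_pos h4]
    linarith
  · have := h.seed e he h3 h4.symm
    have h0 := hp _ (N.hd_lt e he) h4.symm.le
    simp only [if_neg (h4.symm.le.not_gt), if_pos h3]
    linarith
  · have := h.relaxed e he h3 h4 (by simp) (by simp)
    simp only [if_pos h3, if_pos h4]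
    linarith

end Dijkstra

/-- The invariant while the edges `0, …, i - 1` into level `l` are entered. -/
structure Seeded (N : Network) (l : ℕ) (p : ℕ → ℝ) (A : ℝ) (D : ℕ → ℝ) (nxt : ℕ → ℕ) (i : ℕ) :
    Prop where
  cap : ∀ x < N.n, l < N.lev x → D x ≤ A
  seed : ∀ e < N.m, e < i → l < N.lev (N.tl e) → N.lev (N.hd e) = l →
    D (N.tl e) ≤ N.W (N.tl e) (N.hd e) + p (N.tl e)
  path : ∀ x < N.n, l < N.lev x → D x = A ∨
    (N.Edge x (nxt x) ∧ N.lev (nxt x) = l ∧ D x = N.W x (nxt x) + p x)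

namespace Seeded

variable {l : ℕ} {p : ℕ → ℝ} {A : ℝ} {D : ℕ → ℝ} {nxt : ℕ → ℕ} {i : ℕ}

theorem skip (h : Seeded N l p A D nxt i) (hi : l < N.lev (N.tl i) → N.lev (N.hd i) = l →
    D (N.tl i) ≤ N.W (N.tl i) (N.hd i) + p (N.tl i)) : Seeded N l p A D nxt (i + 1) := by
  refine ⟨h.cap, fun e he hei h1 h2 => ?_, h.path⟩
  rcases Nat.lt_succ_iff_lt_or_eq.1 hei with hei | rfl
  · exact h.seed e he hei h1 h2
  · exact hi h1 h2

theorem enter (h : Seeded N l p A D nxt i) (hi : i < N.m) (h2 : N.lev (N.hd i) = l)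
    (hlt : N.W (N.tl i) (N.hd i) + p (N.tl i) < D (N.tl i)) :
    Seeded N l p A (update D (N.tl i) (N.W (N.tl i) (N.hd i) + p (N.tl i)))
      (update nxt (N.tl i) (N.hd i)) (i + 1) := by
  refine ⟨fun x hx hl => ?_, fun e he hei h3 h4 => ?_, fun x hx hl => ?_⟩
  · have := h.cap x hx hl
    simp only [update_apply]
    split_ifs with hxi
    · rw [hxi] at this; linarith
    · exact this
  · rcases Nat.lt_succ_iff_lt_or_eq.1 hei with hei | rfl
    · have := h.seed e he hei h3 h4
      simp only [update_apply]
      split_ifs with hxi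
      · rw [hxi] at this ⊢; linarith
      · exact this
    · rw [update_self]
  · by_cases hxi : x = N.tl i
    · subst hxi
      right
      rw [update_self, update_self]
      exact ⟨⟨i, hi, rfl, rfl⟩, h2, rfl⟩
    · rw [update_of_ne hxi, update_of_ne hxi]
      exact h.path x hx hl

/-- No vertex is finished yet, so the conditions on finished vertices are vacuous, and every
recorded path is a single edge. -/
theorem dijkstra (h : Seeded N l p A D nxt N.m) :
    Dijkstra N l p A D nxt ((Finset.range N.n).filter fun v => l < N.lev v) [] := by
  refine ⟨fun x hx => by simpa using hx, h.cap, fun e he => h.seed e he he,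
    fun e he h1 h2 h3 => ?_, fun y hy hl hQ => ?_, fun x hx hl => ?_⟩
  · exact absurd (by simp [N.hd_lt e he, h2]) h3
  · exact absurd (by simp [hy, hl]) hQ
  · refine (h.path x hx hl).imp_right fun ⟨h1, h2, h3⟩ => ⟨_, .base h1 h2, h3⟩

end Seeded

/-- The edges into `u`. -/
def inEdges (N : Network) (u : ℕ) : List ℕ :=
  (List.range N.m).reverse.filter fun e => N.hd e = u

theorem mem_inEdges {e u : ℕ} : e ∈ N.inEdges u ↔ e < N.m ∧ N.hd e = u := by
  simp [inEdges]

theorem sum_length_inEdges_le (N : Network) {Q : Finset ℕ} (hQ : ∀ x ∈ Q, x < N.n) :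
    ∑ u ∈ Q, (N.inEdges u).length ≤ N.m := by
  have h1 : ∀ u, (N.inEdges u).length = ((Finset.range N.m).filter fun e => N.hd e = u).card := by
    intro u
    rw [inEdges, List.filter_reverse, List.length_reverse]
    rfl
  calc ∑ u ∈ Q, (N.inEdges u).length ≤ ∑ u ∈ Finset.range N.n, (N.inEdges u).length :=
        Finset.sum_le_sum_of_subset fun x hx => Finset.mem_range.2 (hQ x hx)
    _ = (Finset.range N.m).card := by
        simp only [h1]
        exact (Finset.card_eq_sum_card_fiberwise fun e he => by
          simpa using N.hd_lt e (by simpa using he)).symm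
    _ = N.m := Finset.card_range _

/-- Following the pointers `nxt` from `x` for `d` steps and going back to `x` is a negative
cycle; the last vertex is the first one of level `l`. -/
structure NegativeCycle (N : Network) (l : ℕ) (nxt : ℕ → ℕ) (x d : ℕ) : Prop where
  above : ∀ j < d, l < N.lev (nxt^[j] x)
  level : N.lev (nxt^[d] x) = l
  edge : ∀ j < d, N.Edge (nxt^[j] x) (nxt^[j + 1] x)
  last : N.Edge (nxt^[d] x) x
  neg : ∑ j ∈ Finset.range d, N.W (nxt^[j] x) (nxt^[j + 1] x) + N.W (nxt^[d] x) x < 0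

theorem Leads.exists_iterate {l : ℕ} {nxt : ℕ → ℕ} {S : Set ℕ} (hS : ∀ y ∈ S, l < N.lev y) {x : ℕ}
    {w : ℝ} (h : N.Leads l nxt S x w) (hx : l < N.lev x) :
    ∃ d, (∀ j < d, l < N.lev (nxt^[j] x)) ∧ N.lev (nxt^[d] x) = l ∧
      (∀ j < d, N.Edge (nxt^[j] x) (nxt^[j + 1] x)) ∧
      ∑ j ∈ Finset.range d, N.W (nxt^[j] x) (nxt^[j + 1] x) = w := by
  induction h with
  | base he hl =>
    refine ⟨1, fun j hj => ?_, hl, fun j hj => ?_, by simp⟩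
    all_goals obtain rfl : j = 0 := by omega
    · exact hx
    · exact he
  | step he hy h ih =>
    obtain ⟨d, h1, h2, h3, h4⟩ := ih (hS _ hy)
    refine ⟨d + 1, fun j hj => ?_, h2, fun j hj => ?_, ?_⟩
    · cases j with
      | zero => exact hx
      | succ j => exact h1 j (by omega)
    · cases j with
      | zero => exact he
      | succ j => exact h3 j (by omega)
    · rw [Finset.sum_range_succ', add_comm, ← h4]
      rfl

/-- By the choice of the cap, a violated inequality excludes `D (N.hd e) = A`, so the distance is
realized by a path. Its end has level `l`, and it remains to identify this end with the tail of `e`.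
-/
theorem Dijkstra.negativeCycle {l : ℕ} {p : ℕ → ℝ} {A : ℝ} {D : ℕ → ℝ} {nxt : ℕ → ℕ}
    (h : Dijkstra N l p A D nxt ∅ []) {e : ℕ} (he : e < N.m) (h1 : N.lev (N.tl e) = l)
    (h2 : l < N.lev (N.hd e)) (hA : p (N.hd e) - N.W (N.tl e) (N.hd e) ≤ A)
    (hneg : N.W (N.tl e) (N.hd e) - p (N.hd e) + D (N.hd e) < 0) :
    ∃ d, N.NegativeCycle l nxt (N.hd e) d := by
  have hDA : D (N.hd e) ≠ A := by intro hh; linarith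
  obtain ⟨w, hw, hD⟩ := (h.path _ (N.hd_lt e he) h2).resolve_left hDA
  obtain ⟨d, k1, k2, k3, k4⟩ := hw.exists_iterate (fun y hy => hy.1) h2
  -- Both ends of each edge on the path have level at least `l`, so they share their ancestor at
  -- level `l`. The end of the path is its own ancestor at that level, and so is the tail of `e`.
  have hanc : ∀ j ≤ d, N.anc l (nxt^[j] (N.hd e)) = N.anc l (N.hd e) := by
    intro j hj
    induction j with
    | zero => rfl
    | succ j ih =>
      obtain ⟨e', he', ht, hh⟩ := k3 j (by omega)
      rw [← ih (by omega), ← ht, ← hh]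
      refine (N.anc_edge e' he' l ?_ ?_).symm
      · rw [ht]; exact (k1 j (by omega)).le
      · rw [hh]
        rcases hj.lt_or_eq with hlt | heq
        · exact (k1 _ hlt).le
        · rw [heq, k2]
  have hlt : nxt^[d] (N.hd e) < N.n := by
    cases d with
    | zero => exact N.hd_lt e he
    | succ d =>
      obtain ⟨e', he', -, hh⟩ := k3 d (by omega)
      rw [← hh]; exact N.hd_lt e' he'
  have hend : nxt^[d] (N.hd e) = N.tl e := by
    have g1 := N.anc_self _ hlt
    have g2 := N.anc_self _ (N.tl_lt e he)
    have g3 := N.anc_edge e he l h1.ge h2.le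
    rw [k2, hanc d le_rfl, ← g3] at g1
    rw [h1] at g2
    exact g1.symm.trans g2
  refine ⟨d, k1, k2, k3, ?_, ?_⟩
  · rw [hend]; exact ⟨e, he, rfl, rfl⟩
  · rw [k4, hend]; linarith

/-- After a repetition at `i < j` the walk would be periodic, so its last vertex would already occur
at the index `i + (d - j) < d`, where the level exceeds `l`. -/
theorem NegativeCycle.injective {l : ℕ} {nxt : ℕ → ℕ} {x d : ℕ} (h : N.NegativeCycle l nxt x d)
    {i j : ℕ} (hij : i < j) (hj : j ≤ d) : nxt^[i] x ≠ nxt^[j] x := by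
  intro he
  have h1 : nxt^[d] x = nxt^[i + (d - j)] x := by
    conv_lhs => rw [show d = (d - j) + j by omega]
    rw [iterate_add_apply, ← he, ← iterate_add_apply, add_comm]
  have h2 := h.above (i + (d - j)) (by omega)
  rw [← h1, h.level] at h2
  exact lt_irrefl _ h2

theorem NegativeCycle.lt {l : ℕ} {nxt : ℕ → ℕ} {x d : ℕ} (h : N.NegativeCycle l nxt x d)
    {j : ℕ} (hj : j ≤ d) : nxt^[j] x < N.n := by
  rcases hj.lt_or_eq with hlt | rfl
  · obtain ⟨e, he, ht, -⟩ := h.edge j hlt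
    rw [← ht]; exact N.tl_lt e he
  · obtain ⟨e, he, ht, -⟩ := h.last
    rw [← ht]; exact N.tl_lt e he

theorem NegativeCycle.length_lt {l : ℕ} {nxt : ℕ → ℕ} {x d : ℕ} (h : N.NegativeCycle l nxt x d) :
    d < N.n := by
  have := Finset.card_le_card_of_injOn (s := Finset.range (d + 1)) (t := Finset.range N.n)
    (fun j => nxt^[j] x) (fun j hj => by
      simp only [Finset.coe_range, Set.mem_Iio] at hj ⊢
      exact h.lt (by omega)) (fun i hi j hj hij => by
      simp only [Finset.coe_range, Set.mem_Iio] at hi hj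
      rcases lt_trichotomy i j with hlt | heq | hlt
      · exact absurd hij (h.injective hlt (by omega))
      · exact heq
      · exact absurd hij.symm (h.injective hlt (by omega)))
  simpa using this

end Network

/-! ### Adjacency lists, and Dijkstra's algorithm in memory -/

/-- The pointers `nx` link the elements of the list; `x` points to its first element. -/
def IsLinked (nx : ℕ → ℕ) : ℕ → List ℕ → Prop
  | x, [] => x = 0
  | x, e :: l => x = e + 1 ∧ IsLinked nx (nx e) l

theorem IsLinked.congr {nx nx' : ℕ → ℕ} {x : ℕ} {l : List ℕ} (h : IsLinked nx x l)
    (hn : ∀ e ∈ l, nx' e = nx e) : IsLinked nx' x l := by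
  induction l generalizing x with
  | nil => exact h
  | cons e l ih =>
    refine ⟨h.1, ?_⟩
    rw [hn e (by simp)]
    exact ih h.2 fun e' he' => hn e' (by simp [he'])

namespace RealRAM
open Tournament Function Instr Test Program

/-- The memory holds the network with its adjacency lists and the table of `⌈3 * x / 4⌉`. -/
structure Loaded (N : Network) (s : State) : Prop where
  n : s.var vN = N.n
  m : s.var vM = N.m
  zero : s.var vZ = 0
  rzero : s.rvar rZ = 0
  tl : ∀ e < N.m, s.arr aTl e = N.tl e
  hd : ∀ e < N.m, s.arr aHd e = N.hd e
  weight : ∀ e < N.m, s.rarr fW e = N.W (N.tl e) (N.hd e)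
  lev : ∀ v < N.n, s.arr aLev v = N.lev v
  adj : ∀ u < N.n, IsLinked (s.arr aNxe) (s.arr aFst u) (N.inEdges u)
  table : ∀ x ≤ N.n, s.arr aTq x = (3 * x + 3) / 4

/-- The program does not change the representation of the network. -/
def Program.keepsNetwork (P : Program) : Bool :=
  !P.any fun i => i.writesVar vN || i.writesVar vM || i.writesVar vZ || i.writesRvar rZ ||
    i.writesArr aTl || i.writesArr aHd || i.writesRarr fW || i.writesArr aLev ||
    i.writesArr aFst || i.writesArr aNxe || i.writesArr aTq

theorem Loaded.frame {N : Network} {P : Program} {s s' : State} (h : Loaded N s)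
    (hS : Same P s s') (hP : P.keepsNetwork = true) : Loaded N s' := by
  have hP' := (Bool.not_eq_true' _).mp hP
  have e1 := hS.var vN (Program.any_eq_false (by grind) hP')
  have e2 := hS.var vM (Program.any_eq_false (by grind) hP')
  have e3 := hS.var vZ (Program.any_eq_false (by grind) hP')
  have e4 := hS.rvar rZ (Program.any_eq_false (by grind) hP')
  have e5 := hS.arr aTl (Program.any_eq_false (by grind) hP')
  have e6 := hS.arr aHd (Program.any_eq_false (by grind) hP')
  have e7 := hS.rarr fW (Program.any_eq_false (by grind) hP')
  have e8 := hS.arr aLev (Program.any_eq_false (by grind) hP')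
  have e9 := hS.arr aFst (Program.any_eq_false (by grind) hP')
  have e10 := hS.arr aNxe (Program.any_eq_false (by grind) hP')
  have e11 := hS.arr aTq (Program.any_eq_false (by grind) hP')
  obtain ⟨h1, h2, h3, h4, h5, h6, h7, h8, h9, h10⟩ := h
  constructor
  · rwa [e1]
  · rwa [e2]
  · rwa [e3]
  · rwa [e4]
  · rwa [e5]
  · rwa [e6]
  · rwa [e7]
  · rwa [e8]
  · rwa [e9, e10]
  · rwa [e11]

/-- The invariant of Dijkstra's algorithm for the contents of the memory. -/
abbrev Search (N : Network) (s : State) (Q : Finset ℕ) (R : List ℕ) : Prop :=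
  N.Dijkstra (s.var vL) (s.rarr fP) (s.rvar rA) (s.rarr fD) (s.arr aNxt) Q R

/-- Each edge costs at most 620 for a decreased key, potential included, and a few further steps,
together less than 700. The invariant also tracks the actual credits, 60 per edge: the potential may
rise, so the amortized inequality alone does not guarantee that the next step can be executed. -/
theorem wp_relax {N : Network} {s : State} {c : ℕ} {alive Q : Finset ℕ} (hN : Loaded N s)
    (hq : Queue N.n s alive Q) (hd : Search N s Q (N.inEdges (s.var vU)))
    (hp : N.PotentialAbove (s.var vL) (s.rarr fP)) (hu : s.var vU < N.n)
    (hul : s.var vL < N.lev (s.var vU)) (huQ : s.var vU ∉ Q)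
    (hmax : ∀ y < N.n, s.var vL < N.lev y → y ∉ Q → s.rarr fD y ≤ s.rarr fD (s.var vU))
    (hc : 60 * (N.inEdges (s.var vU)).length + 10 ≤ c) :
    WP relaxP (fun c' s' => ∃ alive', Queue N.n s' alive' Q ∧ Search N s' Q [] ∧
      c + potential s' alive' ≤
        c' + potential s alive + 700 * (N.inEdges (s.var vU)).length + 10) c s := by
  refine WP.chain_cons (WP.block (by simp) (by simp; omega) (WP.chain_singleton ?_))
  refine WP.loop (fun c' s' => ∃ R, Queue N.n s' alive Q ∧ Search N s' Q R ∧
    IsLinked (s.arr aNxe) (s'.var vE) R ∧ (∀ e ∈ R, e < N.m ∧ N.hd e = s.var vU) ∧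
    (∀ y < N.n, s.var vL < N.lev y → y ∉ Q → s'.rarr fD y ≤ s'.rarr fD (s.var vU)) ∧
    c + potential s' alive + 700 * R.length ≤
      c' + potential s alive + 700 * (N.inEdges (s.var vU)).length + 1 ∧
    60 * R.length + 1 ≤ c') ?_ ?_
  · refine ⟨N.inEdges (s.var vU), ?_, hd, hN.adj _ hu, fun e he => N.mem_inEdges.1 he, hmax,
      ?_, ?_⟩
    · exact ⟨hq.heap.congr rfl rfl rfl rfl rfl rfl rfl rfl rfl, hq.stacked, hq.bucket, hq.decay,
        hq.size⟩
    · simp only [List.foldl, Instr.apply, potential, List.length_cons, List.length_nil]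
      simp; omega
    · simp; omega
  · rintro c' s' hS ⟨R, h1, h2, h3, h4, h5, h6, h7⟩
    have hN' := (hN.frame (P := block [load vE aFst vU]) (same_instr _ _) rfl).frame hS rfl
    have eL : s'.var vL = s.var vL := hS.var _ rfl
    have eU : s'.var vU = s.var vU := hS.var _ rfl
    have eP : s'.rarr fP = s.rarr fP := hS.rarr _ rfl
    have eA : s'.rvar rA = s.rvar rA := hS.rvar _ rfl
    have eE : s'.arr aNxe = s.arr aNxe := hS.arr _ rfl
    have eZ := hN'.zero
    refine ⟨by omega, fun ht => ?_, fun hf => ?_⟩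
    · simp only [Test.Holds, eZ] at ht
      cases R with
      | nil => exact absurd h3 ht
      | cons e R =>
        obtain ⟨hx, h3⟩ := h3
        obtain ⟨hem, heu⟩ := h4 e (by simp)
        have h4' : ∀ e ∈ R, e < N.m ∧ N.hd e = s.var vU := fun e' he' => h4 e' (by simp [he'])
        simp only [List.length_cons] at h6 h7
        have hvn := N.tl_lt e hem
        refine WP.chain_cons (WP.block (by simp) (by simp; omega) ?_)
        generalize hs₁ : List.foldl _ _ _ = s₁
        have a1 : s₁.var vE = e := by
          have : s₁.var vE = s'.var vE - 1 := by rw [← hs₁]; rfl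
          omega
        have a2 : s₁.var vV = N.tl e := by
          rw [← hN'.tl e hem, ← a1, ← hs₁]; rfl
        have a3 : s₁.var vC = N.lev (N.tl e) := by
          rw [← hN'.lev _ hvn, ← a2, ← hs₁]; rfl
        have hS₁ : ∃ P, Same P s' s₁ ∧ P.keepsNetwork = true ∧ P.keepsHeap = true ∧
            s₁.var vL = s'.var vL ∧ s₁.var vU = s'.var vU ∧ s₁.rarr = s'.rarr ∧ s₁.arr = s'.arr ∧
            s₁.rvar = s'.rvar ∧ s₁.var vR = s'.var vR := by
          refine ⟨block [pred vE vE, load vV aTl vE, load vC aLev vV], ?_, rfl, rfl, ?_, ?_, ?_, ?_,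
            ?_, ?_⟩
          · rw [← hs₁]
            exact (same_instr _ _).seq ((same_instr _ _).seq (same_instr _ _))
          all_goals rw [← hs₁]; rfl
        obtain ⟨P, hP, hPn, hPh, a4, a5, a6, a7, a8, a9⟩ := hS₁
        have hN₁ := hN'.frame hP hPn
        have hq₁ : Queue N.n s₁ alive Q :=
          ⟨h1.heap.frame hP hPh, by rw [Stacked, roots, a7, a9]; exact h1.stacked,
            by rw [a7]; exact h1.bucket, by rw [a7]; exact h1.decay, by rw [a7]; exact h1.size⟩
        have hpot₁ : potential s₁ alive = potential s' alive := by
          rw [potential, potential, a7, a9]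
        clear hs₁
        have next : ∀ c₂ s₂, Queue N.n s₂ alive Q → Search N s₂ Q R → s₂.var vE = e →
            s₂.arr aNxe = s.arr aNxe →
            (∀ y < N.n, s.var vL < N.lev y → y ∉ Q → s₂.rarr fD y ≤ s₂.rarr fD (s.var vU)) →
            c' + potential s₂ alive ≤ c₂ + potential s' alive + 670 → c' ≤ c₂ + 50 →
            WP (chain [block [load vE aNxe vE]]) (fun c' s' => ∃ R, Queue N.n s' alive Q ∧
              Search N s' Q R ∧
              IsLinked (s.arr aNxe) (s'.var vE) R ∧ (∀ e ∈ R, e < N.m ∧ N.hd e = s.var vU) ∧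
              (∀ y < N.n, s.var vL < N.lev y → y ∉ Q → s'.rarr fD y ≤ s'.rarr fD (s.var vU)) ∧
              c + potential s' alive + 700 * R.length ≤
                c' + potential s alive + 700 * (N.inEdges (s.var vU)).length + 1 ∧
              60 * R.length + 1 ≤ c') c₂ s₂ := by
          intro c₂ s₂ b1 b2 b3 b4 b5 b6 b7
          refine WP.chain_singleton (WP.block (by simp) (by simp; omega) ?_)
          refine ⟨R, ?_, b2, ?_, h4', b5, ?_, ?_⟩
          · exact ⟨b1.heap.congr rfl rfl rfl rfl rfl rfl rfl rfl rfl, b1.stacked, b1.bucket,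
              b1.decay, b1.size⟩
          · simp only [List.foldl, Instr.apply, State.setVar_var_same, b3, b4]
            exact h3
          · simp only [potential] at h6 b6 ⊢
            simp [Instr.apply]
            omega
          · simp; omega
        simp only [List.length_cons, List.length_nil]
        refine WP.chain_cons (WP.ite (by omega) (fun hb => ?_) (fun hb => WP.skip (by omega) ?_))
        · simp only [Test.Holds, a3, a4, eL] at hb
          refine WP.chain_cons (WP.block (by simp) (by simp; omega) (WP.chain_singleton ?_))
          generalize hs₂ : List.foldl _ _ _ = s₂
          have b1 : s₂.rvar rT = s'.rarr fD (s.var vU) + N.W (N.tl e) (s.var vU) +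
              s.rarr fP (N.tl e) - s.rarr fP (s.var vU) := by
            have : s₂.rvar rT = s₁.rarr fD (s₁.var vU) + s₁.rarr fW (s₁.var vE) +
              s₁.rarr fP (s₁.var vV) - s₁.rarr fP (s₁.var vU) := by rw [← hs₂]; rfl
            rw [this, a1, hN₁.weight e hem, a2, a5, eU, a6, eP, heu]
          have b2 : s₂.rvar rS = s'.rarr fD (N.tl e) := by
            rw [← a6, ← a2, ← hs₂]; rfl
          have b3 : s₂.var = s₁.var := by rw [← hs₂]; rfl
          have b4 : s₂.arr = s₁.arr := by rw [← hs₂]; rfl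
          have b5 : s₂.rarr = s₁.rarr := by rw [← hs₂]; rfl
          have b6 : s₂.rvar rA = s₁.rvar rA := by rw [← hs₂]; rfl
          clear hs₂
          have hq₂ : Queue N.n s₂ alive Q :=
            ⟨by apply hq₁.heap.congr <;> simp only [b3, b4, b5],
              by rw [Stacked, roots, b4, b3]; exact hq₁.stacked,
              by rw [b4]; exact hq₁.bucket, by rw [b4]; exact hq₁.decay,
              by rw [b4]; exact hq₁.size⟩
          have hpot₂ : potential s₂ alive = potential s' alive := by
            rw [← hpot₁, potential, potential, b3, b4]
          have hmax' : ∀ y < N.n, s'.var vL < N.lev y → y ∉ Q → s'.rarr fD y ≤ s'.rarr fD (N.hd e) := by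
            rw [eL, heu]; exact h5
          have hp' : N.PotentialAbove (s'.var vL) (s'.rarr fP) := by rw [eL, eP]; exact hp
          simp only [List.length_cons, List.length_nil]
          refine WP.ite (by omega) (fun hb' => ?_) (fun hb' => WP.skip (by omega) ?_)
          · simp only [Test.Holds, b1, b2] at hb'
            have hlt : s'.rarr fD (N.hd e) + N.W (N.tl e) (N.hd e) + s'.rarr fP (N.tl e) -
                s'.rarr fP (N.hd e) < s'.rarr fD (N.tl e) := by rw [heu, eP]; exact hb'
            have hvQ := Network.Dijkstra.mem_of_lt hp' hem (by rw [eL, heu]; exact hul)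
              (by rw [eL]; exact hb) hmax' hlt
            have hrel := h2.relax hp' hem (by rw [eL, heu]; exact hul) (by rw [heu]; exact huQ)
              (by rw [eL]; exact hb) hmax' rfl hlt
            refine (wp_decrease (by rw [b3]; exact hN₁.zero) hq₂ (by rw [b3, a2]; exact hvQ)
              (by rw [b1, b3, a2, b5, a6]; exact hb'.le) (by omega)).conseq ?_
            rintro c₃ s₃ hS₃ ⟨d1, d2, d3, d4, d4'⟩
            rw [b5, a6, b3, a2, b1] at d2
            rw [b4, a7, b3, a2, a5, eU] at d3
            have d5 : s₃.var vL = s'.var vL := by rw [hS₃.var _ rfl, b3, a4]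
            have d6 : s₃.rarr fP = s'.rarr fP := by rw [hS₃.rarr _ rfl, b5, a6]
            have d7 : s₃.rvar rA = s'.rvar rA := by rw [hS₃.rvar _ rfl, b6, a8]
            have d8 : s₃.var vE = e := by rw [hS₃.var _ rfl, b3, a1]
            have d9 : s₃.arr aNxe = s.arr aNxe := by rw [hS₃.arr _ rfl, b4, a7, eE]
            refine next c₃ s₃ d1 ?_ d8 d9 (fun y hy hyl hyQ => ?_) (by omega) (by omega)
            · rw [Search, d5, d6, d7, d2, d3]
              rw [heu, eP] at hrel
              rw [eP]
              exact hrel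
            · rw [d2, update_of_ne (by rintro rfl; exact hyQ hvQ),
                update_of_ne (by intro hh; rw [hh] at huQ; exact huQ hvQ)]
              exact h5 y hy hyl hyQ
          · simp only [Test.Holds, b1, b2, not_lt] at hb'
            refine next _ s₂ hq₂ ?_ (by rw [b3, a1]) (by rw [b4, a7, eE]) ?_ (by omega) (by omega)
            · rw [Search, b3, b4, b5, b6, a4, a6, a7, a8]
              refine h2.relax_skip fun _ => ?_
              rw [heu, eP]; exact hb'
            · rw [b5, a6]; exact h5
        · simp only [Test.Holds, a3, a4, eL] at hb
          refine next _ s₁ hq₁ ?_ a1 (by rw [a7, eE]) ?_ (by omega) (by omega)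
          · rw [Search, a4, a6, a7, a8]
            exact h2.relax_skip fun hh => absurd hh (by rw [eL]; exact hb)
          · rw [a6]; exact h5
    · simp only [Test.Holds, eZ, not_not] at hf
      cases R with
      | nil => exact ⟨alive, h1, h2, by simp only [List.length_nil] at h6; omega⟩
      | cons e R => exact absurd (h3.1.symm.trans hf) (by omega)

/-- Every unfinished vertex holds the credits for its extraction, and every edge into it those for
its relaxation. When no root is left, there is no node and hence no unfinished vertex. The counters
and buckets are then zero again, ready for the next round. -/
theorem wp_dijkstra {N : Network} {s : State} {c : ℕ} {alive Q : Finset ℕ} (hN : Loaded N s)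
    (hq : Queue N.n s alive Q) (hd : Search N s Q [])
    (hp : N.PotentialAbove (s.var vL) (s.rarr fP))
    (hc : potential s alive + 2100 * (Nat.log 2 N.n + 1) * Q.card +
      700 * ∑ u ∈ Q, (N.inEdges u).length + 1 ≤ c) :
    WP dijkstraP (fun c' s' => Search N s' ∅ [] ∧ (∀ i, s'.arr aCnt i = 0) ∧
      (∀ i, s'.arr aBk i = 0) ∧ c ≤ c' + potential s alive +
        2100 * (Nat.log 2 N.n + 1) * Q.card + 700 * ∑ u ∈ Q, (N.inEdges u).length + 1) c s := by
  obtain ⟨K, hK⟩ : ∃ K, K = 2100 * (Nat.log 2 N.n + 1) := ⟨_, rfl⟩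
  rw [← hK] at hc ⊢
  refine WP.loop (fun c' s' => ∃ alive' Q', Queue N.n s' alive' Q' ∧ Search N s' Q' [] ∧
    c + (potential s' alive' + K * Q'.card + 700 * ∑ u ∈ Q', (N.inEdges u).length) ≤
      c' + (potential s alive + K * Q.card + 700 * ∑ u ∈ Q, (N.inEdges u).length))
    ⟨alive, Q, hq, hd, le_rfl⟩ ?_
  rintro c' s' hS ⟨alive', Q', h1, h2, h3⟩
  have hN' := hN.frame hS rfl
  have eL : s'.var vL = s.var vL := hS.var _ rfl
  have eP : s'.rarr fP = s.rarr fP := hS.rarr _ rfl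
  refine ⟨by omega, fun ht => ?_, fun hf => ?_⟩
  · simp only [Test.Holds, hN'.zero] at ht
    have h0 : 1 ≤ Q'.card := by
      obtain ⟨d, hd⟩ := Finset.card_pos.1 (by
        rw [h1.stacked.card_eq]; omega : 0 < (roots s' alive').card)
      exact Finset.card_pos.2 ⟨_, h1.heap.forest.owner d (Finset.mem_filter.1 hd).1⟩
    have hK' := Nat.mul_le_mul_left K h0
    have hpre : potential s' alive' + 2000 * (Nat.log 2 N.n + 1) ≤ c' - 1 := by
      generalize ∑ u ∈ Q', (N.inEdges u).length = S' at h3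
      generalize ∑ u ∈ Q, (N.inEdges u).length = S at h3 hc
      omega
    refine WP.chain_cons ((wp_extract hN'.zero hN'.table h1 ht hpre).conseq ?_)
    rintro c₁ s₁ hS₁ ⟨alive₁, hq₁, hu, hmin, hc₁⟩
    have hN₁ := hN'.frame hS₁ rfl
    have eL₁ : s₁.var vL = s'.var vL := hS₁.var _ rfl
    have eP₁ : s₁.rarr fP = s'.rarr fP := hS₁.rarr _ rfl
    have eD₁ : s₁.rarr fD = s'.rarr fD := hS₁.rarr _ rfl
    have eA₁ : s₁.rvar rA = s'.rvar rA := hS₁.rvar _ rfl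
    have eX₁ : s₁.arr aNxt = s'.arr aNxt := hS₁.arr _ rfl
    have hQ := h2.above _ hu
    have hd₁ : Search N s₁ (Q'.erase (s₁.var vU)) (N.inEdges (s₁.var vU)) := by
      rw [Search, eL₁, eP₁, eD₁, eA₁, eX₁]
      exact h2.extract hmin fun e he heu => N.mem_inEdges.2 ⟨he, heu⟩
    have hcard := Finset.card_erase_add_one hu
    have hmul : K * Q'.card = K * (Q'.erase (s₁.var vU)).card + K := by rw [← hcard]; ring
    have hsum := Finset.add_sum_erase Q' (fun u => (N.inEdges u).length) hu
    refine WP.chain_singleton ((wp_relax hN₁ hq₁ hd₁ (by rw [eL₁, eP₁, eL, eP]; exact hp) hQ.1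
      (by rw [eL₁]; exact hQ.2) (by simp) ?_ (by omega)).conseq ?_)
    · intro y hy hyl hyQ
      rw [eD₁]
      rw [eL₁] at hyl
      by_cases hyu : y = s₁.var vU
      · rw [hyu]
      · exact h2.mono y hy hyl (fun hm => hyQ (Finset.mem_erase.2 ⟨hyu, hm⟩)) _ hu
    · rintro c₂ s₂ hS₂ ⟨alive₂, hq₂, hd₂, hc₂⟩
      exact ⟨alive₂, _, hq₂, hd₂, by omega⟩
  · simp only [Test.Holds, hN'.zero, not_not] at hf
    have hr : roots s' alive' = ∅ := by rw [← Finset.card_eq_zero, h1.stacked.card_eq, hf]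
    have hal : alive' = ∅ := by
      rw [Finset.eq_empty_iff_forall_notMem]
      intro d hd
      obtain ⟨r, hr', hp', -⟩ := h1.heap.forest.exists_root hd
      have : r ∈ roots s' alive' := Finset.mem_filter.2 ⟨hr', hp'⟩
      rw [hr] at this
      exact absurd this (Finset.notMem_empty r)
    have hQ' : Q' = ∅ := by
      rw [Finset.eq_empty_iff_forall_notMem]
      intro x hx
      have := (h1.heap.forest.topmost x hx).1
      rw [hal] at this
      exact absurd this (Finset.notMem_empty _)
    subst hal hQ'
    refine ⟨h2, fun i => ?_, h1.bucket, by omega⟩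
    rw [h1.heap.count, count, Finset.filter_empty, Finset.card_empty]

end RealRAM

/-! ### Passes over the vertices and edges -/

namespace RealRAM
open Function Instr Test Program

theorem same_block (l : List Instr) (s : State) :
    Same (block l) s (l.foldl (fun s i => i.apply s) s) := by
  induction l generalizing s with
  | nil => exact Same.refl _ _
  | cons i l ih =>
    cases l with
    | nil => exact same_instr i s
    | cons j l => exact (same_instr i s).seq (ih _)

/-- A loop in which `vI` runs from `0` to a fixed bound. -/
theorem WP.for_lt {b : ℕ} {P : Program} {s : State} {c K : ℕ} (J : ℕ → State → Prop)
    (h0 : s.var vI = 0) (hJ : J 0 s) (hb : P.any (·.writesVar b) = false)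
    (step : ∀ i < s.var b, ∀ c' s', Same (.loop (.lt vI b) P) s s' → s'.var vI = i → J i s' →
      K ≤ c' → WP P (fun c'' s'' => s''.var vI = i + 1 ∧ J (i + 1) s'' ∧ c' ≤ c'' + K) c' s')
    (hc : (K + 1) * s.var b + 1 ≤ c) :
    WP (.loop (.lt vI b) P) (fun c' s' => J (s.var b) s' ∧ c ≤ c' + (K + 1) * s.var b + 1) c s := by
  refine WP.loop (fun c' s' => s'.var vI ≤ s.var b ∧ J (s'.var vI) s' ∧
    c ≤ c' + (K + 1) * s'.var vI) ?_ ?_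
  · rw [h0]; exact ⟨Nat.zero_le _, hJ, by simp⟩
  · rintro c' s' hS ⟨h1, h2, h3⟩
    have eb : s'.var b = s.var b := hS.var _ hb
    have hmul := Nat.mul_le_mul_left (K + 1) h1
    refine ⟨by omega, fun ht => ?_, fun hf => ?_⟩
    · simp only [Test.Holds, eb] at ht
      have hmul' := Nat.mul_le_mul_left (K + 1) (Nat.succ_le_of_lt ht)
      rw [Nat.succ_eq_add_one, Nat.mul_add, Nat.mul_one] at hmul'
      refine (step _ ht (c' - 1) s' hS rfl h2 (by omega)).conseq ?_
      rintro c'' s'' - ⟨g1, g2, g3⟩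
      rw [g1]
      refine ⟨by omega, g2, ?_⟩
      rw [Nat.mul_add, Nat.mul_one]
      omega
    · simp only [Test.Holds, eb, not_lt] at hf
      have he : s'.var vI = s.var b := le_antisymm h1 hf
      rw [he] at h2 h3
      exact ⟨h2, by omega⟩

theorem wp_load_edge {N : Network} {Q : ℕ → State → Prop} {s : State} {c : ℕ} (hN : Loaded N s)
    (hi : s.var vI < N.m) (hc : 4 ≤ c)
    (h : ∀ s', s'.var vA = N.tl (s.var vI) → s'.var vB = N.hd (s.var vI) →
      s'.var vC = N.lev (N.tl (s.var vI)) → s'.var vH = N.lev (N.hd (s.var vI)) →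
      s'.var vI = s.var vI → s'.var vL = s.var vL → s'.var vF = s.var vF → s'.var vS = s.var vS →
      s'.arr = s.arr → s'.rvar = s.rvar → s'.rarr = s.rarr → Q (c - 4) s') :
    WP (block [load vA aTl vI, load vB aHd vI, load vC aLev vA, load vH aLev vB]) Q c s := by
  refine WP.block (by simp) hc (h _ (hN.tl _ hi) (hN.hd _ hi) ?_ ?_ rfl rfl rfl rfl rfl rfl rfl)
  · exact (congrArg (s.arr aLev) (hN.tl _ hi)).trans (hN.lev _ (N.tl_lt _ hi))
  · exact (congrArg (s.arr aLev) (hN.hd _ hi)).trans (hN.lev _ (N.hd_lt _ hi))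

/-- This lower bound on the cap is what makes `D v = A` harmless: it gives `0 ≤ w u v - p v + D v`
for every edge `uv` out of the current level. -/
theorem wp_cap {N : Network} {s : State} {c : ℕ} (hN : Loaded N s) (hc : 15 * N.m + 10 ≤ c) :
    WP capP (fun c' s' => (∀ e < N.m, N.lev (N.tl e) = s.var vL → s.var vL < N.lev (N.hd e) →
      s.rarr fP (N.hd e) - N.W (N.tl e) (N.hd e) ≤ s'.rvar rA) ∧ c ≤ c' + 15 * N.m + 10) c s := by
  refine WP.chain_cons (WP.block (by simp) (by simp; omega) (WP.chain_singleton ?_))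
  have hN₁ := hN.frame (same_block [const vI 0, rcopy rA rZ] s) rfl
  refine (WP.for_lt (K := 14) (fun i s' => ∀ e < i, N.lev (N.tl e) = s.var vL →
    s.var vL < N.lev (N.hd e) → s.rarr fP (N.hd e) - N.W (N.tl e) (N.hd e) ≤ s'.rvar rA) rfl
    (by simp) rfl ?_ (by rw [hN₁.m]; simp; omega)).conseq ?_
  · intro i hi c' s' hS hI hJ hc'
    have hN' := hN₁.frame hS rfl
    rw [hN₁.m] at hi
    have eL : s'.var vL = s.var vL := hS.var _ rfl
    have eP : s'.rarr fP = s.rarr fP := hS.rarr _ rfl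
    refine WP.chain_cons (wp_load_edge hN' (by omega) (by omega) ?_)
    rw [hI]
    intro s₂ a1 a2 a3 a4 a5 a6 _ _ a7 a8 a9
    rw [eL] at a6
    have next : ∀ c₂ s₃, s₃.var vI = i → s₂.rvar rA ≤ s₃.rvar rA →
        (N.lev (N.tl i) = s.var vL → s.var vL < N.lev (N.hd i) →
          s.rarr fP (N.hd i) - N.W (N.tl i) (N.hd i) ≤ s₃.rvar rA) → c' ≤ c₂ + 12 →
        WP (chain [block [succ vI vI]]) (fun c'' s'' => s''.var vI = i + 1 ∧
          (∀ e < i + 1, N.lev (N.tl e) = s.var vL → s.var vL < N.lev (N.hd e) →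
            s.rarr fP (N.hd e) - N.W (N.tl e) (N.hd e) ≤ s''.rvar rA) ∧ c' ≤ c'' + 14) c₂ s₃ := by
      intro c₂ s₃ b1 b2 b3 b4
      refine WP.chain_singleton (WP.block (by simp) (by simp; omega)
        ⟨congrArg (· + 1) b1, fun e he h1 h2 => ?_, by simp; omega⟩)
      rcases Nat.lt_succ_iff_lt_or_eq.1 he with he | rfl
      · rw [a8] at b2
        exact (hJ e he h1 h2).trans b2
      · exact b3 h1 h2
    refine WP.chain_cons (WP.ite (by omega) (fun hb => ?_) (fun hb => WP.skip (by omega) ?_))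
    · refine WP.ite (by omega) (fun hb' => ?_) (fun hb' => WP.skip (by omega) ?_)
      · refine WP.chain_cons (WP.block (by simp) (by simp; omega) (WP.chain_singleton ?_))
        generalize hs₃ : List.foldl _ _ _ = s₃
        have b1 : s₃.rvar rT = s.rarr fP (N.hd i) - N.W (N.tl i) (N.hd i) := by
          have : s₃.rvar rT = s₂.rarr fP (s₂.var vB) - s₂.rarr fW (s₂.var vI) := by
            rw [← hs₃]; rfl
          rw [this, a2, a9, eP, a5, hN'.weight i hi]
        have b2 : s₃.rvar rA = s₂.rvar rA := by rw [← hs₃]; rfl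
        have b3 : s₃.var vI = s₂.var vI := by rw [← hs₃]; rfl
        clear hs₃
        simp only [List.length_cons, List.length_nil]
        refine WP.ite (by omega) (fun hb' => WP.block (by simp) (by simp; omega) ?_)
          (fun hb' => WP.skip (by omega) ?_)
        · simp only [Test.Holds] at hb'
          refine next _ _ (b3.trans a5) ?_ ?_ (by simp; omega)
          · simp [Instr.apply]; rw [← b2]; exact hb'.le
          · intro _ _; simp [Instr.apply, b1]
        · simp only [Test.Holds, not_lt] at hb'
          refine next _ _ (b3.trans a5) b2.ge (fun _ _ => ?_) (by omega)
          rw [← b1]; exact hb'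
      · simp only [Test.Holds, a4, a6] at hb'
        exact next _ _ a5 le_rfl (fun _ h => absurd h hb') (by omega)
    · simp only [Test.Holds, a3, a6] at hb
      exact next _ _ a5 le_rfl (fun h => absurd h hb) (by omega)
  · rintro c' s' - ⟨h1, h2⟩
    rw [hN₁.m] at h1 h2
    exact ⟨h1, by simp at h2; omega⟩

theorem wp_init {N : Network} {s : State} {c : ℕ} (hN : Loaded N s) (hc : 3 * N.n + 2 ≤ c) :
    WP initP (fun c' s' => (∀ v < N.n, s'.rarr fD v = s.rvar rA) ∧ c ≤ c' + 3 * N.n + 2) c s := by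
  refine WP.chain_cons (WP.block (by simp) (by simp; omega) (WP.chain_singleton ?_))
  have hN₁ := hN.frame (same_block [const vI 0] s) rfl
  refine (WP.for_lt (K := 2) (fun i s' => ∀ v < i, s'.rarr fD v = s.rvar rA) rfl (by simp) rfl ?_
    (by rw [hN₁.n]; simp; omega)).conseq ?_
  · intro i hi c' s' hS hI hJ hc'
    have eA : s'.rvar rA = s.rvar rA := hS.rvar _ rfl
    refine WP.block (by simp) (by simp; omega) ⟨congrArg (· + 1) hI, fun v hv => ?_, by simp; omega⟩
    simp only [List.foldl, Instr.apply, State.setVar_rarr, State.setRarr_rarr_same, hI, eA]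
    rcases Nat.lt_succ_iff_lt_or_eq.1 hv with hv | rfl
    · rw [update_of_ne hv.ne, hJ v hv]
    · rw [update_self]
  · rintro c' s' - ⟨h1, h2⟩
    rw [hN₁.n] at h1 h2
    exact ⟨h1, by simp at h2; omega⟩

theorem wp_seed {N : Network} {s : State} {c : ℕ} (hN : Loaded N s)
    (hD : ∀ v < N.n, s.rarr fD v = s.rvar rA) (hc : 16 * N.m + 2 ≤ c) :
    WP seedP (fun c' s' => Search N s' ((Finset.range N.n).filter fun v => s.var vL < N.lev v) [] ∧
      c ≤ c' + 16 * N.m + 2) c s := by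
  refine WP.chain_cons (WP.block (by simp) (by simp; omega) (WP.chain_singleton ?_))
  have hN₁ := hN.frame (same_block [const vI 0] s) rfl
  refine (WP.for_lt (K := 15) (fun i s' => N.Seeded (s.var vL) (s.rarr fP) (s.rvar rA) (s'.rarr fD)
    (s'.arr aNxt) i) rfl ?_ rfl ?_ (by rw [hN₁.m]; simp; omega)).conseq ?_
  · exact ⟨fun x hx _ => (hD x hx).le, fun e _ he => absurd he (Nat.not_lt_zero e),
      fun x hx _ => .inl (hD x hx)⟩
  · intro i hi c' s' hS hI hJ hc'
    have hN' := hN₁.frame hS rfl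
    rw [hN₁.m] at hi
    have eL : s'.var vL = s.var vL := hS.var _ rfl
    have eP : s'.rarr fP = s.rarr fP := hS.rarr _ rfl
    refine WP.chain_cons (wp_load_edge hN' (by omega) (by omega) ?_)
    rw [hI]
    intro s₂ a1 a2 a3 a4 a5 a6 _ _ a7 a8 a9
    rw [eL] at a6
    have next : ∀ c₂ s₃, s₃.var vI = i →
        N.Seeded (s.var vL) (s.rarr fP) (s.rvar rA) (s₃.rarr fD) (s₃.arr aNxt) (i + 1) →
        c' ≤ c₂ + 14 →
        WP (chain [block [succ vI vI]]) (fun c'' s'' => s''.var vI = i + 1 ∧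
          N.Seeded (s.var vL) (s.rarr fP) (s.rvar rA) (s''.rarr fD) (s''.arr aNxt) (i + 1) ∧
          c' ≤ c'' + 15) c₂ s₃ := by
      intro c₂ s₃ b1 b2 b3
      exact WP.chain_singleton (WP.block (by simp) (by simp; omega)
        ⟨congrArg (· + 1) b1, b2, by simp; omega⟩)
    refine WP.chain_cons (WP.ite (by omega) (fun hb => ?_) (fun hb => WP.skip (by omega) ?_))
    · simp only [Test.Holds, a4, a6] at hb
      refine WP.ite (by omega) (fun hb' => ?_) (fun hb' => WP.skip (by omega) ?_)
      · refine WP.chain_cons (WP.block (by simp) (by simp; omega) (WP.chain_singleton ?_))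
        generalize hs₃ : List.foldl _ _ _ = s₃
        have b1 : s₃.rvar rT = N.W (N.tl i) (N.hd i) + s.rarr fP (N.tl i) := by
          have : s₃.rvar rT = s₂.rarr fW (s₂.var vI) + s₂.rarr fP (s₂.var vA) := by
            rw [← hs₃]; rfl
          rw [this, a1, a9, eP, a5, hN'.weight i hi]
        have b2 : s₃.rvar rS = s'.rarr fD (N.tl i) := by
          rw [← a9, ← a1, ← hs₃]; rfl
        have b3 : s₃.var = s₂.var := by rw [← hs₃]; rfl
        have b4 : s₃.arr = s₂.arr := by rw [← hs₃]; rfl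
        have b5 : s₃.rarr = s₂.rarr := by rw [← hs₃]; rfl
        clear hs₃
        simp only [List.length_cons, List.length_nil]
        refine WP.ite (by omega) (fun hb' => WP.block (by simp) (by simp; omega) ?_)
          (fun hb' => WP.skip (by omega) ?_)
        · simp only [Test.Holds, b1, b2] at hb'
          refine next _ _ (by simp [Instr.apply, b3, a5]) ?_ (by simp; omega)
          simp only [List.foldl, Instr.apply, State.setArr_rarr, State.setRarr_rarr_same,
            State.setArr_arr_same, State.setRarr_arr, State.setRarr_var, b1, b3, b4, b5, a1, a2,
            a7, a9]
          exact hJ.enter hi hb hb'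
        · simp only [Test.Holds, b1, b2, not_lt] at hb'
          refine next _ _ (by rw [b3, a5]) ?_ (by omega)
          rw [b4, b5, a7, a9]
          exact hJ.skip fun _ _ => hb'
      · simp only [Test.Holds, a3, a6] at hb'
        refine next _ _ a5 ?_ (by omega)
        rw [a7, a9]
        exact hJ.skip fun h => absurd h hb'
    · simp only [Test.Holds, a4, a6] at hb
      refine next _ _ a5 ?_ (by omega)
      rw [a7, a9]
      exact hJ.skip fun _ h => absurd h hb
  · rintro c' s' hS ⟨h1, h2⟩
    rw [hN₁.m] at h1 h2
    have eL : s'.var vL = s.var vL := hS.var _ rfl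
    have eP : s'.rarr fP = s.rarr fP := hS.rarr _ rfl
    have eA : s'.rvar rA = s.rvar rA := hS.rvar _ rfl
    refine ⟨?_, by simp at h2; omega⟩
    rw [Search, eL, eP, eA]
    exact h1.dijkstra

theorem wp_check {N : Network} {s : State} {c : ℕ} (hN : Loaded N s) (hF : s.var vF = 0)
    (hc : 17 * N.m + 2 ≤ c) :
    WP checkP (fun c' s' =>
      ((s'.var vF = 0 ∧ ∀ e < N.m, N.lev (N.tl e) = s.var vL → s.var vL < N.lev (N.hd e) →
        0 ≤ N.W (N.tl e) (N.hd e) - s.rarr fP (N.hd e) + s.rarr fD (N.hd e)) ∨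
      (s'.var vF = 1 ∧ ∃ e < N.m, N.lev (N.tl e) = s.var vL ∧ s.var vL < N.lev (N.hd e) ∧
        N.W (N.tl e) (N.hd e) - s.rarr fP (N.hd e) + s.rarr fD (N.hd e) < 0 ∧
        s'.var vS = N.hd e)) ∧
      c ≤ c' + 17 * N.m + 2) c s := by
  refine WP.chain_cons (WP.block (by simp) (by simp; omega) (WP.chain_singleton ?_))
  have hN₁ := hN.frame (same_block [const vI 0] s) rfl
  refine (WP.for_lt (K := 16) (fun i s' =>
      (s'.var vF = 0 ∧ ∀ e < i, N.lev (N.tl e) = s.var vL → s.var vL < N.lev (N.hd e) →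
        0 ≤ N.W (N.tl e) (N.hd e) - s.rarr fP (N.hd e) + s.rarr fD (N.hd e)) ∨
      (s'.var vF = 1 ∧ ∃ e < N.m, N.lev (N.tl e) = s.var vL ∧ s.var vL < N.lev (N.hd e) ∧
        N.W (N.tl e) (N.hd e) - s.rarr fP (N.hd e) + s.rarr fD (N.hd e) < 0 ∧
        s'.var vS = N.hd e)) rfl ?_ rfl ?_
        (by rw [hN₁.m]; simp; omega)).conseq ?_
  · exact .inl ⟨hF, by simp⟩
  · intro i hi c' s' hS hI hJ hc'
    have hN' := hN₁.frame hS rfl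
    rw [hN₁.m] at hi
    have eL : s'.var vL = s.var vL := hS.var _ rfl
    have eP : s'.rarr fP = s.rarr fP := hS.rarr _ rfl
    have eD : s'.rarr fD = s.rarr fD := hS.rarr _ rfl
    refine WP.chain_cons (wp_load_edge hN' (by omega) (by omega) ?_)
    rw [hI]
    intro s₂ a1 a2 a3 a4 a5 a6 a10 a11 a7 a8 a9
    rw [eL] at a6
    have next : ∀ c₂ s₃, s₃.var vI = i →
        ((s₃.var vF = s₂.var vF ∧ s₃.var vS = s₂.var vS ∧
          (N.lev (N.tl i) = s.var vL → s.var vL < N.lev (N.hd i) →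
          0 ≤ N.W (N.tl i) (N.hd i) - s.rarr fP (N.hd i) + s.rarr fD (N.hd i))) ∨
        (s₃.var vF = 1 ∧ s₃.var vS = N.hd i ∧ N.lev (N.tl i) = s.var vL ∧
          s.var vL < N.lev (N.hd i) ∧
          N.W (N.tl i) (N.hd i) - s.rarr fP (N.hd i) + s.rarr fD (N.hd i) < 0)) →
        c' ≤ c₂ + 15 →
        WP (chain [block [succ vI vI]]) (fun c'' s'' => s''.var vI = i + 1 ∧
          ((s''.var vF = 0 ∧ ∀ e < i + 1, N.lev (N.tl e) = s.var vL → s.var vL < N.lev (N.hd e) →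
            0 ≤ N.W (N.tl e) (N.hd e) - s.rarr fP (N.hd e) + s.rarr fD (N.hd e)) ∨
          (s''.var vF = 1 ∧ ∃ e < N.m, N.lev (N.tl e) = s.var vL ∧ s.var vL < N.lev (N.hd e) ∧
            N.W (N.tl e) (N.hd e) - s.rarr fP (N.hd e) + s.rarr fD (N.hd e) < 0 ∧
            s''.var vS = N.hd e)) ∧ c' ≤ c'' + 16) c₂ s₃ := by
      intro c₂ s₃ b1 b2 b3
      refine WP.chain_singleton (WP.block (by simp) (by simp; omega)
        ⟨congrArg (· + 1) b1, ?_, by simp; omega⟩)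
      change (s₃.var vF = 0 ∧ _) ∨ (s₃.var vF = 1 ∧ ∃ e < N.m, _ ∧ _ ∧ _ ∧ s₃.var vS = _)
      rcases b2 with ⟨b2, b4, b5⟩ | ⟨b2, b4, b5, b6, b7⟩
      · rw [b2, b4, a10, a11]
        refine hJ.imp_left fun ⟨g1, g2⟩ => ⟨g1, fun e he h1 h2 => ?_⟩
        rcases Nat.lt_succ_iff_lt_or_eq.1 he with he | rfl
        · exact g2 e he h1 h2
        · exact b5 h1 h2
      · exact .inr ⟨b2, i, hi, b5, b6, b7, b4⟩
    refine WP.chain_cons (WP.ite (by omega) (fun hb => ?_) (fun hb => WP.skip (by omega) ?_))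
    · simp only [Test.Holds, a3, a6] at hb
      refine WP.ite (by omega) (fun hb' => ?_) (fun hb' => WP.skip (by omega) ?_)
      · simp only [Test.Holds, a4, a6] at hb'
        refine WP.chain_cons (WP.block (by simp) (by simp; omega) (WP.chain_singleton ?_))
        generalize hs₃ : List.foldl _ _ _ = s₃
        have b1 : s₃.rvar rT =
            N.W (N.tl i) (N.hd i) - s.rarr fP (N.hd i) + s.rarr fD (N.hd i) := by
          have : s₃.rvar rT = s₂.rarr fW (s₂.var vI) - s₂.rarr fP (s₂.var vB) +
              s₂.rarr fD (s₂.var vB) := by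
            rw [← hs₃]; rfl
          rw [this, a2, a9, eP, eD, a5, hN'.weight i hi]
        have b2 : s₃.rvar rZ = 0 := by
          rw [← hN'.rzero, ← a8, ← hs₃]; rfl
        have b3 : s₃.var = s₂.var := by rw [← hs₃]; rfl
        clear hs₃
        simp only [List.length_cons, List.length_nil]
        refine WP.ite (by omega) (fun hb'' => WP.block (by simp) (by simp; omega) ?_)
          (fun hb'' => WP.skip (by omega) ?_)
        · simp only [Test.Holds, b1, b2] at hb''
          refine next _ _ (by simp [Instr.apply, b3, a5]) (.inr ⟨?_, ?_, hb, hb', hb''⟩)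
            (by simp; omega)
          · simp [Instr.apply]
          · simp [Instr.apply, b3, a2]
        · simp only [Test.Holds, b1, b2, not_lt] at hb''
          exact next _ _ (by rw [b3, a5]) (.inl ⟨by rw [b3], by rw [b3], fun _ _ => hb''⟩)
            (by omega)
      · simp only [Test.Holds, a4, a6] at hb'
        exact next _ _ a5 (.inl ⟨rfl, rfl, fun _ h => absurd h hb'⟩) (by omega)
    · simp only [Test.Holds, a3, a6] at hb
      exact next _ _ a5 (.inl ⟨rfl, rfl, fun h => absurd h hb⟩) (by omega)
  · rintro c' s' hS ⟨h1, h2⟩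
    rw [hN₁.m] at h1 h2
    exact ⟨h1, by simp at h2; omega⟩

theorem wp_update {N : Network} {s : State} {c : ℕ} (hN : Loaded N s) (hc : 9 * N.n + 2 ≤ c) :
    WP updateP (fun c' s' => (∀ v < N.n, s'.rarr fP v =
      if s.var vL < N.lev v then s.rarr fP v - s.rarr fD v else s.rarr fP v) ∧
      c ≤ c' + 9 * N.n + 2) c s := by
  refine WP.chain_cons (WP.block (by simp) (by simp; omega) (WP.chain_singleton ?_))
  have hN₁ := hN.frame (same_block [const vI 0] s) rfl
  refine (WP.for_lt (K := 8) (fun i s' => ∀ v < N.n, s'.rarr fP v =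
      if v < i ∧ s.var vL < N.lev v then s.rarr fP v - s.rarr fD v else s.rarr fP v) rfl
      (fun v _ => by simp [Instr.apply]) rfl ?_ (by rw [hN₁.n]; simp; omega)).conseq ?_
  · intro i hi c' s' hS hI hJ hc'
    have hN' := hN₁.frame hS rfl
    rw [hN₁.n] at hi
    have eL : s'.var vL = s.var vL := hS.var _ rfl
    have eD : s'.rarr fD = s.rarr fD := hS.rarr _ rfl
    have hlev := hN'.lev i hi
    refine WP.chain_cons (WP.block (by simp) (by simp; omega) ?_)
    refine WP.chain_cons (WP.ite (by simp; omega)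
      (fun hb => WP.block (by simp) (by simp; omega) (WP.chain_singleton ?_))
      (fun hb => WP.skip (by simp; omega) (WP.chain_singleton ?_)))
    · simp [Instr.apply, Test.Holds, hI, eL, hlev] at hb
      refine WP.block (by simp) (by simp; omega)
        ⟨congrArg (· + 1) hI, fun v hv => ?_, by simp; omega⟩
      simp [Instr.apply, hI, update_apply, eD]
      have h1 := hJ v hv
      have h2 := hJ i hi
      grind
    · simp [Instr.apply, Test.Holds, hI, eL, hlev] at hb
      refine WP.block (by simp) (by simp; omega)
        ⟨congrArg (· + 1) hI, fun v hv => ?_, by simp; omega⟩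
      simp [Instr.apply]
      have h1 := hJ v hv
      grind
  · rintro c' s' - ⟨h1, h2⟩
    rw [hN₁.n] at h1 h2
    refine ⟨fun v hv => ?_, by simp at h2; omega⟩
    rw [h1 v hv]
    simp [hv]

/-- The first vertex of level `l` ends the cycle, so the level serves as the stopping test. The
output overwrites the tails of the edges; this is allowed because the algorithm stops after finding
a cycle. -/
theorem wp_cycle {N : Network} {s : State} {c l d : ℕ} (hN : Loaded N s) (hl : s.var vL = l)
    (hx : N.NegativeCycle l (s.arr aNxt) (s.var vS) d) (hc : 5 * d + 10 ≤ c) :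
    WP cycleP (fun c' s' => (∀ j ≤ d, s'.arr aTl j = (s.arr aNxt)^[j] (s.var vS)) ∧
      s'.var vS = d + 1 ∧ c ≤ c' + 5 * d + 10) c s := by
  have hlev : ∀ j ≤ d, s.arr aLev ((s.arr aNxt)^[j] (s.var vS)) =
      N.lev ((s.arr aNxt)^[j] (s.var vS)) := fun j hj => hN.lev _ (hx.lt hj)
  refine WP.chain_cons (WP.block (by simp) (by simp; omega) (WP.chain_cons ?_))
  refine WP.loop (fun c' s' => s'.var vI ≤ d ∧ s'.var vC = (s.arr aNxt)^[s'.var vI] (s.var vS) ∧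
    s'.var vA = N.lev (s'.var vC) ∧
    (∀ j < s'.var vI, s'.arr aTl j = (s.arr aNxt)^[j] (s.var vS)) ∧
    c ≤ c' + 5 * s'.var vI + 3) ?_ ?_
  · exact ⟨Nat.zero_le _, rfl, hlev 0 (Nat.zero_le _), by simp [Instr.apply], by simp; omega⟩
  · rintro c' s' hS ⟨h1, h2, h3, h4, h5⟩
    have eL : s'.var vL = s.var vL := hS.var _ rfl
    have eN : s'.arr aNxt = s.arr aNxt := hS.arr _ rfl
    have eV : s'.arr aLev = s.arr aLev := hS.arr _ rfl
    have htl : ∀ j < s'.var vI + 1, update (s'.arr aTl) (s'.var vI) (s'.var vC) j =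
        (s.arr aNxt)^[j] (s.var vS) := by
      intro j hj
      rcases Nat.lt_succ_iff_lt_or_eq.1 hj with hj | rfl
      · rw [update_of_ne hj.ne, h4 j hj]
      · rw [update_self, h2]
    refine ⟨by omega, fun ht => WP.block (by simp) (by simp; omega) ?_,
      fun hf => WP.chain_singleton (WP.block (by simp) (by simp; omega) ?_)⟩
    · simp only [Test.Holds, eL, hl, h3, h2] at ht
      have hlt : s'.var vI < d := by
        refine lt_of_le_of_ne h1 fun hh => ht ?_
        rw [hh, hx.level]
      have hnext : s.arr aNxt (s'.var vC) = (s.arr aNxt)^[s'.var vI + 1] (s.var vS) := by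
        rw [h2, iterate_succ_apply']
      simp [Instr.apply, eN, eV, hnext]
      exact ⟨hlt, hlev _ hlt, fun j hj => htl j (by omega), by omega⟩
    · simp only [Test.Holds, eL, hl, h3, h2, not_not] at hf
      have hd : s'.var vI = d := by
        by_contra hne
        have := hx.above (s'.var vI) (by omega)
        omega
      simp [Instr.apply]
      rw [← hd]
      exact ⟨fun j hj => htl j (by omega), rfl, by omega⟩

theorem wp_output {N : Network} {s : State} {c : ℕ} (hN : Loaded N s) (hc : 4 * N.n + 3 ≤ c) :
    WP outputP (fun _ s' => s'.var 0 = 0 ∧ ∀ v < N.n, s'.rarr 0 v = s.rarr fP v) c s := by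
  refine WP.chain_cons (WP.block (by simp) (by simp; omega) (WP.chain_cons ?_))
  have hN₁ := hN.frame (same_block [const vI 0] s) rfl
  refine (WP.for_lt (K := 3) (fun i s' => ∀ v < i, s'.rarr fW v = s.rarr fP v) rfl (by simp) rfl ?_
    (by rw [hN₁.n]; simp; omega)).conseq ?_
  · intro i hi c' s' hS hI hJ hc'
    have eP : s'.rarr fP = s.rarr fP := hS.rarr _ rfl
    refine WP.block (by simp) (by simp; omega) ⟨congrArg (· + 1) hI, fun v hv => ?_, by simp; omega⟩
    simp [Instr.apply, hI, eP]
    rcases Nat.lt_succ_iff_lt_or_eq.1 hv with hv | rfl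
    · rw [update_of_ne hv.ne, hJ v hv]
    · rw [update_self]
  · rintro c' s' - ⟨h1, h2⟩
    rw [hN₁.n] at h1 h2
    refine WP.chain_singleton (WP.block (by simp) (by simp at h2 ⊢; omega) ⟨rfl, h1⟩)

end RealRAM

/-! ### One round, the preprocessing and the whole algorithm -/

namespace Network

theorem PotentialAbove.congr {N : Network} {l : ℕ} {p q : ℕ → ℝ} (h : N.PotentialAbove l p)
    (hq : ∀ v < N.n, q v = p v) : N.PotentialAbove l q := by
  intro e he h1 h2
  rw [hq _ (N.tl_lt e he), hq _ (N.hd_lt e he)]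
  exact h e he h1 h2

end Network

namespace RealRAM
open Function Instr Test Program

/-- The real array `fP` holds a potential of the subgraph above the current level. -/
structure Extended (N : Network) (s : State) : Prop where
  loaded : Loaded N s
  pot : N.PotentialAbove (s.var vL) (s.rarr fP)
  pot_eq_zero : ∀ v < N.n, N.lev v ≤ s.var vL → s.rarr fP v = 0
  cnt : ∀ i, s.arr aCnt i = 0
  bk : ∀ i, s.arr aBk i = 0

/-- The word array `aTl` lists the vertices of a negative cycle, and `vS` is its length. -/
def ListsCycle (N : Network) (s : State) : Prop :=
  ∃ l nxt x d, N.NegativeCycle l nxt x d ∧ (∀ j ≤ d, s.arr aTl j = nxt^[j] x) ∧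
    s.var vS = d + 1

/-- Dijkstra's algorithm dominates with `2100 * n * (log n + 1) + 700 * m` and the initial potential
`235 * n`. The passes add small multiples of `n` and `m`, and `n ≤ n * (log n + 1)` leaves enough
room below 2400. -/
theorem wp_round {N : Network} {s : State} {c : ℕ} (h : Extended N s) (hF : s.var vF = 0)
    (hL : s.var vL ≠ 0) (hc : 2400 * (N.n * (Nat.log 2 N.n + 1) + N.m + 1) ≤ c) :
    WP roundP (fun c' s' => c ≤ c' + 2400 * (N.n * (Nat.log 2 N.n + 1) + N.m + 1) ∧
      ((s'.var vF = 0 ∧ s'.var vL + 1 = s.var vL ∧ Extended N s') ∨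
        (s'.var vF = 1 ∧ s'.var vL = 0 ∧ ListsCycle N s'))) c s := by
  obtain ⟨l, hl⟩ := Nat.exists_eq_succ_of_ne_zero hL
  have hn : N.n ≤ N.n * (Nat.log 2 N.n + 1) := Nat.le_mul_of_pos_right _ (Nat.succ_pos _)
  refine WP.chain_cons ((wp_cap h.loaded (by omega)).conseq ?_)
  rintro c₁ s₁ hS₁ ⟨hA, hc₁⟩
  have hN₁ := h.loaded.frame hS₁ rfl
  refine WP.chain_cons ((wp_init hN₁ (by omega)).conseq ?_)
  rintro c₂ s₂ hS₂ ⟨hD, hc₂⟩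
  have hN₂ := hN₁.frame hS₂ rfl
  have eA : s₂.rvar rA = s₁.rvar rA := hS₂.rvar _ rfl
  refine WP.chain_cons ((wp_seed hN₂ (fun v hv => (hD v hv).trans eA.symm) (by omega)).conseq ?_)
  rintro c₃ s₃ hS₃ ⟨hsearch, hc₃⟩
  have hN₃ := hN₂.frame hS₃ rfl
  have eL₃ : s₃.var vL = s.var vL :=
    ((hS₃.var _ rfl).trans (hS₂.var _ rfl)).trans (hS₁.var _ rfl)
  have eL₂ : s₂.var vL = s.var vL := (hS₂.var _ rfl).trans (hS₁.var _ rfl)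
  have eP₃ : s₃.rarr fP = s.rarr fP :=
    ((hS₃.rarr _ rfl).trans (hS₂.rarr _ rfl)).trans (hS₁.rarr _ rfl)
  have eC₃ : s₃.arr aCnt = s.arr aCnt :=
    ((hS₃.arr _ rfl).trans (hS₂.arr _ rfl)).trans (hS₁.arr _ rfl)
  have eB₃ : s₃.arr aBk = s.arr aBk :=
    ((hS₃.arr _ rfl).trans (hS₂.arr _ rfl)).trans (hS₁.arr _ rfl)
  have eA₃ : s₃.rvar rA = s₁.rvar rA := (hS₃.rvar _ rfl).trans eA
  have eF₃ : s₃.var vF = 0 :=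
    (((hS₃.var _ rfl).trans (hS₂.var _ rfl)).trans (hS₁.var _ rfl)).trans hF
  refine WP.chain_cons ((wp_build hN₃.zero (by rw [eC₃]; exact h.cnt) (by rw [eB₃]; exact h.bk)
    (by rw [hN₃.n]; omega)).conseq ?_)
  rintro c₄ s₄ hS₄ ⟨alive, hq, hpot, hc₄⟩
  have hN₄ := hN₃.frame hS₄ rfl
  have eL₄ : s₄.var vL = s.var vL := (hS₄.var _ rfl).trans eL₃
  have eP₄ : s₄.rarr fP = s.rarr fP := (hS₄.rarr _ rfl).trans eP₃
  have eA₄ : s₄.rvar rA = s₁.rvar rA := (hS₄.rvar _ rfl).trans eA₃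
  have eF₄ : s₄.var vF = 0 := (hS₄.var _ rfl).trans eF₃
  have eD₄ : s₄.rarr fD = s₃.rarr fD := hS₄.rarr _ rfl
  have eX₄ : s₄.arr aNxt = s₃.arr aNxt := hS₄.arr _ rfl
  rw [hN₃.n] at hpot hc₄ hq
  rw [Finset.filter_congr (q := fun v => s₂.var vL < N.lev v) (fun v hv => by
    rw [hN₃.lev v (Finset.mem_range.1 hv), eL₃, eL₂])] at hq
  generalize hQ : (Finset.range N.n).filter (fun v => s₂.var vL < N.lev v) = Q at hq hsearch
  have hQn : ∀ x ∈ Q, x < N.n := fun x hx => by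
    rw [← hQ] at hx; exact Finset.mem_range.1 (Finset.mem_filter.1 hx).1
  have hQc : Q.card ≤ N.n := by
    rw [← hQ]; exact (Finset.card_filter_le _ _).trans (Finset.card_range _).le
  have hQm := N.sum_length_inEdges_le hQn
  have hQK : 2100 * (Nat.log 2 N.n + 1) * Q.card ≤ 2100 * (N.n * (Nat.log 2 N.n + 1)) := by
    rw [Nat.mul_assoc, Nat.mul_comm N.n]
    exact Nat.mul_le_mul_left _ (Nat.mul_le_mul_left _ hQc)
  have hbudget : potential s₄ alive + 2100 * (Nat.log 2 N.n + 1) * Q.card +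
      700 * ∑ u ∈ Q, (N.inEdges u).length + 1 ≤
      235 * N.n + 2100 * (N.n * (Nat.log 2 N.n + 1)) + 700 * N.m + 1 := by
    generalize ∑ u ∈ Q, (N.inEdges u).length = S at hQm
    omega
  have hsearch₄ : Search N s₄ Q [] := by
    rw [Search, hS₄.var vL rfl, hS₄.rarr fP rfl, hS₄.rvar rA rfl, eD₄, eX₄]
    exact hsearch
  refine WP.chain_cons ((wp_dijkstra hN₄ hq hsearch₄ (by rw [eL₄, eP₄]; exact h.pot)
    (hbudget.trans (by omega))).conseq ?_)
  rintro c₅ s₅ hS₅ ⟨hsearch₅, hcnt, hbk, hc₅⟩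
  replace hc₅ : c₄ ≤ c₅ + (235 * N.n + 2100 * (N.n * (Nat.log 2 N.n + 1)) + 700 * N.m + 1) := by
    generalize ∑ u ∈ Q, (N.inEdges u).length = S at hbudget hc₅
    omega
  have hN₅ := hN₄.frame hS₅ rfl
  have eL₅ : s₅.var vL = l + 1 := ((hS₅.var _ rfl).trans eL₄).trans hl
  have eP₅ : s₅.rarr fP = s.rarr fP := (hS₅.rarr _ rfl).trans eP₄
  have eA₅ : s₅.rvar rA = s₁.rvar rA := (hS₅.rvar _ rfl).trans eA₄
  have eF₅ : s₅.var vF = 0 := (hS₅.var _ rfl).trans eF₄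
  rw [Search, eL₅, eP₅] at hsearch₅
  refine WP.chain_cons ((wp_check hN₅ eF₅ (by omega)).conseq ?_)
  rintro c₆ s₆ hS₆ ⟨hcheck, hc₆⟩
  have hN₆ := hN₅.frame hS₆ rfl
  have eL₆ : s₆.var vL = l + 1 := (hS₆.var _ rfl).trans eL₅
  have eP₆ : s₆.rarr fP = s.rarr fP := (hS₆.rarr _ rfl).trans eP₅
  have eD₆ : s₆.rarr fD = s₅.rarr fD := hS₆.rarr _ rfl
  have eX₆ : s₆.arr aNxt = s₅.arr aNxt := hS₆.arr _ rfl
  have eC₆ : s₆.arr aCnt = s₅.arr aCnt := hS₆.arr _ rfl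
  have eB₆ : s₆.arr aBk = s₅.arr aBk := hS₆.arr _ rfl
  rw [eL₅, eP₅] at hcheck
  have hz : ∀ v < N.n, N.lev v ≤ l + 1 → s.rarr fP v = 0 := by
    have := h.pot_eq_zero
    rwa [hl] at this
  refine WP.chain_singleton (WP.ite (by omega) (fun hb => ?_) (fun hb => ?_)) <;>
    simp only [Test.Holds, hN₆.zero] at hb
  · obtain ⟨-, hnonneg⟩ := hcheck.resolve_right (by omega)
    refine WP.chain_cons ((wp_update hN₆ (by omega)).conseq ?_)
    rintro c₇ s₇ hS₇ ⟨hP, hc₇⟩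
    have hN₇ := hN₆.frame hS₇ rfl
    have eL₇ : s₇.var vL = l + 1 := (hS₇.var _ rfl).trans eL₆
    have eF₇ : s₇.var vF = 0 := (hS₇.var _ rfl).trans hb
    rw [eL₆, eP₆, eD₆] at hP
    refine WP.chain_singleton (WP.block (by simp) (by simp; omega) ⟨by simp; omega, .inl ⟨eF₇, ?_,
      hN₇.frame (same_instr (.pred vL vL) _) rfl, ?_, ?_, ?_, ?_⟩⟩)
    · simp [Instr.apply, eL₇, hl]
    · simp only [List.foldl, Instr.apply, State.setVar_var_same, eL₇, State.setVar_rarr,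
        Nat.add_sub_cancel]
      exact (hsearch₅.potentialAbove hz hnonneg).congr hP
    · simp only [List.foldl, Instr.apply, State.setVar_var_same, eL₇, State.setVar_rarr,
        Nat.add_sub_cancel]
      intro v hv hvl
      rw [hP v hv, if_neg (by omega), hz v hv (by omega)]
    · rw [← eC₆, ← hS₇.arr aCnt rfl] at hcnt
      exact hcnt
    · rw [← eB₆, ← hS₇.arr aBk rfl] at hbk
      exact hbk
  · obtain ⟨-, e, he, h1, h2, h3, h4⟩ := hcheck.resolve_left (fun hh => hb hh.1)
    have h5 : s₆.var vF = 1 := (hcheck.resolve_left (fun hh => hb hh.1)).1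
    rw [hl] at hA
    obtain ⟨d, hd⟩ := hsearch₅.negativeCycle he h1 h2 (by rw [eA₅]; exact hA e he h1 h2) h3
    rw [← eX₆, ← h4] at hd
    have hdn := hd.length_lt
    refine WP.chain_cons ((wp_cycle hN₆ eL₆ hd (by omega)).conseq ?_)
    rintro c₇ s₇ hS₇ ⟨hj, hlen, hc₇⟩
    -- Setting the current level to zero makes the main loop stop.
    exact WP.chain_singleton (WP.block (by simp) (by simp; omega) ⟨by simp; omega,
      .inr ⟨(hS₇.var vF rfl).trans h5, rfl, l + 1, _, _, d, hd, hj, hlen⟩⟩)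

/-- Each vertex walks up to its root in at most `k` iterations. The total of `O(k * n)` steps is
within the time bound, so nothing cleverer is needed. -/
theorem wp_levels {s : State} {c k : ℕ} {lev : ℕ → ℕ}
    (hpar : ∀ v < s.var vN, (s.arr aPa v = s.var vN ∧ lev v = 1) ∨
      (s.arr aPa v < s.var vN ∧ lev v = lev (s.arr aPa v) + 1))
    (hk : ∀ v < s.var vN, lev v ≤ k) (hc : (4 * k + 10) * s.var vN + 10 ≤ c) :
    WP levelsP (fun c' s' => (∀ v < s.var vN, s'.arr aLev v = lev v ∧ lev v ≤ s'.var vL) ∧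
      s'.var vL ≤ k ∧ c ≤ c' + (4 * k + 10) * s.var vN + 10) c s := by
  refine WP.chain_cons (WP.block (by simp) (by simp; omega) (WP.chain_singleton ?_))
  refine (WP.for_lt (K := 4 * k + 9) (fun i s' => (∀ v < i, s'.arr aLev v = lev v ∧
    lev v ≤ s'.var vL) ∧ s'.var vL ≤ k) rfl ?_ rfl ?_ ?_).conseq ?_
  · exact ⟨by simp, Nat.zero_le _⟩
  · intro i hi c' s' hS hI ⟨hJ, hJk⟩ hc'
    have eN : s'.var vN = s.var vN := hS.var _ rfl
    have eP : s'.arr aPa = s.arr aPa := hS.arr _ rfl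
    replace hi : i < s.var vN := hi
    refine WP.chain_cons (WP.block (by simp) (by simp; omega) (WP.chain_cons ?_))
    -- Either the walk has left the forest, which the parent `n` of a root signals, or the number of
    -- steps so far plus the level of the present vertex is the level of `i`.
    refine WP.loop (fun c₂ s₂ => s₂.var vI = i ∧ s₂.var vL = s'.var vL ∧
      ((s₂.var vA = s.var vN ∧ s₂.var vC = lev i) ∨
        (s₂.var vA < s.var vN ∧ s₂.var vC + lev (s₂.var vA) = lev i)) ∧
      c' ≤ c₂ + 4 * s₂.var vC + 2) ?_ ?_
    · exact ⟨hI, rfl, .inr (by simp [Instr.apply, hI, hi]), by simp; omega⟩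
    · rintro c₂ s₂ hS₂ ⟨h1, h2, h3, h4⟩
      have eN₂ : s₂.var vN = s.var vN := (hS₂.var _ rfl).trans eN
      have eP₂ : s₂.arr aPa = s.arr aPa := (hS₂.arr _ rfl).trans eP
      have eV₂ : s₂.arr aLev = s'.arr aLev := hS₂.arr _ rfl
      have hki := hk i hi
      refine ⟨by omega, fun ht => WP.block (by simp) (by simp; omega) ?_, fun hf => ?_⟩
      · simp only [Test.Holds, eN₂] at ht
        obtain ⟨h5, h6⟩ := h3.resolve_left (fun hh => ht hh.1)
        have := hpar _ h5
        refine ⟨h1, h2, ?_, by simp [Instr.apply]; omega⟩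
        simp [Instr.apply, eP₂]
        omega
      · simp only [Test.Holds, eN₂, not_not] at hf
        obtain ⟨-, h6⟩ := h3.resolve_right (fun hh => by omega)
        have hlev : ∀ v < i + 1, update (s₂.arr aLev) i (s₂.var vC) v = lev v := by
          intro v hv
          rcases Nat.lt_succ_iff_lt_or_eq.1 hv with hv | rfl
          · rw [update_of_ne hv.ne, eV₂, (hJ v hv).1]
          · rw [update_self, h6]
        refine WP.chain_cons (WP.block (by simp) (by simp; omega) (WP.chain_singleton ?_))
        refine WP.ite (by simp; omega) (fun hb => WP.block (by simp) (by simp; omega) ?_)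
          (fun hb => WP.skip (by simp; omega) ?_) <;>
        simp [Instr.apply, Test.Holds, h1, h2, h6] at hb <;>
        simp only [List.foldl, Instr.apply, State.setVar_var_same, h1, h6, State.setVar_arr,
          State.setArr_arr_same, List.length_cons, List.length_nil]
        · refine ⟨by simp [h1], ⟨fun v hv => ⟨?_, ?_⟩, ?_⟩, by omega⟩
          · rw [← h6]; exact hlev v hv
          · simp [h6]
            rcases Nat.lt_succ_iff_lt_or_eq.1 hv with hv | rfl
            · exact (hJ v hv).2.trans hb.le
            · exact le_rfl
          · simp [h6]; exact hki
        · refine ⟨by simp [h1], ⟨fun v hv => ⟨?_, ?_⟩, ?_⟩, by omega⟩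
          · rw [← h6]; exact hlev v hv
          · simp [h2]
            rcases Nat.lt_succ_iff_lt_or_eq.1 hv with hv | rfl
            · exact (hJ v hv).2
            · exact hb
          · simp [h2]; exact hJk
  · change (4 * k + 10) * s.var vN + 1 ≤ c - 2
    omega
  · rintro c' s' - ⟨⟨h1, h2⟩, h3⟩
    replace h3 : c - 2 ≤ c' + (4 * k + 10) * s.var vN + 1 := h3
    exact ⟨h1, h2, by omega⟩

/-- Edges are pushed at the front of their list, which is why the lists contain the edge numbers in
decreasing order. -/
theorem wp_adjacency {N : Network} {s : State} {c : ℕ} (hm : s.var vM = N.m)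
    (hhd : ∀ e < N.m, s.arr aHd e = N.hd e) (hfst : ∀ u, s.arr aFst u = 0)
    (hc : 6 * N.m + 2 ≤ c) :
    WP adjacencyP (fun c' s' => (∀ u, IsLinked (s'.arr aNxe) (s'.arr aFst u) (N.inEdges u)) ∧
      c ≤ c' + 6 * N.m + 2) c s := by
  refine WP.chain_cons (WP.block (by simp) (by simp; omega) (WP.chain_singleton ?_))
  have hm₁ : (List.foldl (fun s i => i.apply s) s [const vI 0]).var vM = N.m := hm
  refine (WP.for_lt (K := 5) (fun i s' => ∀ u, IsLinked (s'.arr aNxe) (s'.arr aFst u)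
    ((List.range i).reverse.filter fun e => N.hd e = u)) rfl ?_ rfl ?_
    (by rw [hm₁]; simp; omega)).conseq ?_
  · exact hfst
  · intro i hi c' s' hS hI hJ hc'
    rw [hm₁] at hi
    have eH : s'.arr aHd i = N.hd i := by rw [hS.arr aHd rfl]; exact hhd i hi
    refine WP.block (by simp) (by simp; omega) ⟨?_, fun u => ?_, by simp; omega⟩
    · simp [Instr.apply, hI]
    · have hcongr : IsLinked (update (s'.arr aNxe) i (s'.arr aFst (N.hd i))) (s'.arr aFst u)
          ((List.range i).reverse.filter fun e => N.hd e = u) := by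
        refine (hJ u).congr fun e he => update_of_ne ?_ _ _
        have : e < i := by simpa using (List.mem_filter.1 he).1
        exact this.ne
      simp [Instr.apply, hI, eH, List.range_succ] at hcongr ⊢
      by_cases hu : N.hd i = u
      · subst hu
        simp [IsLinked]
        exact hcongr
      · rw [List.filter_cons_of_neg (by simpa using hu), update_of_ne (Ne.symm hu),
          List.filter_reverse]
        exact hcongr
  · rintro c' s' - ⟨h1, h2⟩
    rw [hm₁] at h1 h2
    exact ⟨h1, by simp at h2; omega⟩

theorem wp_table {s : State} {c : ℕ} (hz : s.var vZ = 0) (hc : 6 * s.var vN + 20 ≤ c) :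
    WP tableP (fun c' s' => (∀ x ≤ s.var vN, s'.arr aTq x = (3 * x + 3) / 4) ∧
      c ≤ c' + 6 * s.var vN + 20) c s := by
  refine WP.chain_cons (WP.block (by simp) (by simp; omega) (WP.chain_singleton ?_))
  -- With `vB ≤ 3`, the equation says that `vA` and `3 - vB` encode `⌈3 * vI / 4⌉` and the amount by
  -- which four times this value exceeds `3 * vI`.
  refine WP.loop (fun c' s' => s'.var vI ≤ s.var vN + 1 ∧
    4 * s'.var vA + s'.var vB = 3 * s'.var vI + 3 ∧ s'.var vB ≤ 3 ∧
    (∀ x < s'.var vI, s'.arr aTq x = (3 * x + 3) / 4) ∧ c ≤ c' + 6 * s'.var vI + 3) ?_ ?_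
  · simp [Instr.apply]; omega
  · rintro c' s' hS ⟨h1, h2, h3, h4, h5⟩
    have eZ : s'.var vZ = 0 := (hS.var _ rfl).trans hz
    have eN : s'.var vN = s.var vN := hS.var _ rfl
    refine ⟨by omega, fun ht => ?_, fun hf => ?_⟩
    · simp only [Test.Holds, eN] at ht
      have htab : ∀ x < s'.var vI + 1, update (s'.arr aTq) (s'.var vI) (s'.var vA) x =
          (3 * x + 3) / 4 := by
        intro x hx
        rcases Nat.lt_succ_iff_lt_or_eq.1 hx with hx | rfl
        · rw [update_of_ne hx.ne, h4 x hx]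
        · rw [update_self]; omega
      refine WP.chain_cons (WP.block (by simp) (by simp; omega) (WP.chain_singleton ?_))
      refine WP.ite (by simp; omega) (fun hb => WP.block (by simp) (by simp; omega) ?_)
        (fun hb => WP.block (by simp) (by simp; omega) ?_) <;>
      simp [Instr.apply, Test.Holds, eZ] at hb
      · refine ⟨by simp [Instr.apply]; omega, by simp [Instr.apply]; omega, by simp [Instr.apply],
          ?_, by simp [Instr.apply]; omega⟩
        simpa [Instr.apply] using htab
      · refine ⟨by simp [Instr.apply]; omega, by simp [Instr.apply]; omega,
          by simp [Instr.apply]; omega, ?_, by simp [Instr.apply]; omega⟩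
        simpa [Instr.apply] using htab
    · simp only [Test.Holds, eN] at hf
      exact ⟨fun x hx => h4 x (by omega), by omega⟩

/-- The memory holds the edges of the network and the parents in its elimination forest, whose
depth is at most `k`. -/
structure Input (N : Network) (k : ℕ) (s : State) : Prop where
  n : s.var vN = N.n
  m : s.var vM = N.m
  tl : ∀ e < N.m, s.arr aTl e = N.tl e
  hd : ∀ e < N.m, s.arr aHd e = N.hd e
  weight : ∀ e < N.m, s.rarr fW e = N.W (N.tl e) (N.hd e)
  parent : ∀ v < N.n, (s.arr aPa v = N.n ∧ N.lev v = 1) ∨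
    (s.arr aPa v < N.n ∧ N.lev v = N.lev (s.arr aPa v) + 1)
  lev_le : ∀ v < N.n, N.lev v ≤ k
  flag : s.var vF = 0
  zero : s.var vZ = 0
  rzero : s.rvar rZ = 0
  fst : ∀ u, s.arr aFst u = 0
  cnt : ∀ i, s.arr aCnt i = 0
  bk : ∀ i, s.arr aBk i = 0
  pot : ∀ v, s.rarr fP v = 0

/-- The current level counts the remaining rounds, each with a credit for the loop test.
Preprocessing, including the `O(k * n)` computation of levels, and the output fit into the
difference between 2500 and 2400 and the extra summand `1` in `k + 1`. -/
theorem wp_main {N : Network} {s : State} {c k : ℕ} (h : Input N k s)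
    (hc : 2500 * ((k + 1) * (N.n * (Nat.log 2 N.n + 1) + N.m + 1)) ≤ c) :
    WP mainP (fun _ s' => (s'.var 0 = 0 ∧ N.PotentialAbove 0 (s'.rarr 0)) ∨
      (s'.var 0 = 1 ∧ ∃ l nxt x d, N.NegativeCycle l nxt x d ∧
        (∀ j ≤ d, s'.arr 0 j = nxt^[j] x) ∧ s'.var 1 = d + 1)) c s := by
  obtain ⟨X, hX⟩ : ∃ X, X = N.n * (Nat.log 2 N.n + 1) + N.m + 1 := ⟨_, rfl⟩
  have hn : N.n ≤ N.n * (Nat.log 2 N.n + 1) := Nat.le_mul_of_pos_right _ (Nat.succ_pos _)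
  rw [← hX] at hc
  have hkn : k * N.n ≤ k * X := Nat.mul_le_mul_left _ (by omega)
  have hk : k ≤ k * X := Nat.le_mul_of_pos_right _ (by omega)
  have e1 : (k + 1) * X = k * X + X := by ring
  have e2 : (4 * k + 10) * N.n = 4 * (k * N.n) + 10 * N.n := by ring
  rw [e1] at hc
  refine WP.chain_cons ((wp_levels (k := k) (lev := N.lev) (by rw [h.n]; exact h.parent)
    (by rw [h.n]; exact h.lev_le) (by rw [h.n, e2]; omega)).conseq ?_)
  rintro c₁ s₁ hS₁ ⟨hlev, hL, hc₁⟩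
  rw [h.n] at hlev hc₁
  rw [e2] at hc₁
  refine WP.chain_cons ((wp_adjacency (N := N) ((hS₁.var _ rfl).trans h.m)
    (by rw [hS₁.arr _ rfl]; exact h.hd) (by rw [hS₁.arr _ rfl]; exact h.fst)
    (by omega)).conseq ?_)
  rintro c₂ s₂ hS₂ ⟨hadj, hc₂⟩
  have en₂ : s₂.var vN = N.n := ((hS₂.var _ rfl).trans (hS₁.var _ rfl)).trans h.n
  refine WP.chain_cons ((wp_table (((hS₂.var _ rfl).trans (hS₁.var _ rfl)).trans h.zero)
    (by rw [en₂]; omega)).conseq ?_)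
  rintro c₃ s₃ hS₃ ⟨htab, hc₃⟩
  rw [en₂] at htab hc₃
  have eL : s₃.var vL = s₁.var vL := (hS₃.var _ rfl).trans (hS₂.var _ rfl)
  have eF : s₃.var vF = 0 :=
    (((hS₃.var _ rfl).trans (hS₂.var _ rfl)).trans (hS₁.var _ rfl)).trans h.flag
  have eP : s₃.rarr fP = s.rarr fP :=
    ((hS₃.rarr _ rfl).trans (hS₂.rarr _ rfl)).trans (hS₁.rarr _ rfl)
  have hN₃ : Loaded N s₃ := by
    refine ⟨?_, ?_, ?_, ?_, ?_, ?_, ?_, ?_, ?_, htab⟩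
    · rw [hS₃.var _ rfl]; exact en₂
    · rw [hS₃.var _ rfl, hS₂.var _ rfl, hS₁.var _ rfl]; exact h.m
    · rw [hS₃.var _ rfl, hS₂.var _ rfl, hS₁.var _ rfl]; exact h.zero
    · rw [hS₃.rvar _ rfl, hS₂.rvar _ rfl, hS₁.rvar _ rfl]; exact h.rzero
    · rw [hS₃.arr _ rfl, hS₂.arr _ rfl, hS₁.arr _ rfl]; exact h.tl
    · rw [hS₃.arr _ rfl, hS₂.arr _ rfl, hS₁.arr _ rfl]; exact h.hd
    · rw [hS₃.rarr _ rfl, hS₂.rarr _ rfl, hS₁.rarr _ rfl]; exact h.weight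
    · rw [hS₃.arr _ rfl, hS₂.arr _ rfl]; exact fun v hv => (hlev v hv).1
    · rw [hS₃.arr _ rfl, hS₃.arr _ rfl]; exact fun u _ => hadj u
  -- No vertex lies beyond the maximum level, so the zero function is a potential there.
  have hE₃ : Extended N s₃ := by
    refine ⟨hN₃, fun e he hlt => ?_, fun v _ _ => by rw [eP, h.pot], ?_, ?_⟩
    · have := (hlev _ (N.tl_lt e he)).2
      omega
    · rw [hS₃.arr _ rfl, hS₂.arr _ rfl, hS₁.arr _ rfl]; exact h.cnt
    · rw [hS₃.arr _ rfl, hS₂.arr _ rfl, hS₁.arr _ rfl]; exact h.bk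
  have hpos : ∀ v < N.n, 0 < N.lev v := fun v hv => by
    rcases h.parent v hv with hh | hh <;> omega
  refine WP.chain_cons ?_
  have hYk : (2400 * X + 1) * s₁.var vL ≤ (2400 * X + 1) * k := Nat.mul_le_mul_left _ hL
  have e3 : (2400 * X + 1) * k = 2400 * (k * X) + k := by ring
  refine WP.loop (fun c' s' => (2400 * X + 1) * s'.var vL + 4 * N.n + 10 ≤ c' ∧
    ((s'.var vF = 0 ∧ Extended N s') ∨ (s'.var vF = 1 ∧ s'.var vL = 0 ∧ ListsCycle N s')))
    ⟨by rw [eL]; omega, .inl ⟨eF, hE₃⟩⟩ ?_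
  rintro c' s' hS ⟨h1, h2⟩
  have eZ : s'.var vZ = 0 := (hS.var _ rfl).trans hN₃.zero
  refine ⟨by omega, fun ht => ?_, fun hf => ?_⟩
  · simp only [Test.Holds, eZ] at ht
    obtain ⟨h2, h3⟩ := h2.resolve_right (fun hh => ht hh.2.1)
    obtain ⟨l, hl⟩ := Nat.exists_eq_succ_of_ne_zero ht
    have e4 : (2400 * X + 1) * (l + 1) = (2400 * X + 1) * l + (2400 * X + 1) := by ring
    rw [hl, Nat.succ_eq_add_one, e4] at h1
    refine (wp_round h3 h2 ht (by rw [← hX]; omega)).conseq ?_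
    rw [← hX]
    rintro c'' s'' - ⟨h4, ⟨h5, h6, h7⟩ | ⟨h5, h6, h7⟩⟩
    · have e5 : s''.var vL = l := by omega
      rw [e5]
      exact ⟨by omega, .inl ⟨h5, h7⟩⟩
    · rw [h6]
      exact ⟨by omega, .inr ⟨h5, rfl, h7⟩⟩
  · simp only [Test.Holds, eZ, not_not] at hf
    refine WP.chain_singleton (WP.ite (by omega) (fun hb => ?_) (fun hb => ?_)) <;>
      simp only [Test.Holds, eZ] at hb
    · obtain ⟨-, h3⟩ := h2.resolve_right (fun hh => by omega)
      refine (wp_output h3.loaded (by omega)).conseq ?_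
      rintro c'' s'' - ⟨h4, h5⟩
      have := h3.pot
      rw [hf] at this
      exact .inl ⟨h4, this.congr h5⟩
    · obtain ⟨-, -, l, nxt, x, d, g1, g2, g3⟩ := h2.resolve_left (fun hh => hb hh.1)
      exact WP.block (by simp) (by simp; omega) (.inr ⟨rfl, l, nxt, x, d, g1, g2, g3⟩)

end RealRAM

/-! ### Ancestors and levels -/

namespace RootedForest

variable {V : Type*} {T : RootedForest V} {u v x : V}

theorem IsAncestor.antisymm (h : T.IsAncestor u v) (h' : T.IsAncestor v u) : u = v := by
  by_contra hne
  exact T.acyclic v (((Relation.reflTransGen_iff_eq_or_transGen.1 h).resolve_left hne).trans_left h')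

theorem IsAncestor.total (h : T.IsAncestor u v) (h' : T.IsAncestor x v) :
    T.IsAncestor x u ∨ T.IsAncestor u x :=
  Relation.ReflTransGen.total_of_right_unique
    (fun _ _ _ h₁ h₂ => Option.some_injective _ (h₁.symm.trans h₂)) h h'

theorem isAncestor_iff_of_parent (h : T.parent v = some u) :
    T.IsAncestor x v ↔ x = v ∨ T.IsAncestor x u := by
  rw [IsAncestor, Relation.ReflTransGen.cases_head_iff]
  refine or_congr eq_comm ⟨fun ⟨c, hc, hx⟩ => ?_, fun hx => ⟨u, h, hx⟩⟩
  obtain rfl := Option.some_injective _ (h.symm.trans hc)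
  exact hx

theorem level_eq_one (h : T.parent v = none) : T.level v = 1 := by
  rw [level, Set.ncard_eq_one]
  refine ⟨v, Set.eq_singleton_iff_unique_mem.2 ⟨.refl, fun x hx => ?_⟩⟩
  rcases Relation.ReflTransGen.cases_head_iff.1 hx with hx | ⟨c, hc, -⟩
  · exact hx.symm
  · simp [h] at hc

section Finite

variable [Finite V]

theorem IsAncestor.level_lt (h : T.IsAncestor u v) (hne : u ≠ v) : T.level u < T.level v :=
  Set.ncard_lt_ncard ⟨fun _ hx => h.trans hx, fun hs => hne (h.antisymm (hs .refl))⟩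

theorem level_eq_succ (h : T.parent v = some u) : T.level v = T.level u + 1 := by
  have h1 : {x | T.IsAncestor x v} = insert v {x | T.IsAncestor x u} :=
    Set.ext fun x => isAncestor_iff_of_parent h
  rw [level, h1, Set.ncard_insert_of_notMem, level]
  exact fun hv => T.acyclic v (.head' h hv)

theorem level_pos (T : RootedForest V) (v : V) : 0 < T.level v :=
  (Set.ncard_pos).2 ⟨v, .refl⟩

/-- The ancestors of `v` form a chain on which the level is strictly monotone, so those of level at
most that of `u` are ancestors of `u`. -/
theorem IsAncestor.isAncestor_and_level_eq_iff (h : T.IsAncestor u v) {l : ℕ} (hl : l ≤ T.level u) :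
    T.IsAncestor x u ∧ T.level x = l ↔ T.IsAncestor x v ∧ T.level x = l := by
  refine and_congr_left fun hx => ⟨fun hxu => h.trans hxu, fun hxv => ?_⟩
  refine (h.total hxv).elim id fun hux => ?_
  by_cases hne : u = x
  · exact hne ▸ .refl
  · have := hux.level_lt hne
    omega

end Finite

end RootedForest

/-! ### Translation between graphs and networks -/

namespace Network

/-- The network of an elimination forest of a directed graph whose edges are listed by `e`. -/
noncomputable def ofForest {n m : ℕ} (G : Digraph (Fin n)) (w : Fin n → Fin n → ℝ)
    (T : RootedForest (Fin n)) (e : Fin m ≃ {a : Fin n × Fin n // G.Adj a.1 a.2})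
    (hG : ∀ v, ¬ G.Adj v v) (hT : T.IsEliminationForest G) : Network where
  n := n
  m := m
  tl i := if h : i < m then ((e ⟨i, h⟩).1.1 : ℕ) else 0
  hd i := if h : i < m then ((e ⟨i, h⟩).1.2 : ℕ) else 0
  W u v := if h : u < n ∧ v < n then w ⟨u, h.1⟩ ⟨v, h.2⟩ else 0
  lev v := if h : v < n then T.level ⟨v, h⟩ else 0
  -- The set has at most one element, which `sInf` extracts; it is empty if there is no such
  -- ancestor, and the value is then `0`. The ends of an edge have equal ancestors because their
  -- sets coincide.
  anc l v := sInf {x | ∃ (hx : x < n) (hv : v < n),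
    T.IsAncestor ⟨x, hx⟩ ⟨v, hv⟩ ∧ T.level ⟨x, hx⟩ = l}
  tl_lt i hi := by rw [dif_pos hi]; exact Fin.is_lt _
  hd_lt i hi := by rw [dif_pos hi]; exact Fin.is_lt _
  lev_ne i hi := by
    have hadj := (e ⟨i, hi⟩).2
    have hne : (e ⟨i, hi⟩).1.1 ≠ (e ⟨i, hi⟩).1.2 := fun hh => hG _ (hh ▸ hadj)
    simp only [dif_pos hi, Fin.is_lt, dif_pos, Fin.eta]
    rcases hT _ _ hadj with h | h
    · exact (h.level_lt hne).ne
    · exact (h.level_lt hne.symm).ne'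
  anc_edge i hi l := by
    simp only [dif_pos hi, Fin.is_lt, dif_pos, Fin.eta, exists_true_left]
    intro h1 h2
    congr 1
    ext x
    refine exists_congr fun hx => ?_
    rcases hT _ _ (e ⟨i, hi⟩).2 with h | h
    · exact h.isAncestor_and_level_eq_iff h1
    · exact (h.isAncestor_and_level_eq_iff h2).symm
  anc_self v hv := by
    simp only [dif_pos hv]
    have : {x | ∃ (hx : x < n) (hv : v < n),
        T.IsAncestor ⟨x, hx⟩ ⟨v, hv⟩ ∧ T.level ⟨x, hx⟩ = T.level ⟨v, hv⟩} = {v} := by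
      refine Set.eq_singleton_iff_unique_mem.2 ⟨⟨hv, hv, .refl, rfl⟩, ?_⟩
      rintro x ⟨hx, _, h1, h2⟩
      by_contra hne
      exact (h1.level_lt fun hh => hne (congrArg Fin.val hh)).ne h2
    simp only [hv, exists_true_left] at this ⊢
    rw [this, csInf_singleton]

section OfForest

variable {n m : ℕ} {G : Digraph (Fin n)} {w : Fin n → Fin n → ℝ} {T : RootedForest (Fin n)}
  {e : Fin m ≃ {a : Fin n × Fin n // G.Adj a.1 a.2}} {hG : ∀ v, ¬ G.Adj v v}
  {hT : T.IsEliminationForest G}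

theorem edge_ofForest {u v : Fin n} : (ofForest G w T e hG hT).Edge u v ↔ G.Adj u v := by
  constructor
  · rintro ⟨i, hi, h1, h2⟩
    simp only [ofForest] at hi h1 h2
    rw [dif_pos hi] at h1 h2
    rw [← Fin.ext h1, ← Fin.ext h2]
    exact (e ⟨i, hi⟩).2
  · intro h
    refine ⟨e.symm ⟨(u, v), h⟩, Fin.is_lt _, ?_, ?_⟩ <;> simp [ofForest]

theorem W_ofForest (u v : Fin n) : (ofForest G w T e hG hT).W u v = w u v := by
  simp [ofForest]

theorem isPotential_ofForest {p : ℕ → ℝ} (h : (ofForest G w T e hG hT).PotentialAbove 0 p) :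
    IsPotential G w fun v => p v := by
  intro u v huv
  obtain ⟨i, hi, h1, h2⟩ := (edge_ofForest (w := w) (hG := hG) (hT := hT) (e := e)).2 huv
  have := h i hi
  rw [h1, h2, W_ofForest] at this
  refine this ?_ ?_ <;> simp [ofForest, T.level_pos]

theorem NegativeCycle.isNegativeCycle {l : ℕ} {nxt : ℕ → ℕ} {x d : ℕ}
    (h : (ofForest G w T e hG hT).NegativeCycle l nxt x d) :
    IsNegativeCycle G w (l := d) fun i => ⟨nxt^[i] x, h.lt (Nat.lt_succ_iff.1 i.2)⟩ := by
  refine ⟨fun i j hij => ?_, fun i =>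
    (edge_ofForest (w := w) (e := e) (hG := hG) (hT := hT)).1 ?_, ?_⟩
  · have hij' : nxt^[i] x = nxt^[j] x := congrArg Fin.val hij
    rcases lt_trichotomy i j with hlt | heq | hlt
    · exact absurd hij' (h.injective hlt (Nat.lt_succ_iff.1 j.2))
    · exact heq
    · exact absurd hij'.symm (h.injective hlt (Nat.lt_succ_iff.1 i.2))
  · induction i using Fin.lastCases with
    | last =>
      -- Addition wraps around at the last index, which yields the closing edge.
      rw [Fin.last_add_one]
      exact h.last
    | cast i =>
      rw [Fin.coeSucc_eq_succ]
      exact h.edge i i.2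
  · have hneg := h.neg
    rw [Finset.sum_range] at hneg
    rw [Fin.sum_univ_castSucc, Fin.last_add_one]
    refine lt_of_eq_of_lt ?_ hneg
    congr 1
    · refine Finset.sum_congr rfl fun i _ => ?_
      rw [Fin.coeSucc_eq_succ]
      exact (W_ofForest _ _).symm
    · exact (W_ofForest _ _).symm

theorem input_ofForest : RealRAM.Input (ofForest G w T e hG hT) T.depth (inputState G w T e) := by
  refine ⟨rfl, rfl, fun i hi => rfl, fun i hi => rfl, fun i hi => ?_, fun v hv => ?_, fun v hv => ?_,
    rfl, rfl, rfl, fun _ => rfl, fun _ => rfl, fun _ => rfl, fun _ => rfl⟩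
  · simp only [ofForest] at hi
    simp [ofForest, inputState, hi]
  · simp only [ofForest] at hv
    have h1 : (inputState G w T e).arr 2 v = (T.parent ⟨v, hv⟩).elim n (fun u => (u : ℕ)) := by
      simp [inputState, hv]
    simp only [h1, ofForest, dif_pos hv]
    clear h1
    cases hp : T.parent ⟨v, hv⟩ with
    | none => left; simp [T.level_eq_one hp]
    | some u => right; simp [T.level_eq_succ hp]
  · simp only [ofForest] at hv ⊢
    rw [dif_pos hv]
    exact Finset.le_sup (f := T.level) (Finset.mem_univ _)

end OfForest

end Network

/-! ### The bound with the natural logarithm -/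

theorem RootedForest.depth_le_card {V : Type*} [Fintype V] (T : RootedForest V) :
    T.depth ≤ Fintype.card V :=
  Finset.sup_le fun _ _ => (Set.ncard_le_card _).trans Nat.card_eq_fintype_card.le

theorem edges_eq_zero_of_le_one {n m : ℕ} {G : Digraph (Fin n)}
    (e : Fin m ≃ {a : Fin n × Fin n // G.Adj a.1 a.2}) (hG : ∀ v, ¬ G.Adj v v) (hn : n ≤ 1) :
    m = 0 := by
  have : IsEmpty {a : Fin n × Fin n // G.Adj a.1 a.2} := by
    refine ⟨fun a => hG a.1.1 ?_⟩
    have h : a.1.1 = a.1.2 := by ext; omega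
    exact h.symm ▸ a.2
  rw [← Fintype.card_fin m, Fintype.card_eq_zero_iff]
  exact e.isEmpty

/-- For `n ≥ 2` one has `1 / 2 ≤ Real.log n` and `Nat.log 2 n ≤ 2 * Real.log n`. Hence the inner
factor is at most `5 * (m + n * Real.log n)`, and `k + 1 ≤ 2 * k` gives `2500 * 5 * 2 = 25000`. -/
theorem steps_le {n m k : ℕ} (h2 : 2 ≤ n) (hk : 1 ≤ k) :
    ((2500 * ((k + 1) * (n * (Nat.log 2 n + 1) + m + 1)) : ℕ) : ℝ) ≤
      25000 * ((k : ℝ) * ((m : ℝ) + (n : ℝ) * Real.log n) + 1) := by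
  have hn0 : (2 : ℝ) ≤ n := by exact_mod_cast h2
  have hk0 : (1 : ℝ) ≤ k := by exact_mod_cast hk
  have hm0 : (0 : ℝ) ≤ m := by positivity
  have hlog2 : (1 / 2 : ℝ) ≤ Real.log 2 := by have := Real.log_two_gt_d9; linarith
  have hlogn : Real.log 2 ≤ Real.log n := Real.log_le_log (by norm_num) hn0
  have hlog : (Nat.log 2 n : ℝ) ≤ 2 * Real.log n := by
    have h1 : ((2 ^ Nat.log 2 n : ℕ) : ℝ) ≤ n := by
      exact_mod_cast Nat.pow_log_le_self 2 (by omega)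
    have h3 := Real.log_le_log (by positivity) h1
    rw [Nat.cast_pow, Real.log_pow, Nat.cast_ofNat] at h3
    have h4 : (0 : ℝ) ≤ Nat.log 2 n := by positivity
    nlinarith
  have hX : (n : ℝ) * (Nat.log 2 n + 1) + m + 1 ≤ 5 * (m + n * Real.log n) := by
    nlinarith
  have hY : (0 : ℝ) ≤ m + n * Real.log n := by
    have : 0 ≤ Real.log n := by linarith
    positivity
  push_cast
  nlinarith [mul_le_mul_of_nonneg_left hX (by linarith : (0 : ℝ) ≤ k + 1),
    mul_le_mul_of_nonneg_right hk0 hY]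

/-- One program and one constant serve all inputs.  The summand `1` only matters for graphs with at
most one vertex, where `k * (m + n * log n) = 0`. -/
theorem theorem5 :
    ∃ (P : RealRAM.Program) (C : ℝ),
      ∀ (n m k : ℕ) (G : Digraph (Fin n)) (w : Fin n → Fin n → ℝ) (T : RootedForest (Fin n))
        (e : Fin m ≃ {a : Fin n × Fin n // G.Adj a.1 a.2}),
        (∀ v, ¬ G.Adj v v) → T.IsEliminationForest G → T.depth = k →
          ∃ (t : ℕ) (s : RealRAM.State),
            RealRAM.Exec P (inputState G w T e) t s ∧
            (t : ℝ) ≤ C * ((k : ℝ) * ((m : ℝ) + (n : ℝ) * Real.log n) + 1) ∧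
            (OutputsPotential G w s ∨ OutputsNegativeCycle G w s) := by
  refine ⟨RealRAM.mainP, 25000, fun n m k G w T e hG hT hk => ?_⟩
  obtain ⟨t, s, hexec, ht, hout⟩ := RealRAM.wp_main
    (Network.input_ofForest (G := G) (w := w) (T := T) (e := e) (hG := hG) (hT := hT)) le_rfl
  refine ⟨t, s, hexec, ?_, ?_⟩
  · rw [hk] at ht
    have hkn : k ≤ n := hk ▸ T.depth_le_card.trans (Fintype.card_fin n).le
    rcases Nat.lt_or_ge n 2 with hn | hn
    · have hm := edges_eq_zero_of_le_one e hG (by omega)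
      have h0 : 0 ≤ (k : ℝ) * ((m : ℝ) + (n : ℝ) * Real.log n) := by
        have : 0 ≤ Real.log n := Real.log_natCast_nonneg n
        positivity
      have h1 : t ≤ 25000 := by
        refine ht.trans ?_
        simp only [Network.ofForest, hm]
        -- Here `m = 0` and `k ≤ n ≤ 1`; the largest value is `10000`, for `n = k = 1`.
        interval_cases n <;> interval_cases k <;> norm_num
      have h2 : (t : ℝ) ≤ 25000 := by exact_mod_cast h1
      linarith
    · refine (Nat.cast_le.2 ht).trans (steps_le hn ?_)
      rw [← hk]
      exact (T.level_pos ⟨0, by omega⟩).trans_le (Finset.le_sup (f := T.level) (Finset.mem_univ _))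
  · refine hout.imp (fun ⟨h1, h2⟩ => ⟨h1, Network.isPotential_ofForest h2⟩) ?_
    rintro ⟨h1, l, nxt, x, d, h2, h3, h4⟩
    exact ⟨h1, d, _, h4, fun i => h3 i (Nat.lt_succ_iff.1 i.2), h2.isNegativeCycle⟩
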